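/- **Notation.** Let $X$ be a complex Banach space, $T$ a bounded linear operator on $X$, and $\alpha\ge 0$. For real $\beta\ge0$ put $$k^{\beta}(n)=\frac{\beta(\beta+1)\cdots(\beta+n-1)}{n!}\quad(n\ge 0,\ k^\beta(0)=1),\qquad \Delta^{-\alpha}\mathcal T(n)=\sum_{j=0}^n k^{\alpha}(n-j)\,T^j .$$ $T$ is *$(C,\alpha)$-bounded* if $\sup_{n\ge0}\big\|\Delta^{-\alpha}\mathcal T(n)\big\|/k^{\alpha+1}(n)<\infty$. Let $A^\alpha(\mathbb D)$ be the set of functions $\mathfrak f(z)=\sum_{n\ge0}f(n)z^n$ on the open unit disc for which there is a (necessarily unique) complex sequence $W^\alpha f$ with $\sum_n|W^\alpha f(n)|\,k^{\alpha+1}(n)<\infty$ and $f(n)=\sum_{j\ge n}k^\alpha(j-n)\,W^\alpha f(j)$ for all $n\ge0$. If $T$ is $(C,\alpha)$-bounded, put $\mathfrak f(T)=\sum_{n\ge0}W^\alpha f(n)\,\Delta^{-\alpha}\mathcal T(n)$ for $\mathfrak f\in A^\alpha(\mathbb D)$. If $\mathfrak f$ is holomorphic on $\mathbb D$ and there is $\mathfrak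 e\in A^\alpha(\mathbb D)$ with $\mathfrak e\mathfrak f\in A^\alpha(\mathbb D)$ and $\mathfrak e(T)$ injective, put $\mathfrak f(T)=\mathfrak e(T)^{-1}(\mathfrak e\mathfrak f)(T)$, that is, $x\in\operatorname{Dom}\mathfrak f(T)$ and $\mathfrak f(T)x=y$ if and only if $\mathfrak e(T)y=(\mathfrak e\mathfrak f)(T)x$ (this does not depend on $\mathfrak e$). The operator $\log(I-T)$ is $\mathfrak f(T)$ for $\mathfrak f(z)=\log(1-z)$ (principal branch). **Theorem 8.5 (LOG).** Let $\alpha\ge0$, let $T$ be a $(C,\alpha)$-bounded operator on a complex Banach space $X$ such that the range of $I-T$ is dense in $X$, and let $x\in X$. The following are equivalent: (i) $x\in\operatorname{Dom}\log(I-T)$; (ii) the series $\displaystyle\sum_{n=1}^\infty \frac1{n^{1+\alpha}}\,\Delta^{-\alpha}\mathcal T(n)x$ converges in norm; (iii) the series $\displaystyle\sum_{n=1}^\infty \frac1{n^{1+\alpha}}\,\Delta^{-\alpha}\mathcal T(n)x$ converges weakly to an element of $X$. In that case $$\log(I-T)x=\left(\int_0^1\frac{1-u^\alpha}{1-u}\,du\right)x-\sum_{n=1}^\infty\frac{\Gamma(\alpha+1)\Gamma(n)}{\Gamma(n+\alpha+1)}\,\Delta^{-\alpha}\mathcal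 T(n)x ,$$ where the series on the right converges in norm. -/

import Mathlib

open Filter Topology

/-- The Cesàro number `k^α(n) = α (α + 1) ⋯ (α + n - 1) / n!`, the `n`-th Taylor coefficient of
`(1 - z)^(-α)`; in particular `k^α(0) = 1`. -/
noncomputable def cesaroNumber (α : ℝ) (n : ℕ) : ℝ :=
  (∏ i ∈ Finset.range n, (α + (i : ℝ))) / (n.factorial : ℝ)

section Operators

variable {X : Type*} [NormedAddCommGroup X] [NormedSpace ℂ X]

/-- The Cesàro sum `Δ^{-α} 𝒯(n) = ∑_{j=0}^n k^α(n - j) T^j` of order `α`. -/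
noncomputable def cesaroSum (α : ℝ) (T : X →L[ℂ] X) (n : ℕ) : X →L[ℂ] X :=
  ∑ j ∈ Finset.range (n + 1), (cesaroNumber α (n - j) : ℂ) • T ^ j

/-- The Cesàro mean `M_T^α(n) = Δ^{-α} 𝒯(n) / k^{α+1}(n)` of order `α`. -/
noncomputable def cesaroMean (α : ℝ) (T : X →L[ℂ] X) (n : ℕ) : X →L[ℂ] X :=
  ((cesaroNumber (α + 1) n : ℂ))⁻¹ • cesaroSum α T n

/-- `T` is `(C,α)`-bounded: `sup_n ‖M_T^α(n)‖ < ∞`. -/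
def IsCesaroBounded (α : ℝ) (T : X →L[ℂ] X) : Prop :=
  BddAbove (Set.range fun n : ℕ => ‖cesaroMean α T n‖)

end Operators

/-- The Weyl sum `W^{-α} g(n) = ∑_{j ≥ n} k^α(j - n) g(j)` of order `α`. -/
noncomputable def weylSum (α : ℝ) (g : ℕ → ℂ) (n : ℕ) : ℂ :=
  ∑' j : ℕ, (cesaroNumber α j : ℂ) * g (n + j)

/-- `f` belongs to the convolution algebra `τ^α = W^{-α}(ℓ¹(k^{α+1}))` and `g = W^α f` is its
Weyl difference, that is, the sequence `g ∈ ℓ¹(k^{α+1})` with `f = W^{-α} g`. -/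
structure IsWeylDifference (α : ℝ) (f g : ℕ → ℂ) : Prop where
  summable : Summable fun n : ℕ => ‖g n‖ * cesaroNumber (α + 1) n
  weylSum_eq : weylSum α g = f

section Calculus

variable {X : Type*} [NormedAddCommGroup X] [NormedSpace ℂ X]

/-- `𝔣` (as a function on the open unit disc) belongs to `A^α(𝔻)`, i.e. `𝔣(z) = ∑ f(n) z^n` with
`f ∈ τ^α`, and `S = 𝔣(T) = ∑ W^α f(n) Δ^{-α} 𝒯(n)`. -/
def HasCesaroCalculus (α : ℝ) (T : X →L[ℂ] X) (𝔣 : ℂ → ℂ) (S : X →L[ℂ] X) : Prop :=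
  ∃ f g : ℕ → ℂ, IsWeylDifference α f g ∧
    (∀ z : ℂ, ‖z‖ < 1 → HasSum (fun n : ℕ => f n * z ^ n) (𝔣 z)) ∧
    HasSum (fun n : ℕ => g n • cesaroSum α T n) S

/-- The graph of the closed operator `𝔣(T) = 𝔢(T)⁻¹ (𝔢𝔣)(T)` given by regularization:
`x ∈ Dom 𝔣(T)` and `𝔣(T) x = y` iff `𝔢(T) y = (𝔢𝔣)(T) x`, where `𝔢 ∈ A^α(𝔻)` is a regularizer of
`𝔣`, i.e. `𝔢𝔣 ∈ A^α(𝔻)` and `𝔢(T)` is injective. -/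
def RegularizedCalculus (α : ℝ) (T : X →L[ℂ] X) (𝔣 : ℂ → ℂ) (x y : X) : Prop :=
  ∃ (𝔢 : ℂ → ℂ) (E S : X →L[ℂ] X),
    HasCesaroCalculus α T 𝔢 E ∧ HasCesaroCalculus α T (fun z => 𝔢 z * 𝔣 z) S ∧
      Function.Injective E ∧ E y = S x

/-- `x ∈ Dom log(I - T)` and `log(I - T) x = y`, where `log(I - T) = [log(1 - z)](T)`. -/
def HasLogOneSub (α : ℝ) (T : X →L[ℂ] X) (x y : X) : Prop :=
  RegularizedCalculus α T (fun z => Complex.log (1 - z)) x y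

/-- `x ∈ Dom log(I - T)`. -/
def MemDomLogOneSub (α : ℝ) (T : X →L[ℂ] X) (x : X) : Prop :=
  ∃ y : X, HasLogOneSub α T x y

/-- The series `∑_{n ≥ 1} u n` converges to `y` in norm (not necessarily unconditionally). -/
def SeriesConvergesTo (u : ℕ → X) (y : X) : Prop :=
  Tendsto (fun N : ℕ => ∑ n ∈ Finset.Icc 1 N, u n) atTop (𝓝 y)

/-- The series `∑_{n ≥ 1} u n` converges to `y` weakly. -/
def SeriesConvergesWeaklyTo (u : ℕ → X) (y : X) : Prop :=
  ∀ φ : X →L[ℂ] ℂ, Tendsto (fun N : ℕ => φ (∑ n ∈ Finset.Icc 1 N, u n)) atTop (𝓝 (φ y))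

end Calculus

/-! Let e_n be the polynomial with e_n(T) = Δ^{-α}𝒯(n), let b_n = 1/(n k^{α+1}(n)) be the
`cesaroWeight`, let c be the integral in the statement, and S_N = ∑_{1≤n≤N} b_n e_n. Gauss'
summation formula gives, coefficient by coefficient, log(1-z) = c - ∑ b_n e_n(z). Since b_n/Γ(α+1)
and n^{-1-α} differ by a sequence in ℓ¹(k^{α+1}) (`summable_abs_one_div_rpow_sub_cesaroWeight`),
everything reduces to the behaviour of S_N(T)x.

A mean ergodic argument shows that I-T is injective, and (1-z)log(1-z) lies in A^α(𝔻). So y =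
log(I-T)x means (I-T)y = [(1-z)log(1-z)](T)x (`hasLogOneSub_iff`). Summation by parts shows that
(I-T)(c - S_N(T)) converges in norm to that operator; hence a weak limit s of S_N(T)x makes y = c x
- s a solution.

The hard direction is from the domain to norm convergence. Let u(z) = ∫_0^1 (1-z)^s ds =
-z/log(1-z), which lies in A^α(𝔻), and U = u(T). If y = log(I-T)x then Uy = -Tx, so S_N x = (I-T)S_N
x - S_N U y. The first term converges, and S_N U converges on the dense range of I-T, so it suffices
that ‖S_N U‖ is bounded.

This follows from a bound, uniform in N, for the Weyl difference of S_N u in ℓ¹(k^{α+1})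
(`exists_tsum_abs_truncLogConv_le`). Its entries beyond N are nonpositive and its weighted sum
vanishes because u(1) = 0, so its norm is at most twice the part up to N. There it differs from the
Weyl difference of the complete product c u + z by a double sum of Hilbert type, which is bounded
uniformly in N.

The calculus is multiplicative because the products e_n e_i have explicit coefficients in the family
e_k, with weighted ℓ¹ norm at most (1+2α) k^{α+1}(n) k^{α+1}(i) (`sum_abs_cesaroStructure_mul_le`).
-/

/-! ### Identities and inequalities for the Cesàro numbers. -/

theorem cesaroNumber_zero (α : ℝ) : cesaroNumber α 0 = 1 := by simp [cesaroNumber]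

theorem cesaroNumber_succ (α : ℝ) (n : ℕ) :
    cesaroNumber α (n + 1) = cesaroNumber α n * ((α + n) / (n + 1)) := by
  have h : ((n.factorial : ℕ) : ℝ) ≠ 0 := by positivity
  simp only [cesaroNumber, Finset.prod_range_succ, Nat.factorial_succ]
  push_cast
  field_simp

theorem cesaroNumber_succ_mul (α : ℝ) (n : ℕ) :
    ((n : ℝ) + 1) * cesaroNumber α (n + 1) = (α + n) * cesaroNumber α n := by
  rw [cesaroNumber_succ]
  have : (n : ℝ) + 1 ≠ 0 := by positivity
  field_simp

theorem cesaroNumber_one (α : ℝ) : cesaroNumber α 1 = α := by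
  simp [cesaroNumber]

theorem cesaroNumber_nonneg {α : ℝ} (hα : 0 ≤ α) (n : ℕ) : 0 ≤ cesaroNumber α n :=
  div_nonneg (Finset.prod_nonneg fun _ _ => by positivity) (by positivity)

theorem cesaroNumber_pos {α : ℝ} (hα : 0 < α) (n : ℕ) : 0 < cesaroNumber α n :=
  div_pos (Finset.prod_pos fun _ _ => by positivity) (by positivity)

theorem cesaroNumber_zero_left (n : ℕ) : cesaroNumber 0 n = if n = 0 then 1 else 0 := by
  cases n with
  | zero => simp [cesaroNumber_zero]
  | succ n =>
    simp only [cesaroNumber, Finset.prod_range_succ']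
    simp

theorem cesaroNumber_one_left (n : ℕ) : cesaroNumber 1 n = 1 := by
  induction n with
  | zero => exact cesaroNumber_zero 1
  | succ n ih =>
    rw [cesaroNumber_succ, ih, one_mul, add_comm]
    exact div_self (by positivity)

theorem add_mul_cesaroNumber (α : ℝ) (n : ℕ) :
    (α + n) * cesaroNumber α n = α * cesaroNumber (α + 1) n := by
  induction n with
  | zero => simp [cesaroNumber_zero]
  | succ n ih =>
    have h1 := cesaroNumber_succ_mul α n
    have h2 := cesaroNumber_succ_mul (α + 1) n
    have h : (n : ℝ) + 1 ≠ 0 := by positivity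
    apply mul_left_cancel₀ h
    push_cast
    linear_combination (α + (n + 1)) * h1 + (α + n + 1) * ih - α * h2

theorem cesaroNumber_pascal (α : ℝ) (n : ℕ) :
    cesaroNumber (α + 1) (n + 1) = cesaroNumber (α + 1) n + cesaroNumber α (n + 1) := by
  have h1 := cesaroNumber_succ_mul α n
  have h2 := cesaroNumber_succ_mul (α + 1) n
  have h3 := add_mul_cesaroNumber α n
  have h : (n : ℝ) + 1 ≠ 0 := by positivity
  apply mul_left_cancel₀ h
  linear_combination h2 - h1 - h3

theorem sum_range_cesaroNumber (α : ℝ) (n : ℕ) :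
    ∑ j ∈ Finset.range (n + 1), cesaroNumber α j = cesaroNumber (α + 1) n := by
  induction n with
  | zero => simp [cesaroNumber_zero]
  | succ n ih => rw [Finset.sum_range_succ, ih, cesaroNumber_pascal]

theorem cesaroNumber_add_two (α : ℝ) (n : ℕ) :
    (α + 1) * cesaroNumber (α + 2) n = (n + 1) * cesaroNumber (α + 1) (n + 1) := by
  have h1 := add_mul_cesaroNumber (α + 1) n
  have h2 := cesaroNumber_succ_mul (α + 1) n
  rw [show α + 2 = α + 1 + 1 by ring]
  linear_combination -h2 - h1

/-- The semigroup law (1-z)^{-α}(1-z)^{-β} = (1-z)^{-α-β}. The induction multiplies by n+1 = p.1 +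
p.2, which amounts to differentiating the product. -/
theorem sum_antidiagonal_cesaroNumber_mul (α β : ℝ) (n : ℕ) :
    ∑ p ∈ Finset.HasAntidiagonal.antidiagonal n, cesaroNumber α p.1 * cesaroNumber β p.2
      = cesaroNumber (α + β) n := by
  induction n with
  | zero => simp [cesaroNumber_zero]
  | succ n ih =>
    have h : (n : ℝ) + 1 ≠ 0 := by positivity
    apply mul_left_cancel₀ h
    rw [cesaroNumber_succ_mul, ← ih]
    have e1 : ((n : ℝ) + 1) * ∑ p ∈ Finset.HasAntidiagonal.antidiagonal (n + 1),
          cesaroNumber α p.1 * cesaroNumber β p.2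
        = ∑ p ∈ Finset.HasAntidiagonal.antidiagonal (n + 1),
          (p.1 : ℝ) * cesaroNumber α p.1 * cesaroNumber β p.2
          + ∑ p ∈ Finset.HasAntidiagonal.antidiagonal (n + 1),
            cesaroNumber α p.1 * ((p.2 : ℝ) * cesaroNumber β p.2) := by
      rw [Finset.mul_sum, ← Finset.sum_add_distrib]
      refine Finset.sum_congr rfl fun p hp => ?_
      have hp' : (p.1 : ℝ) + p.2 = n + 1 := by
        exact_mod_cast Finset.HasAntidiagonal.mem_antidiagonal.1 hp
      rw [← hp']
      ring
    rw [e1, Finset.Nat.sum_antidiagonal_succ, Finset.Nat.sum_antidiagonal_succ', Finset.mul_sum]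
    simp only [Nat.cast_zero, zero_mul, mul_zero, zero_add, Nat.cast_add, Nat.cast_one,
      cesaroNumber_succ_mul]
    rw [← Finset.sum_add_distrib]
    refine Finset.sum_congr rfl fun p hp => ?_
    have hp' : (p.1 : ℝ) + p.2 = n := by exact_mod_cast Finset.HasAntidiagonal.mem_antidiagonal.1 hp
    rw [← hp']
    ring

theorem sum_antidiagonal_cesaroNumber_neg_mul (α : ℝ) (n : ℕ) :
    ∑ p ∈ Finset.HasAntidiagonal.antidiagonal n, cesaroNumber (-α) p.1 * cesaroNumber α p.2
      = if n = 0 then 1 else 0 := by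
  rw [sum_antidiagonal_cesaroNumber_mul, neg_add_cancel, cesaroNumber_zero_left]

theorem cesaroNumber_monotone {α : ℝ} (hα : 0 ≤ α) : Monotone (cesaroNumber (α + 1)) :=
  monotone_nat_of_le_succ fun n => by
    rw [cesaroNumber_pascal]
    linarith [cesaroNumber_nonneg hα (n + 1)]

theorem one_le_cesaroNumber {α : ℝ} (hα : 0 ≤ α) (n : ℕ) : 1 ≤ cesaroNumber (α + 1) n :=
  (cesaroNumber_zero (α + 1)).symm.trans_le (cesaroNumber_monotone hα (Nat.zero_le n))

theorem cesaroNumber_le_add_one {α : ℝ} (hα : 0 ≤ α) (n : ℕ) :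
    cesaroNumber α n ≤ cesaroNumber (α + 1) n := by
  cases n with
  | zero => simp [cesaroNumber_zero]
  | succ n =>
    rw [cesaroNumber_pascal]
    linarith [cesaroNumber_nonneg (add_nonneg hα zero_le_one) n]

theorem cesaroNumber_succ_le {α : ℝ} (hα : 0 ≤ α) (n : ℕ) :
    cesaroNumber (α + 1) (n + 1) ≤ (1 + α) * cesaroNumber (α + 1) n := by
  rw [cesaroNumber_succ, mul_comm]
  refine mul_le_mul_of_nonneg_right ?_ (cesaroNumber_nonneg (by linarith) n)
  rw [div_le_iff₀ (by positivity)]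
  nlinarith [mul_nonneg hα (Nat.cast_nonneg (α := ℝ) n)]

/-- Log-concavity of the sequence `k^{α+1}`. -/
theorem cesaroNumber_mul_le {α : ℝ} (hα : 0 ≤ α) {p q : ℕ} (hpq : p ≤ q) (d : ℕ) :
    cesaroNumber (α + 1) (q + d) * cesaroNumber (α + 1) p
      ≤ cesaroNumber (α + 1) q * cesaroNumber (α + 1) (p + d) := by
  induction d with
  | zero => simp
  | succ d ih =>
    have hp : ∀ m, 0 ≤ cesaroNumber (α + 1) m := cesaroNumber_nonneg (by linarith)
    rw [← add_assoc, ← add_assoc, cesaroNumber_succ, cesaroNumber_succ]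
    have hr : (α + 1 + ((q + d : ℕ) : ℝ)) / ((q + d : ℕ) + 1)
        ≤ (α + 1 + ((p + d : ℕ) : ℝ)) / ((p + d : ℕ) + 1) := by
      rw [div_le_div_iff₀ (by positivity) (by positivity)]
      have : (p : ℝ) ≤ q := by exact_mod_cast hpq
      push_cast
      nlinarith
    calc _ = (cesaroNumber (α + 1) (q + d) * cesaroNumber (α + 1) p)
          * ((α + 1 + ((q + d : ℕ) : ℝ)) / ((q + d : ℕ) + 1)) := by ring
      _ ≤ (cesaroNumber (α + 1) q * cesaroNumber (α + 1) (p + d))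
          * ((α + 1 + ((p + d : ℕ) : ℝ)) / ((p + d : ℕ) + 1)) :=
        mul_le_mul ih hr (by positivity) (mul_nonneg (hp _) (hp _))
      _ = _ := by ring

/-- From index J on, the ratios (1-α+m)/(m+1) of consecutive terms have modulus at most 1. -/
theorem abs_cesaroNumber_one_sub_le {α : ℝ} (hα : 0 ≤ α) {J : ℕ} (hJ : α ≤ J) (n : ℕ) :
    |cesaroNumber (1 - α) (J + n)| ≤ |cesaroNumber (1 - α) J| := by
  induction n with
  | zero => simp
  | succ n ih =>
    rw [← add_assoc, cesaroNumber_succ, abs_mul]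
    refine le_trans (mul_le_of_le_one_right (abs_nonneg _) ?_) ih
    rw [abs_div, div_le_one (by positivity), abs_of_pos (by positivity : (0 : ℝ) < (J + n : ℕ) + 1),
      abs_le]
    push_cast
    constructor <;> linarith [Nat.cast_nonneg (α := ℝ) n]

/-- Past J ≥ α the sign no longer changes, so the sums of absolute values telescope to differences
of k^{1-α}, which stay bounded. Summability makes convolution with k^{-α}, the inverse of the Weyl
sum, act on bounded sequences. -/
theorem summable_abs_cesaroNumber_neg {α : ℝ} (hα : 0 ≤ α) :
    Summable fun j : ℕ => |cesaroNumber (-α) j| := by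
  obtain ⟨J, hJ⟩ := exists_nat_ge α
  have hsign : ∀ n : ℕ, |cesaroNumber (-α) (J + n)|
      = SignType.sign (cesaroNumber (-α) J) * cesaroNumber (-α) (J + n) := by
    intro n
    induction n with
    | zero => simp [sign_mul_self]
    | succ n ih =>
      have h : (0 : ℝ) ≤ (-α + ((J + n : ℕ) : ℝ)) / ((J + n : ℕ) + 1) := by
        apply div_nonneg _ (by positivity)
        push_cast
        linarith [Nat.cast_nonneg (α := ℝ) n]
      rw [← add_assoc, cesaroNumber_succ, abs_mul, ih, abs_of_nonneg h, mul_assoc]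
  have key : Summable fun n : ℕ => |cesaroNumber (-α) (n + (J + 1))| := by
    refine summable_of_sum_range_le (c := 2 * |cesaroNumber (1 - α) J|) (fun _ => abs_nonneg _) ?_
    intro n
    have h1 : ∑ i ∈ Finset.range n, cesaroNumber (-α) (J + (i + 1))
        = cesaroNumber (1 - α) (J + n) - cesaroNumber (1 - α) J := by
      induction n with
      | zero => simp
      | succ n ih =>
        rw [Finset.sum_range_succ, ih]
        have := cesaroNumber_pascal (-α) (J + n)
        rw [show -α + 1 = 1 - α by ring] at this
        rw [← add_assoc, this]
        ring
    have h2 : ∑ i ∈ Finset.range n, |cesaroNumber (-α) (i + (J + 1))|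
        = SignType.sign (cesaroNumber (-α) J) *
          (cesaroNumber (1 - α) (J + n) - cesaroNumber (1 - α) J) := by
      rw [← h1, Finset.mul_sum]
      refine Finset.sum_congr rfl fun i _ => ?_
      rw [← hsign, show i + (J + 1) = J + (i + 1) by ring]
    rw [h2]
    have h3 : |((SignType.sign (cesaroNumber (-α) J) : SignType) : ℝ)| ≤ 1 := by
      rcases lt_trichotomy (cesaroNumber (-α) J) 0 with h | h | h
      · simp [sign_neg h]
      · simp [h]
      · simp [sign_pos h]
    calc _ ≤ |((SignType.sign (cesaroNumber (-α) J) : SignType) : ℝ) *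
          (cesaroNumber (1 - α) (J + n) - cesaroNumber (1 - α) J)| := le_abs_self _
      _ ≤ 1 * (|cesaroNumber (1 - α) (J + n)| + |cesaroNumber (1 - α) J|) := by
        rw [abs_mul]
        exact mul_le_mul h3 (abs_sub _ _) (abs_nonneg _) zero_le_one
      _ ≤ _ := by linarith [abs_cesaroNumber_one_sub_le hα hJ n]
  exact (summable_nat_add_iff (J + 1)).1 key

/-! ### The polynomials e_n and the structure constants of their products. -/

/-- The element `∑_{j ≤ n} k^α(n - j) a^j` of a complex algebra. -/
noncomputable def cesaroElem {A : Type*} [Ring A] [Algebra ℂ A] (α : ℝ) (a : A) (n : ℕ) : A :=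
  ∑ j ∈ Finset.range (n + 1), (cesaroNumber α (n - j) : ℂ) • a ^ j

/-- The coefficient of `e_k` in the product `e_n e_i`, where `e_n(z) = ∑_{j ≤ n} k^α(n - j) z^j`. -/
noncomputable def cesaroStructure (α : ℝ) (n i k : ℕ) : ℝ :=
  if k ≤ n + i ∧ n ≤ k ∧ i ≤ k then cesaroNumber α (n + i - k)
  else if k < n ∧ k < i then -cesaroNumber α (n + i - k) else 0

/-- The coefficient of `z^m` in `e_n(z) = ∑_{j ≤ n} k^α(n - j) z^j`. -/
noncomputable def cesaroCoeff (α : ℝ) (n m : ℕ) : ℝ :=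
  if m ≤ n then cesaroNumber α (n - m) else 0

section Algebra

variable {A : Type*} [Ring A] [Algebra ℂ A]

theorem cesaroElem_zero (α : ℝ) (a : A) : cesaroElem α a 0 = 1 := by
  simp [cesaroElem, cesaroNumber_zero]

theorem cesaroElem_succ (α : ℝ) (a : A) (n : ℕ) :
    cesaroElem α a (n + 1) = a * cesaroElem α a n + (cesaroNumber α (n + 1) : ℂ) • (1 : A) := by
  rw [cesaroElem, Finset.sum_range_succ', cesaroElem, Finset.mul_sum]
  simp [pow_succ']

theorem commute_cesaroElem (α : ℝ) (a : A) (n : ℕ) : Commute a (cesaroElem α a n) :=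
  Commute.sum_right _ _ _ fun j _ => ((Commute.refl a).pow_right j).smul_right _

theorem cesaroElem_one (α : ℝ) (n : ℕ) :
    cesaroElem α (1 : A) n = (cesaroNumber (α + 1) n : ℂ) • (1 : A) := by
  rw [cesaroElem, ← sum_range_cesaroNumber]
  push_cast
  rw [Finset.sum_smul, ← Finset.sum_range_reflect]
  refine Finset.sum_congr rfl fun j hj => ?_
  have := Finset.mem_range.1 hj
  rw [one_pow, show n - (n + 1 - 1 - j) = j by omega]

/-- The coefficient form of e_{n+1} e_i = e_n e_{i+1} - k^α(i+1) e_n + k^α(n+1) e_i. -/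
theorem cesaroStructure_succ (α : ℝ) (n i k : ℕ) :
    cesaroStructure α (n + 1) i k = cesaroStructure α n (i + 1) k
      - (if k = n then cesaroNumber α (i + 1) else 0)
      + (if k = i then cesaroNumber α (n + 1) else 0) := by
  have e : n + 1 + i = n + (i + 1) := by omega
  have e1 : k = n → n + (i + 1) - k = i + 1 := by omega
  have e2 : k = i → n + (i + 1) - k = n + 1 := by omega
  unfold cesaroStructure
  rw [e]
  by_cases h1 : k = n <;> by_cases h2 : k = i
  · rw [e1 h1]
    have : n + 1 = i + 1 := by omega
    rw [if_neg (by omega), if_neg (by omega), if_neg (by omega), if_neg (by omega), if_pos h1,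
      if_pos h2, this]
    ring
  · rw [e1 h1, if_pos h1, if_neg h2]
    split_ifs <;> first | omega | ring
  · rw [e2 h2, if_neg h1, if_pos h2]
    split_ifs <;> first | omega | ring
  · rw [if_neg h1, if_neg h2]
    split_ifs <;> first | omega | ring

theorem cesaroStructure_zero (α : ℝ) (i k : ℕ) :
    cesaroStructure α 0 i k = if k = i then 1 else 0 := by
  unfold cesaroStructure
  by_cases h : k = i
  · subst h
    simp [cesaroNumber_zero]
  · rw [if_neg (by omega), if_neg (by omega), if_neg h]

theorem cesaroStructure_eq_zero (α : ℝ) {n i k : ℕ} (h : n + i < k) :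
    cesaroStructure α n i k = 0 := by
  unfold cesaroStructure
  rw [if_neg (by omega), if_neg (by omega)]

/-- Induction on n: the recursion e_{n+1} = a e_n + k^α(n+1) allows a factor a to be moved from the
first polynomial to the second. -/
theorem cesaroElem_mul_cesaroElem (α : ℝ) (a : A) (n i : ℕ) :
    cesaroElem α a n * cesaroElem α a i
      = ∑ k ∈ Finset.range (n + i + 1), (cesaroStructure α n i k : ℂ) • cesaroElem α a k := by
  induction n generalizing i with
  | zero =>
    simp_rw [cesaroElem_zero, one_mul, cesaroStructure_zero]
    rw [Finset.sum_eq_single i]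
    · simp
    · intro k _ hk
      simp [hk]
    · intro h
      exact absurd (Finset.mem_range.2 (by omega)) h
  | succ n ih =>
    have h1 : cesaroElem α a (n + 1) * cesaroElem α a i
        = cesaroElem α a n * cesaroElem α a (i + 1)
          - (cesaroNumber α (i + 1) : ℂ) • cesaroElem α a n
          + (cesaroNumber α (n + 1) : ℂ) • cesaroElem α a i := by
      rw [cesaroElem_succ, cesaroElem_succ, add_mul, mul_add, ← mul_assoc,
        (commute_cesaroElem α a n).eq]
      simp
    have h2 : ∀ (p : ℕ) (x : ℝ), p ∈ Finset.range (n + 1 + i + 1) →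
        ∑ k ∈ Finset.range (n + 1 + i + 1), ((if k = p then x else 0 : ℝ) : ℂ) • cesaroElem α a k
          = (x : ℂ) • cesaroElem α a p := by
      intro p x hp
      rw [Finset.sum_eq_single_of_mem p hp]
      · simp
      · intro k _ hk
        simp [hk]
    rw [h1, ih, ← h2 n _ (Finset.mem_range.2 (by omega)), ← h2 i _ (Finset.mem_range.2 (by omega)),
      show n + (i + 1) + 1 = n + 1 + i + 1 by omega, ← Finset.sum_sub_distrib,
      ← Finset.sum_add_distrib]
    refine Finset.sum_congr rfl fun k _ => ?_
    rw [cesaroStructure_succ, ← sub_smul, ← add_smul]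
    push_cast
    rfl

end Algebra

theorem coeff_cesaroElem_X (α : ℝ) (n m : ℕ) :
    (cesaroElem α (Polynomial.X : Polynomial ℂ) n).coeff m = (cesaroCoeff α n m : ℂ) := by
  simp only [cesaroElem, Polynomial.finsetSum_coeff, Polynomial.coeff_smul,
    Polynomial.coeff_X_pow, smul_eq_mul, mul_ite, mul_one, mul_zero, Finset.sum_ite_eq,
    Finset.mem_range, cesaroCoeff]
  by_cases h : m ≤ n
  · rw [if_pos (by omega), if_pos h]
  · rw [if_neg (by omega), if_neg h, Complex.ofReal_zero]

theorem sum_antidiagonal_cesaroCoeff_mul (α : ℝ) (n i m : ℕ) :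
    ∑ p ∈ Finset.HasAntidiagonal.antidiagonal m, cesaroCoeff α n p.1 * cesaroCoeff α i p.2
      = ∑ k ∈ Finset.range (n + i + 1), cesaroStructure α n i k * cesaroCoeff α k m := by
  have h := congrArg (fun q : Polynomial ℂ => q.coeff m)
    (cesaroElem_mul_cesaroElem α (Polynomial.X : Polynomial ℂ) n i)
  simp only [Polynomial.coeff_mul, Polynomial.finsetSum_coeff, Polynomial.coeff_smul,
    coeff_cesaroElem_X, smul_eq_mul] at h
  exact_mod_cast h

/-- The product formula at a = 1, where e_n takes the value k^{α+1}(n). -/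
theorem sum_cesaroStructure_mul (α : ℝ) (n i : ℕ) :
    ∑ k ∈ Finset.range (n + i + 1), cesaroStructure α n i k * cesaroNumber (α + 1) k
      = cesaroNumber (α + 1) n * cesaroNumber (α + 1) i := by
  have h := cesaroElem_mul_cesaroElem α (1 : ℂ) n i
  simp only [cesaroElem_one, smul_eq_mul, mul_one] at h
  exact_mod_cast h.symm

theorem cesaroCoeff_nonneg {α : ℝ} (hα : 0 ≤ α) (n m : ℕ) : 0 ≤ cesaroCoeff α n m := by
  unfold cesaroCoeff
  split_ifs
  exacts [cesaroNumber_nonneg hα _, le_rfl]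

theorem sum_cesaroCoeff (α : ℝ) (n : ℕ) :
    ∑ m ∈ Finset.range (n + 1), cesaroCoeff α n m = cesaroNumber (α + 1) n := by
  rw [← sum_range_cesaroNumber, ← Finset.sum_range_reflect]
  refine Finset.sum_congr rfl fun j hj => ?_
  have := Finset.mem_range.1 hj
  rw [cesaroCoeff, if_pos (by omega)]
  congr 1
  omega

theorem sum_range_cesaroCoeff_le {α : ℝ} (hα : 0 ≤ α) (n m : ℕ) :
    ∑ p ∈ Finset.range (m + 1), cesaroCoeff α n p ≤ cesaroNumber (α + 1) n := by
  rw [← sum_cesaroCoeff]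
  rcases le_total m n with h | h
  · exact Finset.sum_le_sum_of_subset_of_nonneg (Finset.range_mono (by omega))
      fun p _ _ => cesaroCoeff_nonneg hα n p
  · refine (Finset.sum_subset (Finset.range_mono (by omega)) fun p _ hp => ?_).ge
    rw [cesaroCoeff, if_neg]
    simpa using hp

theorem cesaroCoeff_le {α : ℝ} (hα : 0 ≤ α) (n m : ℕ) :
    cesaroCoeff α n m ≤ cesaroNumber (α + 1) n :=
  (Finset.single_le_sum (fun p _ => cesaroCoeff_nonneg hα n p)
    (Finset.self_mem_range_succ m)).trans (sum_range_cesaroCoeff_le hα n m)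

theorem hasSum_cesaroNumber_neg_mul_cesaroCoeff (α : ℝ) (i k : ℕ) :
    HasSum (fun j => cesaroNumber (-α) j * cesaroCoeff α i (k + j)) (if k = i then 1 else 0) := by
  by_cases hk : k ≤ i
  · obtain ⟨d, rfl⟩ := Nat.exists_eq_add_of_le hk
    have h : ∑ j ∈ Finset.range (d + 1), cesaroNumber (-α) j * cesaroCoeff α (k + d) (k + j)
        = if k = k + d then 1 else 0 := by
      have h1 := sum_antidiagonal_cesaroNumber_neg_mul α d
      rw [Finset.Nat.sum_antidiagonal_eq_sum_range_succ_mk] at h1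
      have h2 : (if k = k + d then (1 : ℝ) else 0) = if d = 0 then 1 else 0 := by
        simp
      rw [h2, ← h1]
      refine Finset.sum_congr rfl fun j hj => ?_
      have := Finset.mem_range.1 hj
      rw [cesaroCoeff, if_pos (by omega), show k + d - (k + j) = d - j by omega]
    rw [← h]
    refine hasSum_sum_of_ne_finset_zero fun j hj => ?_
    rw [cesaroCoeff, if_neg, mul_zero]
    simp at hj
    omega
  · rw [if_neg (by omega)]
    convert hasSum_zero using 2 with j
    rw [cesaroCoeff, if_neg (by omega), mul_zero]

/-- The structure constants are the Weyl difference of the coefficients of e_n e_i, since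
convolution with k^{-α} sends the coefficients of e_l to the unit vector at l. -/
theorem hasSum_cesaroNumber_neg_mul_sum_antidiagonal (α : ℝ) (n i k : ℕ) :
    HasSum (fun j => cesaroNumber (-α) j *
      ∑ p ∈ Finset.HasAntidiagonal.antidiagonal (k + j),
        cesaroCoeff α n p.1 * cesaroCoeff α i p.2) (cesaroStructure α n i k) := by
  have h : HasSum (fun j => ∑ l ∈ Finset.range (n + i + 1),
      cesaroStructure α n i l * (cesaroNumber (-α) j * cesaroCoeff α l (k + j)))
      (∑ l ∈ Finset.range (n + i + 1), cesaroStructure α n i l * if k = l then 1 else 0) :=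
    hasSum_sum fun l _ => (hasSum_cesaroNumber_neg_mul_cesaroCoeff α l k).mul_left _
  have e : ∑ l ∈ Finset.range (n + i + 1), cesaroStructure α n i l * (if k = l then 1 else 0)
      = cesaroStructure α n i k := by
    simp only [mul_ite, mul_one, mul_zero, Finset.sum_ite_eq, Finset.mem_range]
    split_ifs with hk
    · rfl
    · exact (cesaroStructure_eq_zero α (by omega)).symm
  rw [e] at h
  convert h using 2 with j
  rw [sum_antidiagonal_cesaroCoeff_mul, Finset.mul_sum]
  exact Finset.sum_congr rfl fun l _ => by ring

/-- Combines k^α(l) ≤ (α/l) k^{α+1}(l) with log-concavity of k^{α+1}. -/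
theorem cesaroNumber_mul_cesaroNumber_le {α : ℝ} (hα : 0 ≤ α) {n i k : ℕ} (hn : k < n)
    (hi : k < i) :
    cesaroNumber α (n + i - k) * cesaroNumber (α + 1) k
      ≤ α / ((n + i - k : ℕ) : ℝ) * (cesaroNumber (α + 1) n * cesaroNumber (α + 1) i) := by
  have hl : (0 : ℝ) < ((n + i - k : ℕ) : ℝ) := by
    exact_mod_cast (by omega : 0 < n + i - k)
  have h1 : cesaroNumber α (n + i - k)
      ≤ α / ((n + i - k : ℕ) : ℝ) * cesaroNumber (α + 1) (n + i - k) := by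
    rw [div_mul_eq_mul_div, le_div_iff₀ hl, ← add_mul_cesaroNumber]
    nlinarith [cesaroNumber_nonneg hα (n + i - k)]
  have h2 := cesaroNumber_mul_le hα hn.le (i - k)
  rw [show n + (i - k) = n + i - k by omega, show k + (i - k) = i by omega] at h2
  calc _ ≤ α / ((n + i - k : ℕ) : ℝ) * cesaroNumber (α + 1) (n + i - k)
        * cesaroNumber (α + 1) k :=
      mul_le_mul_of_nonneg_right h1 (cesaroNumber_nonneg (by linarith) k)
    _ = α / ((n + i - k : ℕ) : ℝ) *
        (cesaroNumber (α + 1) (n + i - k) * cesaroNumber (α + 1) k) := by ring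
    _ ≤ _ := mul_le_mul_of_nonneg_left h2 (by positivity)

/-- The signed sum equals k^{α+1}(n) k^{α+1}(i). Negative constants occur only for k < min n i;
there are min n i such indices, each costing at most α / min n i times that product, and passing to
absolute values counts them twice. -/
theorem sum_abs_cesaroStructure_mul_le {α : ℝ} (hα : 0 ≤ α) (n i : ℕ) :
    ∑ k ∈ Finset.range (n + i + 1), |cesaroStructure α n i k| * cesaroNumber (α + 1) k
      ≤ (1 + 2 * α) * (cesaroNumber (α + 1) n * cesaroNumber (α + 1) i) := by
  have hk : ∀ m, 0 < cesaroNumber (α + 1) m := cesaroNumber_pos (by linarith)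
  have h1 : ∀ k ∈ Finset.range (n + i + 1),
      |cesaroStructure α n i k| * cesaroNumber (α + 1) k
        ≤ cesaroStructure α n i k * cesaroNumber (α + 1) k
          + if k < min n i then 2 * (α / (min n i : ℕ) *
            (cesaroNumber (α + 1) n * cesaroNumber (α + 1) i)) else 0 := by
    intro k _
    have h0 := cesaroNumber_nonneg hα (n + i - k)
    unfold cesaroStructure
    by_cases h : k < n ∧ k < i
    · rw [if_neg (by omega), if_pos h, if_pos (lt_min h.1 h.2), abs_neg, abs_of_nonneg h0]
      have h2 := cesaroNumber_mul_cesaroNumber_le hα h.1 h.2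
      have hm : 0 < min n i := by omega
      have h3 : α / ((n + i - k : ℕ) : ℝ) ≤ α / (min n i : ℕ) := by
        apply div_le_div_of_nonneg_left hα (by exact_mod_cast hm)
        exact_mod_cast (by omega : min n i ≤ n + i - k)
      have h4 := mul_le_mul_of_nonneg_right h3 (mul_pos (hk n) (hk i)).le
      linarith
    · rw [if_neg (by omega : ¬ k < min n i)]
      split_ifs
      · rw [abs_of_nonneg h0, add_zero]
      · simp
  refine (Finset.sum_le_sum h1).trans ?_
  rw [Finset.sum_add_distrib, sum_cesaroStructure_mul, ← Finset.sum_filter, Finset.sum_const,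
    show (Finset.range (n + i + 1)).filter (fun k => k < min n i) = Finset.range (min n i) by
      ext k; simp; omega, Finset.card_range, nsmul_eq_mul]
  have h5 : ((min n i : ℕ) : ℝ) * (α / (min n i : ℕ)) ≤ α := by
    rcases Nat.eq_zero_or_pos (min n i) with h | h
    · rw [h]
      simpa using hα
    · exact (mul_div_cancel₀ _ (by exact_mod_cast h.ne')).le
  nlinarith [mul_pos (hk n) (hk i)]

/-! ### Weyl differences of products, and multiplicativity of the calculus. -/

theorem summable_prod_of_tsum_le {ι κ : Type*} {F : ι → κ → ℝ} (hF : ∀ i j, 0 ≤ F i j)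
    (hs : ∀ i, Summable (F i)) {B : ι → ℝ} (hB : Summable B) (hFB : ∀ i, ∑' j, F i j ≤ B i) :
    Summable fun z : ι × κ => F z.1 z.2 :=
  (summable_prod_of_nonneg (f := fun z : ι × κ => F z.1 z.2) fun z => hF z.1 z.2).2
    ⟨hs, Summable.of_nonneg_of_le (fun i => tsum_nonneg fun j => hF i j) hFB hB⟩

theorem weylSum_eq_tsum_cesaroCoeff (α : ℝ) (g : ℕ → ℂ) (m : ℕ) :
    weylSum α g m = ∑' n, g n * (cesaroCoeff α n m : ℂ) := by
  have h := (add_right_injective m).tsum_eq (f := fun n => g n * (cesaroCoeff α n m : ℂ)) (by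
    intro n hn
    by_contra hc
    apply hn
    have : ¬ m ≤ n := fun h => hc ⟨n - m, by simp only []; omega⟩
    simp [cesaroCoeff, this])
  rw [← h, weylSum]
  refine tsum_congr fun j => ?_
  rw [cesaroCoeff, if_pos (by omega), Nat.add_sub_cancel_left, mul_comm]

theorem hasSum_mul_mul_sum_antidiagonal {𝕜 : Type*} [RCLike 𝕜] (c : ℕ → ℕ → ℝ) {x y : ℕ → 𝕜}
    (hx : ∀ p, Summable fun n => ‖x n * (c n p : 𝕜)‖)
    (hy : ∀ p, Summable fun n => ‖y n * (c n p : 𝕜)‖) (m : ℕ) :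
    HasSum (fun q : ℕ × ℕ => x q.1 * y q.2 *
      ((∑ p ∈ Finset.HasAntidiagonal.antidiagonal m, c q.1 p.1 * c q.2 p.2 : ℝ) : 𝕜))
      (∑ p ∈ Finset.HasAntidiagonal.antidiagonal m,
        (∑' n, x n * (c n p.1 : 𝕜)) * ∑' n, y n * (c n p.2 : 𝕜)) := by
  have h : HasSum (fun q : ℕ × ℕ => ∑ p ∈ Finset.HasAntidiagonal.antidiagonal m,
      (x q.1 * (c q.1 p.1 : 𝕜)) * (y q.2 * (c q.2 p.2 : 𝕜)))
      (∑ p ∈ Finset.HasAntidiagonal.antidiagonal m,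
        (∑' n, x n * (c n p.1 : 𝕜)) * ∑' n, y n * (c n p.2 : 𝕜)) := by
    refine hasSum_sum fun p _ => ?_
    rw [tsum_mul_tsum_of_summable_norm (hx p.1) (hy p.2)]
    exact (summable_mul_of_summable_norm (hx p.1) (hy p.2)).hasSum
  convert h using 2 with q
  push_cast
  rw [Finset.mul_sum]
  exact Finset.sum_congr rfl fun p _ => by ring

theorem summable_mul_cesaroCoeff {α : ℝ} (hα : 0 ≤ α) {g : ℕ → ℂ}
    (hg : Summable fun n => ‖g n‖ * cesaroNumber (α + 1) n) (p : ℕ) :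
    Summable fun n => ‖g n‖ * cesaroCoeff α n p :=
  hg.of_nonneg_of_le (fun n => mul_nonneg (norm_nonneg _) (cesaroCoeff_nonneg hα n p))
    fun n => mul_le_mul_of_nonneg_left (cesaroCoeff_le hα n p) (norm_nonneg _)

theorem sum_tsum_mul_cesaroCoeff_le {α : ℝ} (hα : 0 ≤ α) {g : ℕ → ℂ}
    (hg : Summable fun n => ‖g n‖ * cesaroNumber (α + 1) n) (m : ℕ) :
    ∑ p ∈ Finset.range (m + 1), ∑' n, ‖g n‖ * cesaroCoeff α n p
      ≤ ∑' n, ‖g n‖ * cesaroNumber (α + 1) n := by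
  rw [← Summable.tsum_finsetSum fun p _ => summable_mul_cesaroCoeff hα hg p]
  refine Summable.tsum_le_tsum (fun n => ?_)
    (summable_sum fun p _ => summable_mul_cesaroCoeff hα hg p) hg
  rw [← Finset.mul_sum]
  exact mul_le_mul_of_nonneg_left (sum_range_cesaroCoeff_le hα n m) (norm_nonneg _)

/-- Fubini for the inversion by k^{-α}. The first factor only needs bounded Weyl sums of its
absolute values, not membership in ℓ¹(k^{α+1}): the lemma is applied to the logarithm, whose
weighted terms decay only like 1/n. -/
theorem hasSum_mul_cesaroStructure {α : ℝ} (hα : 0 ≤ α) {g₁ g₂ : ℕ → ℂ} {Λ : ℝ}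
    (h₁ : ∀ p, Summable fun n => ‖g₁ n‖ * cesaroCoeff α n p)
    (hΛ : ∀ p, ∑' n, ‖g₁ n‖ * cesaroCoeff α n p ≤ Λ)
    (h₂ : Summable fun n => ‖g₂ n‖ * cesaroNumber (α + 1) n) (k : ℕ) :
    HasSum (fun q : ℕ × ℕ => g₁ q.1 * g₂ q.2 * (cesaroStructure α q.1 q.2 k : ℂ))
      (∑' j, (cesaroNumber (-α) j : ℂ) * ∑ p ∈ Finset.HasAntidiagonal.antidiagonal (k + j),
        weylSum α g₁ p.1 * weylSum α g₂ p.2) := by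
  have h₂' := summable_mul_cesaroCoeff hα h₂
  have hc0 := cesaroCoeff_nonneg hα
  set conv : ℕ × ℕ → ℕ → ℝ := fun q m => ∑ p ∈ Finset.HasAntidiagonal.antidiagonal m,
    cesaroCoeff α q.1 p.1 * cesaroCoeff α q.2 p.2 with hconv
  have hconv0 : ∀ q m, 0 ≤ conv q m := fun q m =>
    Finset.sum_nonneg fun p _ => mul_nonneg (hc0 _ _) (hc0 _ _)
  have hreal : ∀ m, HasSum (fun q : ℕ × ℕ => ‖g₁ q.1‖ * ‖g₂ q.2‖ * conv q m)
      (∑ p ∈ Finset.HasAntidiagonal.antidiagonal m,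
        (∑' n, ‖g₁ n‖ * cesaroCoeff α n p.1) * ∑' n, ‖g₂ n‖ * cesaroCoeff α n p.2) := by
    intro m
    refine hasSum_mul_mul_sum_antidiagonal (𝕜 := ℝ) (cesaroCoeff α) (x := fun n => ‖g₁ n‖)
      (y := fun n => ‖g₂ n‖) ?_ ?_ m
    · intro p
      simpa [abs_of_nonneg (hc0 _ _)] using h₁ p
    · intro p
      simpa [abs_of_nonneg (hc0 _ _)] using h₂' p
  have hcpx : ∀ m, HasSum (fun q : ℕ × ℕ => g₁ q.1 * g₂ q.2 * (conv q m : ℂ))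
      (∑ p ∈ Finset.HasAntidiagonal.antidiagonal m, weylSum α g₁ p.1 * weylSum α g₂ p.2) := by
    intro m
    simp only [weylSum_eq_tsum_cesaroCoeff]
    refine hasSum_mul_mul_sum_antidiagonal (𝕜 := ℂ) (cesaroCoeff α) ?_ ?_ m
    · intro p
      simpa [abs_of_nonneg (hc0 _ _)] using h₁ p
    · intro p
      simpa [abs_of_nonneg (hc0 _ _)] using h₂' p
  have hbound : ∀ m, ∑ p ∈ Finset.HasAntidiagonal.antidiagonal m,
        (∑' n, ‖g₁ n‖ * cesaroCoeff α n p.1) * ∑' n, ‖g₂ n‖ * cesaroCoeff α n p.2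
      ≤ Λ * ∑' n, ‖g₂ n‖ * cesaroNumber (α + 1) n := by
    intro m
    have hΛ0 : 0 ≤ Λ := le_trans (tsum_nonneg fun n => mul_nonneg (norm_nonneg _) (hc0 n 0)) (hΛ 0)
    calc _ ≤ ∑ p ∈ Finset.HasAntidiagonal.antidiagonal m,
          Λ * ∑' n, ‖g₂ n‖ * cesaroCoeff α n p.2 :=
        Finset.sum_le_sum fun p _ => mul_le_mul_of_nonneg_right (hΛ _)
          (tsum_nonneg fun n => mul_nonneg (norm_nonneg _) (hc0 n _))
      _ = Λ * ∑ p ∈ Finset.range (m + 1), ∑' n, ‖g₂ n‖ * cesaroCoeff α n p := by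
        rw [← Finset.mul_sum, ← Finset.Nat.sum_antidiagonal_swap,
          Finset.Nat.sum_antidiagonal_eq_sum_range_succ_mk]
        rfl
      _ ≤ _ := mul_le_mul_of_nonneg_left (sum_tsum_mul_cesaroCoeff_le hα h₂ m) hΛ0
  have hsum : Summable fun z : ℕ × (ℕ × ℕ) =>
      (cesaroNumber (-α) z.1 : ℂ) * (g₁ z.2.1 * g₂ z.2.2 * (conv z.2 (k + z.1) : ℂ)) := by
    refine Summable.of_norm ?_
    have e : (fun z : ℕ × (ℕ × ℕ) => ‖(cesaroNumber (-α) z.1 : ℂ) *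
        (g₁ z.2.1 * g₂ z.2.2 * (conv z.2 (k + z.1) : ℂ))‖)
        = fun z : ℕ × (ℕ × ℕ) => |cesaroNumber (-α) z.1| *
          (‖g₁ z.2.1‖ * ‖g₂ z.2.2‖ * conv z.2 (k + z.1)) := by
      ext z
      simp [abs_of_nonneg (hconv0 _ _)]
    rw [e]
    refine summable_prod_of_tsum_le
      (F := fun j q => |cesaroNumber (-α) j| * (‖g₁ q.1‖ * ‖g₂ q.2‖ * conv q (k + j)))
      (fun j q => mul_nonneg (abs_nonneg _) (mul_nonneg (by positivity) (hconv0 _ _)))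
      (fun j => (hreal (k + j)).summable.mul_left _)
      ((summable_abs_cesaroNumber_neg hα).mul_right
        (Λ * ∑' n, ‖g₂ n‖ * cesaroNumber (α + 1) n)) fun j => ?_
    rw [tsum_mul_left, (hreal (k + j)).tsum_eq]
    exact mul_le_mul_of_nonneg_left (hbound _) (abs_nonneg _)
  have h1 : ∑' z : ℕ × (ℕ × ℕ),
      (cesaroNumber (-α) z.1 : ℂ) * (g₁ z.2.1 * g₂ z.2.2 * (conv z.2 (k + z.1) : ℂ))
      = ∑' j, (cesaroNumber (-α) j : ℂ) * ∑ p ∈ Finset.HasAntidiagonal.antidiagonal (k + j),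
        weylSum α g₁ p.1 * weylSum α g₂ p.2 := by
    rw [hsum.tsum_prod]
    refine tsum_congr fun j => ?_
    exact ((hcpx (k + j)).mul_left (cesaroNumber (-α) j : ℂ)).tsum_eq
  have h2 := hsum.hasSum
  rw [h1] at h2
  -- Summing over j first, each pair q contributes its structure constant.
  have h3 := ((Equiv.prodComm (ℕ × ℕ) ℕ).hasSum_iff.2 h2).prod_fiberwise
    (g := fun q => g₁ q.1 * g₂ q.2 * (cesaroStructure α q.1 q.2 k : ℂ)) fun q => by
      have h4 : HasSum (fun j => cesaroNumber (-α) j * conv q (k + j)) _ :=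
        hasSum_cesaroNumber_neg_mul_sum_antidiagonal α q.1 q.2 k
      have h5 := (Complex.hasSum_ofReal.2 h4).mul_left (g₁ q.1 * g₂ q.2)
      have h6 : (fun j => g₁ q.1 * g₂ q.2 * ((cesaroNumber (-α) j * conv q (k + j) : ℝ) : ℂ))
          = fun j => (cesaroNumber (-α) j : ℂ) * (g₁ q.1 * g₂ q.2 * (conv q (k + j) : ℂ)) := by
        ext j
        push_cast
        ring
      rw [h6] at h5
      exact h5
  exact h3

/-- The sequence `W^α (W^{-α} g₁ * W^{-α} g₂)`. -/
noncomputable def cesaroConv (α : ℝ) (g₁ g₂ : ℕ → ℂ) (k : ℕ) : ℂ :=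
  ∑' q : ℕ × ℕ, g₁ q.1 * g₂ q.2 * (cesaroStructure α q.1 q.2 k : ℂ)

/-- The Weyl difference of a product is recovered from its Taylor coefficients, so identities
between functions pass to the calculus. -/
theorem cesaroConv_congr {α : ℝ} (hα : 0 ≤ α) {g₁ g₂ g₃ g₄ : ℕ → ℂ}
    (h₁ : Summable fun n => ‖g₁ n‖ * cesaroNumber (α + 1) n)
    (h₂ : Summable fun n => ‖g₂ n‖ * cesaroNumber (α + 1) n)
    (h₃ : Summable fun n => ‖g₃ n‖ * cesaroNumber (α + 1) n)
    (h₄ : Summable fun n => ‖g₄ n‖ * cesaroNumber (α + 1) n)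
    (h : ∀ m, ∑ p ∈ Finset.HasAntidiagonal.antidiagonal m, weylSum α g₁ p.1 * weylSum α g₂ p.2
      = ∑ p ∈ Finset.HasAntidiagonal.antidiagonal m, weylSum α g₃ p.1 * weylSum α g₄ p.2) :
    cesaroConv α g₁ g₂ = cesaroConv α g₃ g₄ := by
  have aux : ∀ {x : ℕ → ℂ}, (Summable fun n => ‖x n‖ * cesaroNumber (α + 1) n) →
      ∀ p, ∑' n, ‖x n‖ * cesaroCoeff α n p ≤ ∑' n, ‖x n‖ * cesaroNumber (α + 1) n :=
    fun hx p => Summable.tsum_le_tsum (fun n => mul_le_mul_of_nonneg_left (cesaroCoeff_le hα n p)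
      (norm_nonneg _)) (summable_mul_cesaroCoeff hα hx p) hx
  ext k
  rw [cesaroConv, cesaroConv,
    (hasSum_mul_cesaroStructure hα (summable_mul_cesaroCoeff hα h₁) (aux h₁) h₂ k).tsum_eq,
    (hasSum_mul_cesaroStructure hα (summable_mul_cesaroCoeff hα h₃) (aux h₃) h₄ k).tsum_eq]
  exact tsum_congr fun j => by rw [h]

theorem summable_norm_mul_abs_cesaroStructure {α : ℝ} (hα : 0 ≤ α) {g₁ g₂ : ℕ → ℂ}
    (h₁ : Summable fun n => ‖g₁ n‖ * cesaroNumber (α + 1) n)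
    (h₂ : Summable fun n => ‖g₂ n‖ * cesaroNumber (α + 1) n) :
    Summable fun z : (ℕ × ℕ) × ℕ => ‖g₁ z.1.1 * g₂ z.1.2‖ *
      (|cesaroStructure α z.1.1 z.1.2 z.2| * cesaroNumber (α + 1) z.2) := by
  have hk : ∀ m, 0 ≤ cesaroNumber (α + 1) m := cesaroNumber_nonneg (by linarith)
  have hfin : ∀ q : ℕ × ℕ, HasSum
      (fun k => |cesaroStructure α q.1 q.2 k| * cesaroNumber (α + 1) k)
      (∑ k ∈ Finset.range (q.1 + q.2 + 1),
        |cesaroStructure α q.1 q.2 k| * cesaroNumber (α + 1) k) := fun q =>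
    hasSum_sum_of_ne_finset_zero fun k hk => by
      rw [cesaroStructure_eq_zero α (by simpa using hk), abs_zero, zero_mul]
  refine summable_prod_of_tsum_le
    (F := fun (q : ℕ × ℕ) k => ‖g₁ q.1 * g₂ q.2‖ *
      (|cesaroStructure α q.1 q.2 k| * cesaroNumber (α + 1) k))
    (fun q k => mul_nonneg (norm_nonneg _) (mul_nonneg (abs_nonneg _) (hk _)))
    (fun q => (hfin q).summable.mul_left _)
    ((h₁.mul_of_nonneg h₂ (fun n => mul_nonneg (norm_nonneg _) (hk n))
      (fun n => mul_nonneg (norm_nonneg _) (hk n))).mul_left (1 + 2 * α)) fun q => ?_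
  rw [tsum_mul_left, (hfin q).tsum_eq, norm_mul]
  calc _ ≤ ‖g₁ q.1‖ * ‖g₂ q.2‖ * ((1 + 2 * α) *
        (cesaroNumber (α + 1) q.1 * cesaroNumber (α + 1) q.2)) :=
      mul_le_mul_of_nonneg_left (sum_abs_cesaroStructure_mul_le hα _ _) (by positivity)
    _ = _ := by ring

theorem summable_norm_mul_abs_cesaroStructure_left {α : ℝ} (hα : 0 ≤ α) {g₁ g₂ : ℕ → ℂ}
    (h₁ : Summable fun n => ‖g₁ n‖ * cesaroNumber (α + 1) n)
    (h₂ : Summable fun n => ‖g₂ n‖ * cesaroNumber (α + 1) n) (k : ℕ) :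
    Summable fun q : ℕ × ℕ => ‖g₁ q.1 * g₂ q.2‖ * |cesaroStructure α q.1 q.2 k| := by
  have h := (summable_norm_mul_abs_cesaroStructure hα h₁ h₂).prod_symm.prod_factor k
  simp only [Prod.swap_prod_mk, ← mul_assoc] at h
  exact (summable_mul_right_iff (cesaroNumber_pos (by linarith) k).ne').1 h

theorem summable_norm_cesaroConv {α : ℝ} (hα : 0 ≤ α) {g₁ g₂ : ℕ → ℂ}
    (h₁ : Summable fun n => ‖g₁ n‖ * cesaroNumber (α + 1) n)
    (h₂ : Summable fun n => ‖g₂ n‖ * cesaroNumber (α + 1) n) :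
    Summable fun k => ‖cesaroConv α g₁ g₂ k‖ * cesaroNumber (α + 1) k := by
  have hk : ∀ m, 0 < cesaroNumber (α + 1) m := cesaroNumber_pos (by linarith)
  have hs := (summable_norm_mul_abs_cesaroStructure hα h₁ h₂).prod_symm
  refine hs.prod.of_nonneg_of_le (fun k => mul_nonneg (norm_nonneg _) (hk k).le) fun k => ?_
  simp only [Prod.swap_prod_mk, ← mul_assoc]
  rw [tsum_mul_right]
  refine mul_le_mul_of_nonneg_right ?_ (hk k).le
  refine (norm_tsum_le_tsum_norm ?_).trans_eq ?_
  · simpa using summable_norm_mul_abs_cesaroStructure_left hα h₁ h₂ k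
  · exact tsum_congr fun q => by simp

theorem summable_norm_smul_cesaroElem {A : Type*} [NormedRing A] [NormedAlgebra ℂ A] {α C : ℝ}
    {a : A}
    (hC : ∀ n, ‖cesaroElem α a n‖ ≤ C * cesaroNumber (α + 1) n) {g : ℕ → ℂ}
    (hg : Summable fun n => ‖g n‖ * cesaroNumber (α + 1) n) :
    Summable fun n => ‖g n • cesaroElem α a n‖ := by
  refine (hg.mul_left C).of_nonneg_of_le (fun n => norm_nonneg _) fun n => ?_
  rw [norm_smul]
  calc _ ≤ ‖g n‖ * (C * cesaroNumber (α + 1) n) :=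
      mul_le_mul_of_nonneg_left (hC n) (norm_nonneg _)
    _ = _ := by ring

section NormedAlgebra

variable {A : Type*} [NormedRing A] [NormedAlgebra ℂ A] [CompleteSpace A]

/-- Expand each product of two polynomials and reorder; the weighted bound on the structure
constants gives absolute convergence of the triple sum. -/
theorem tsum_smul_cesaroElem_mul {α C : ℝ} (hα : 0 ≤ α) {a : A}
    (hC : ∀ n, ‖cesaroElem α a n‖ ≤ C * cesaroNumber (α + 1) n) {g₁ g₂ : ℕ → ℂ}
    (h₁ : Summable fun n => ‖g₁ n‖ * cesaroNumber (α + 1) n)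
    (h₂ : Summable fun n => ‖g₂ n‖ * cesaroNumber (α + 1) n) :
    (∑' n, g₁ n • cesaroElem α a n) * ∑' n, g₂ n • cesaroElem α a n
      = ∑' k, cesaroConv α g₁ g₂ k • cesaroElem α a k := by
  have hsum : Summable fun z : (ℕ × ℕ) × ℕ =>
      (g₁ z.1.1 * g₂ z.1.2 * (cesaroStructure α z.1.1 z.1.2 z.2 : ℂ)) • cesaroElem α a z.2 := by
    refine Summable.of_norm ?_
    refine ((summable_norm_mul_abs_cesaroStructure hα h₁ h₂).mul_left C).of_nonneg_of_le
      (fun z => norm_nonneg _) fun z => ?_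
    rw [norm_smul, norm_mul _ (Complex.ofReal _), Complex.norm_real, Real.norm_eq_abs]
    calc _ ≤ ‖g₁ z.1.1 * g₂ z.1.2‖ * |cesaroStructure α z.1.1 z.1.2 z.2|
          * (C * cesaroNumber (α + 1) z.2) := mul_le_mul_of_nonneg_left (hC _) (by positivity)
      _ = _ := by ring
  rw [tsum_mul_tsum_of_summable_norm (summable_norm_smul_cesaroElem hC h₁)
    (summable_norm_smul_cesaroElem hC h₂)]
  have hL : ∀ q : ℕ × ℕ, (g₁ q.1 • cesaroElem α a q.1) * (g₂ q.2 • cesaroElem α a q.2)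
      = ∑' k, (g₁ q.1 * g₂ q.2 * (cesaroStructure α q.1 q.2 k : ℂ)) • cesaroElem α a k := by
    intro q
    rw [tsum_eq_sum (s := Finset.range (q.1 + q.2 + 1)), smul_mul_smul_comm,
      cesaroElem_mul_cesaroElem, Finset.smul_sum]
    · exact Finset.sum_congr rfl fun k _ => smul_smul _ _ _
    · intro k hk
      rw [cesaroStructure_eq_zero α (by simpa using hk)]
      simp
  simp_rw [hL]
  rw [← Summable.tsum_comm (f := fun (q : ℕ × ℕ) k =>
    (g₁ q.1 * g₂ q.2 * (cesaroStructure α q.1 q.2 k : ℂ)) • cesaroElem α a k) hsum]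
  refine tsum_congr fun k => ?_
  rw [cesaroConv]
  refine Summable.tsum_smul_const ?_ _
  refine Summable.of_norm ?_
  simpa using summable_norm_mul_abs_cesaroStructure_left hα h₁ h₂ k

theorem tsum_smul_cesaroElem_mul_congr {α C : ℝ} (hα : 0 ≤ α) {a : A}
    (hC : ∀ n, ‖cesaroElem α a n‖ ≤ C * cesaroNumber (α + 1) n) {g₁ g₂ g₃ g₄ : ℕ → ℂ}
    (h₁ : Summable fun n => ‖g₁ n‖ * cesaroNumber (α + 1) n)
    (h₂ : Summable fun n => ‖g₂ n‖ * cesaroNumber (α + 1) n)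
    (h₃ : Summable fun n => ‖g₃ n‖ * cesaroNumber (α + 1) n)
    (h₄ : Summable fun n => ‖g₄ n‖ * cesaroNumber (α + 1) n)
    (h : ∀ m, ∑ p ∈ Finset.HasAntidiagonal.antidiagonal m, weylSum α g₁ p.1 * weylSum α g₂ p.2
      = ∑ p ∈ Finset.HasAntidiagonal.antidiagonal m, weylSum α g₃ p.1 * weylSum α g₄ p.2) :
    (∑' n, g₁ n • cesaroElem α a n) * ∑' n, g₂ n • cesaroElem α a n
      = (∑' n, g₃ n • cesaroElem α a n) * ∑' n, g₄ n • cesaroElem α a n := by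
  rw [tsum_smul_cesaroElem_mul hα hC h₁ h₂, tsum_smul_cesaroElem_mul hα hC h₃ h₄,
    cesaroConv_congr hα h₁ h₂ h₃ h₄ h]

end NormedAlgebra

/-! ### Beta integrals, Gauss' formula and the logarithmic weights. -/

theorem multichoose_eq_cesaroNumber (a : ℝ) (n : ℕ) :
    Ring.choose (a + n - 1) n = cesaroNumber a n := by
  rw [← Ring.multichoose_eq, cesaroNumber, eq_div_iff (by positivity), mul_comm, ← nsmul_eq_mul,
    Ring.factorial_nsmul_multichoose_eq_ascPochhammer, Polynomial.ascPochhammer_smeval_eq_eval]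
  induction n with
  | zero => simp
  | succ n ih => rw [ascPochhammer_succ_eval, ih, Finset.prod_range_succ]

theorem hasSum_cesaroNumber_mul_pow (a : ℝ) {t : ℝ} (ht0 : 0 ≤ t) (ht1 : t < 1) :
    HasSum (fun n => cesaroNumber a n * t ^ n) ((1 - t) ^ (-a)) := by
  have h := (Real.one_div_one_sub_rpow_hasFPowerSeriesOnBall_zero a).hasSum (y := t) (by
    simp [abs_of_nonneg ht0, ht1, enorm_eq_nnnorm, ← NNReal.coe_lt_coe])
  simp only [FormalMultilinearSeries.ofScalars_apply_eq, multichoose_eq_cesaroNumber,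
    zero_add, smul_eq_mul] at h
  rw [Real.rpow_neg (by linarith), ← one_div]
  exact h

theorem integrableOn_beta {p q : ℝ} (hp : 0 < p) (hq : 0 < q) :
    MeasureTheory.IntegrableOn (fun t : ℝ => t ^ (p - 1) * (1 - t) ^ (q - 1)) (Set.Ioo 0 1) := by
  have h := Complex.betaIntegral_convergent (u := p) (v := q) (by simpa) (by simpa)
  rw [intervalIntegrable_iff_integrableOn_Ioo_of_le zero_le_one] at h
  refine MeasureTheory.IntegrableOn.congr_fun h.re (fun x hx => ?_) measurableSet_Ioo
  have e : ((x : ℂ) ^ ((p : ℂ) - 1) * (1 - (x : ℂ)) ^ ((q : ℂ) - 1))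
      = ((x ^ (p - 1) * (1 - x) ^ (q - 1) : ℝ) : ℂ) := by
    push_cast
    rw [Complex.ofReal_cpow hx.1.le, Complex.ofReal_cpow (by linarith [hx.2])]
    push_cast
    rfl
  simp only [e]
  exact Complex.ofReal_re _

theorem integral_beta {p q : ℝ} (hp : 0 < p) (hq : 0 < q) :
    ∫ t in Set.Ioo (0 : ℝ) 1, t ^ (p - 1) * (1 - t) ^ (q - 1) = ProbabilityTheory.beta p q := by
  have h : Complex.betaIntegral p q
      = ((∫ t in (0 : ℝ)..1, t ^ (p - 1) * (1 - t) ^ (q - 1) : ℝ) : ℂ) := by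
    rw [Complex.betaIntegral, ← intervalIntegral.integral_ofReal]
    refine intervalIntegral.integral_congr fun x hx => ?_
    rw [Set.uIcc_of_le zero_le_one] at hx
    push_cast
    rw [Complex.ofReal_cpow hx.1, Complex.ofReal_cpow (by linarith [hx.2])]
    push_cast
    rfl
  rw [ProbabilityTheory.beta_eq_betaIntegralReal p q hp hq, h, Complex.ofReal_re,
    intervalIntegral.integral_of_le zero_le_one, MeasureTheory.integral_Ioc_eq_integral_Ioo]

theorem hasSum_integral_of_nonneg {X : Type*} [MeasurableSpace X] {μ : MeasureTheory.Measure X}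
    {F : ℕ → X → ℝ} {f : X → ℝ} (hF : ∀ n, MeasureTheory.AEStronglyMeasurable (F n) μ)
    (h0 : ∀ n, ∀ᵐ x ∂μ, 0 ≤ F n x) (hf : MeasureTheory.Integrable f μ)
    (hsum : ∀ᵐ x ∂μ, HasSum (fun n => F n x) (f x)) :
    HasSum (fun n => ∫ x, F n x ∂μ) (∫ x, f x ∂μ) := by
  refine MeasureTheory.hasSum_integral_of_dominated_convergence F hF (fun n => ?_) ?_ ?_ hsum
  · filter_upwards [h0 n] with x hx
    rw [Real.norm_of_nonneg hx]
  · filter_upwards [hsum] with x hx using hx.summable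
  · refine hf.congr ?_
    filter_upwards [hsum] with x hx using hx.tsum_eq.symm

/-- Gauss' summation formula for `₂F₁(α, p; p + q + α; 1)`. -/
theorem hasSum_cesaroNumber_mul_beta {α p q : ℝ} (hα : 0 ≤ α) (hp : 0 < p) (hq : 0 < q) :
    HasSum (fun i : ℕ => cesaroNumber α i * ProbabilityTheory.beta (p + i) (q + α))
      (ProbabilityTheory.beta p q) := by
  have h := hasSum_integral_of_nonneg (μ := MeasureTheory.volume.restrict (Set.Ioo (0 : ℝ) 1))
    (F := fun i t => cesaroNumber α i * (t ^ (p + i - 1) * (1 - t) ^ (q + α - 1)))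
    (f := fun t => t ^ (p - 1) * (1 - t) ^ (q - 1)) ?_ ?_ (integrableOn_beta hp hq) ?_
  · simp only [MeasureTheory.integral_const_mul] at h
    rw [integral_beta hp hq] at h
    convert h using 2 with i
    rw [integral_beta (by positivity) (by positivity)]
  · intro i
    exact (Measurable.aestronglyMeasurable (by fun_prop))
  · intro i
    refine MeasureTheory.ae_restrict_of_forall_mem measurableSet_Ioo fun t ht => ?_
    have h1 : 0 ≤ 1 - t := by linarith [ht.2]
    exact mul_nonneg (cesaroNumber_nonneg hα i)
      (mul_nonneg (Real.rpow_nonneg ht.1.le _) (Real.rpow_nonneg h1 _))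
  · refine MeasureTheory.ae_restrict_of_forall_mem measurableSet_Ioo fun t ht => ?_
    have h1 : 0 < 1 - t := by linarith [ht.2]
    -- The binomial series of (1-t)^{-α} cancels the extra factor (1-t)^α in the beta integrand.
    have h2 := (hasSum_cesaroNumber_mul_pow α ht.1.le ht.2).mul_left
      (t ^ (p - 1) * (1 - t) ^ (q + α - 1))
    have e1 : t ^ (p - 1) * (1 - t) ^ (q + α - 1) * (1 - t) ^ (-α)
        = t ^ (p - 1) * (1 - t) ^ (q - 1) := by
      rw [mul_assoc, ← Real.rpow_add h1]
      ring_nf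
    rw [e1] at h2
    have e2 : (fun i : ℕ => t ^ (p - 1) * (1 - t) ^ (q + α - 1) * (cesaroNumber α i * t ^ i))
        = fun i : ℕ => cesaroNumber α i * (t ^ (p + i - 1) * (1 - t) ^ (q + α - 1)) := by
      ext i
      rw [show p + i - 1 = p - 1 + i by ring, Real.rpow_add ht.1, Real.rpow_natCast]
      ring
    rw [e2] at h2
    exact h2

theorem cesaroNumber_eq_Gamma {β : ℝ} (hβ : 0 < β) (n : ℕ) :
    cesaroNumber β n = Real.Gamma (n + β) / (Real.Gamma β * n.factorial) := by
  have h0 := (Real.Gamma_pos_of_pos hβ).ne'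
  induction n with
  | zero => simp [cesaroNumber_zero, h0]
  | succ n ih =>
    have h1 : (n : ℝ) + β ≠ 0 := by positivity
    rw [cesaroNumber_succ, ih, show ((n + 1 : ℕ) : ℝ) + β = n + β + 1 by push_cast; ring,
      Real.Gamma_add_one h1, Nat.factorial_succ]
    push_cast
    field_simp
    ring

/-- The weight `1 / (n k^{α+1}(n)) = B(n, α + 1)`. -/
noncomputable def cesaroWeight (α : ℝ) (n : ℕ) : ℝ := 1 / (n * cesaroNumber (α + 1) n)

theorem cesaroWeight_nonneg {α : ℝ} (hα : 0 ≤ α) (n : ℕ) : 0 ≤ cesaroWeight α n :=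
  one_div_nonneg.2 (mul_nonneg n.cast_nonneg (cesaroNumber_nonneg (by linarith) n))

theorem cesaroWeight_zero (α : ℝ) : cesaroWeight α 0 = 0 := by simp [cesaroWeight]

theorem cesaroWeight_mul {α : ℝ} (hα : 0 ≤ α) (n : ℕ) :
    cesaroWeight α n * cesaroNumber (α + 1) n = 1 / n := by
  have h := (cesaroNumber_pos (α := α + 1) (by linarith) n).ne'
  rw [cesaroWeight]
  rcases Nat.eq_zero_or_pos n with rfl | hn
  · simp
  · field_simp

/-- Index 0 is included because division by zero and `Real.Gamma 0` both give 0. -/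
theorem cesaroWeight_eq_Gamma {α : ℝ} (hα : 0 ≤ α) (n : ℕ) :
    cesaroWeight α n = Real.Gamma (α + 1) * Real.Gamma n / Real.Gamma (n + α + 1) := by
  cases n with
  | zero => simp [cesaroWeight_zero, Real.Gamma_zero]
  | succ n =>
    have h1 := (Real.Gamma_pos_of_pos (by linarith : 0 < α + 1)).ne'
    have h2 := (Real.Gamma_pos_of_pos (by positivity : 0 < ((n + 1 : ℕ) : ℝ) + α + 1)).ne'
    rw [cesaroWeight, cesaroNumber_eq_Gamma (by linarith), ← add_assoc, Nat.factorial_succ]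
    push_cast at h2 ⊢
    rw [Real.Gamma_nat_eq_factorial]
    have h3 : ((n.factorial : ℕ) : ℝ) ≠ 0 := by positivity
    field_simp

theorem cesaroWeight_eq_beta {α : ℝ} (hα : 0 ≤ α) (n : ℕ) :
    cesaroWeight α n = ProbabilityTheory.beta n (1 + α) := by
  rw [cesaroWeight_eq_Gamma hα, ProbabilityTheory.beta, add_assoc, add_comm α 1, mul_comm]

/-- Gauss' formula with q = 1. This is why b_n is the right weight: ∑ b_n e_n has the Taylor
coefficients of -log(1-z) at positive indices. -/
theorem hasSum_cesaroNumber_mul_cesaroWeight {α : ℝ} (hα : 0 ≤ α) {p : ℕ} (hp : 0 < p) :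
    HasSum (fun j => cesaroNumber α j * cesaroWeight α (p + j)) (1 / p) := by
  have hp' : (0 : ℝ) < p := by exact_mod_cast hp
  have h := hasSum_cesaroNumber_mul_beta hα hp' one_pos
  have e : ProbabilityTheory.beta p 1 = 1 / p := by
    rw [ProbabilityTheory.beta, Real.Gamma_one, Real.Gamma_add_one hp'.ne']
    have := (Real.Gamma_pos_of_pos hp').ne'
    field_simp
  rw [e] at h
  convert h using 2 with j
  rw [cesaroWeight_eq_beta hα]
  push_cast
  rfl

theorem cesaroNumber_mul_cesaroWeight {α : ℝ} (hα : 0 ≤ α) (n : ℕ) :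
    cesaroNumber α n * cesaroWeight α n = α / (n * (n + α)) := by
  rcases Nat.eq_zero_or_pos n with rfl | hn
  · simp [cesaroWeight_zero]
  · have hn' : (0 : ℝ) < n := by exact_mod_cast hn
    have h1 := add_mul_cesaroNumber α n
    have h2 := cesaroNumber_pos (α := α + 1) (by linarith) n
    rw [cesaroWeight]
    field_simp
    linear_combination h1

/-- Expand 1/(1-u) geometrically and integrate u^n - u^{n+α} term by term. -/
theorem integral_one_sub_rpow_div_nonneg_hasSum {α : ℝ} (hα : 0 ≤ α) :
    HasSum (fun n : ℕ => α / (((n + 1 : ℕ) : ℝ) * ((n + 1 : ℕ) + α)))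
      (∫ u in (0 : ℝ)..1, (1 - u ^ α) / (1 - u)) := by
  have hint : ∀ n : ℕ, ∫ u in Set.Ioo (0 : ℝ) 1, (u ^ n - u ^ ((n : ℝ) + α))
      = α / (((n + 1 : ℕ) : ℝ) * ((n + 1 : ℕ) + α)) := by
    intro n
    rw [← MeasureTheory.integral_Ioc_eq_integral_Ioo, ← intervalIntegral.integral_of_le zero_le_one,
      intervalIntegral.integral_sub (by simp) (intervalIntegral.intervalIntegrable_rpow'
        (by linarith [n.cast_nonneg (α := ℝ)])), integral_pow,
      integral_rpow (Or.inl (by linarith [n.cast_nonneg (α := ℝ)]))]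
    have h1 : (n : ℝ) + 1 ≠ 0 := by positivity
    have h2 : (n : ℝ) + 1 + α ≠ 0 := by positivity
    have h3 : (n : ℝ) + α + 1 ≠ 0 := by positivity
    rw [Real.zero_rpow h3]
    push_cast
    simp
    field_simp
    ring
  have hint' : ∀ n : ℕ, MeasureTheory.IntegrableOn (fun u : ℝ => u ^ n - u ^ ((n : ℝ) + α))
      (Set.Ioo 0 1) := by
    intro n
    refine ((intervalIntegrable_iff_integrableOn_Ioo_of_le zero_le_one).1 (by simp)).sub
      ((intervalIntegrable_iff_integrableOn_Ioo_of_le zero_le_one).1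
        (intervalIntegral.intervalIntegrable_rpow' (by linarith [n.cast_nonneg (α := ℝ)])))
  have hnn : ∀ n : ℕ, ∀ u ∈ Set.Ioo (0 : ℝ) 1, 0 ≤ u ^ n - u ^ ((n : ℝ) + α) := by
    intro n u hu
    rw [sub_nonneg, ← Real.rpow_natCast]
    exact Real.rpow_le_rpow_of_exponent_ge hu.1 hu.2.le (by linarith)
  have hsm : Summable fun n : ℕ => α / (((n + 1 : ℕ) : ℝ) * ((n + 1 : ℕ) + α)) := by
    have h2 : Summable fun n : ℕ => α * (1 / ((n + 1 : ℕ) : ℝ) ^ 2) :=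
      ((summable_nat_add_iff 1).2 (Real.summable_one_div_nat_pow.2 one_lt_two)).mul_left α
    refine Summable.of_nonneg_of_le (fun n => by positivity) (fun n => ?_) h2
    rw [mul_one_div]
    refine div_le_div_of_nonneg_left hα (by positivity) ?_
    rw [sq]
    refine mul_le_mul_of_nonneg_left (by linarith) (by positivity)
  have h := MeasureTheory.hasSum_integral_of_summable_integral_norm
    (μ := MeasureTheory.volume.restrict (Set.Ioo (0 : ℝ) 1))
    (F := fun (n : ℕ) u => u ^ n - u ^ ((n : ℝ) + α)) hint' (by
      refine hsm.congr fun n => ?_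
      rw [← hint n]
      refine MeasureTheory.setIntegral_congr_fun measurableSet_Ioo fun u hu => ?_
      exact (Real.norm_of_nonneg (hnn n u hu)).symm)
  simp only [hint] at h
  rw [intervalIntegral.integral_of_le zero_le_one, MeasureTheory.integral_Ioc_eq_integral_Ioo]
  have e : ∫ u in Set.Ioo (0 : ℝ) 1, (1 - u ^ α) / (1 - u)
      = ∫ u in Set.Ioo (0 : ℝ) 1, ∑' n : ℕ, (u ^ n - u ^ ((n : ℝ) + α)) := ?_
  · rw [e]
    exact h
  refine MeasureTheory.setIntegral_congr_fun measurableSet_Ioo fun u hu => ?_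
  have hg := (hasSum_geometric_of_lt_one hu.1.le hu.2).mul_right (1 - u ^ α)
  rw [← div_eq_inv_mul] at hg
  refine hg.tsum_eq.symm.trans (tsum_congr fun n => ?_)
  rw [Real.rpow_add hu.1, Real.rpow_natCast]
  ring

/-- The constant coefficient of ∑ b_n e_n, which -log(1-z) does not have; this is the origin of the
integral in the final formula. -/
theorem hasSum_cesaroNumber_mul_cesaroWeight_zero {α : ℝ} (hα : 0 ≤ α) :
    HasSum (fun n => cesaroNumber α n * cesaroWeight α n)
      (∫ u in (0 : ℝ)..1, (1 - u ^ α) / (1 - u)) := by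
  rw [← hasSum_nat_add_iff' 1]
  simp only [Finset.range_one, Finset.sum_singleton, cesaroWeight_zero, mul_zero, sub_zero]
  simp_rw [cesaroNumber_mul_cesaroWeight hα]
  exact integral_one_sub_rpow_div_nonneg_hasSum hα

/-! ### The kernel u = -z/log(1-z) and its Weyl difference. -/

theorem differentiable_cesaroNumber (n : ℕ) : Differentiable ℝ fun β => cesaroNumber β n := by
  unfold cesaroNumber
  fun_prop

theorem hasDerivAt_cesaroNumber_zero (n : ℕ) :
    HasDerivAt (fun h => cesaroNumber h n) (1 / (n : ℝ)) 0 := by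
  cases n with
  | zero => simpa [cesaroNumber_zero] using hasDerivAt_const (0 : ℝ) (1 : ℝ)
  | succ n =>
    have e : (fun h => cesaroNumber h (n + 1))
        = fun h : ℝ => h * (cesaroNumber (h + 1) n / (n + 1)) := by
      ext h
      rw [← mul_div_assoc, ← add_mul_cesaroNumber, cesaroNumber_succ]
      ring
    have h1 : DifferentiableAt ℝ (fun h : ℝ => cesaroNumber (h + 1) n / (n + 1)) 0 :=
      (((differentiable_cesaroNumber n).comp (differentiable_id.add_const 1)).div_const _) 0
    have h2 := (hasDerivAt_id (0 : ℝ)).mul h1.hasDerivAt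
    rw [e]
    refine h2.congr_deriv ?_
    simp [cesaroNumber_one_left]

/-- Differentiating (1-z)^{-β} in β multiplies it by -log(1-z). The semigroup law reduces this to β
= 0; the value 1/0 = 0 supplies the missing constant term of the logarithm. -/
theorem hasDerivAt_cesaroNumber (β : ℝ) (n : ℕ) :
    HasDerivAt (fun β => cesaroNumber β n)
      (∑ p ∈ Finset.HasAntidiagonal.antidiagonal n, 1 / (p.1 : ℝ) * cesaroNumber β p.2) β := by
  have h1 : HasDerivAt (fun h => ∑ p ∈ Finset.HasAntidiagonal.antidiagonal n,
      cesaroNumber h p.1 * cesaroNumber β p.2)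
      (∑ p ∈ Finset.HasAntidiagonal.antidiagonal n, 1 / (p.1 : ℝ) * cesaroNumber β p.2)
      (β - β) := by
    rw [sub_self]
    exact HasDerivAt.fun_sum fun p _ => (hasDerivAt_cesaroNumber_zero p.1).mul_const _
  have h2 := h1.comp_sub_const β β
  refine h2.congr_of_eventuallyEq (Eventually.of_forall fun x => ?_)
  simp only
  rw [sum_antidiagonal_cesaroNumber_mul, sub_add_cancel]

/-- The Taylor coefficients of `∫_0^1 (1 - z)^s ds = -z / log (1 - z)`. -/
noncomputable def logKernel (n : ℕ) : ℝ := ∫ s in (0 : ℝ)..1, cesaroNumber (-s) n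

theorem continuous_cesaroNumber_neg (n : ℕ) : Continuous fun s : ℝ => cesaroNumber (-s) n :=
  (differentiable_cesaroNumber n).continuous.comp continuous_neg

/-- Integrating d/ds (1-z)^s = log(1-z)(1-z)^s over [0,1] gives log(1-z) u(z) = (1-z) - 1 = -z. -/
theorem sum_antidiagonal_mul_logKernel (m : ℕ) :
    ∑ p ∈ Finset.HasAntidiagonal.antidiagonal m, 1 / (p.1 : ℝ) * logKernel p.2
      = if m = 1 then 1 else 0 := by
  have h1 : ∀ s : ℝ, HasDerivAt (fun s => cesaroNumber (-s) m)
      (-∑ p ∈ Finset.HasAntidiagonal.antidiagonal m, 1 / (p.1 : ℝ) * cesaroNumber (-s) p.2) s := by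
    intro s
    have h := (hasDerivAt_cesaroNumber (-s) m).scomp s (hasDerivAt_neg s)
    exact h.congr_deriv (by simp)
  have hc : Continuous fun s : ℝ => -∑ p ∈ Finset.HasAntidiagonal.antidiagonal m,
      1 / (p.1 : ℝ) * cesaroNumber (-s) p.2 :=
    (continuous_finsetSum _ fun p _ => (continuous_cesaroNumber_neg p.2).const_mul _).neg
  have h2 := intervalIntegral.integral_eq_sub_of_hasDerivAt (a := 0) (b := 1)
    (fun s _ => h1 s) (hc.intervalIntegrable 0 1)
  rw [intervalIntegral.integral_neg, intervalIntegral.integral_finsetSum fun p _ =>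
    ((continuous_cesaroNumber_neg p.2).const_mul _).intervalIntegrable 0 1] at h2
  simp only [intervalIntegral.integral_const_mul] at h2
  have h3 : cesaroNumber (-1) m = (if m = 0 then 1 else 0) - if m = 1 then 1 else 0 := by
    match m with
    | 0 => simp [cesaroNumber_zero]
    | 1 => simp [cesaroNumber_one]
    | n + 2 =>
      have h := cesaroNumber_succ_mul (-1) (n + 1)
      have h' := add_mul_cesaroNumber (-1) (n + 1)
      rw [neg_add_cancel, cesaroNumber_zero_left, if_neg (by omega), mul_zero] at h'
      rw [h'] at h
      have h0 : (((n + 1 : ℕ) : ℝ) + 1) ≠ 0 := by positivity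
      simpa using (mul_eq_zero.1 h).resolve_left h0
  rw [neg_zero, cesaroNumber_zero_left, h3] at h2
  unfold logKernel
  linarith

/-- The density in `s` of `-W^α u (n + 1)`, where `u` is the sequence `logKernel`. -/
noncomputable def logKernelDensity (α s : ℝ) (n : ℕ) : ℝ :=
  ProbabilityTheory.beta (n + 1 - s) (s + α + 1) / (Real.Gamma s * Real.Gamma (1 - s))

section Density

variable {α s : ℝ}

theorem logKernelDensity_nonneg (hα : 0 ≤ α) (hs : s ∈ Set.Ioo (0 : ℝ) 1) (n : ℕ) :
    0 ≤ logKernelDensity α s n := by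
  have h1 : 0 < (n : ℝ) + 1 - s := by linarith [hs.2, n.cast_nonneg (α := ℝ)]
  exact div_nonneg (ProbabilityTheory.beta_pos h1 (by linarith [hs.1])).le
    (mul_pos (Real.Gamma_pos_of_pos hs.1) (Real.Gamma_pos_of_pos (by linarith [hs.2]))).le

/-- Gauss' formula with p = n+1-s and q = s+1, normalised by Γ(s)Γ(1-s): the density is, up to sign,
the Weyl difference of (1-z)^s at n+1. -/
theorem hasSum_cesaroNumber_mul_logKernelDensity (hα : 0 ≤ α) (hs : s ∈ Set.Ioo (0 : ℝ) 1)
    (n : ℕ) : HasSum (fun i => cesaroNumber α i * logKernelDensity α s (n + i))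
      (-cesaroNumber (-s) (n + 1)) := by
  have h1 : 0 < (n : ℝ) + 1 - s := by linarith [hs.2, n.cast_nonneg (α := ℝ)]
  have h := (hasSum_cesaroNumber_mul_beta hα h1 (by linarith [hs.1] : 0 < s + 1)).div_const
    (Real.Gamma s * Real.Gamma (1 - s))
  have e : ProbabilityTheory.beta (n + 1 - s) (s + 1) / (Real.Gamma s * Real.Gamma (1 - s))
      = -cesaroNumber (-s) (n + 1) := by
    have h2 := cesaroNumber_succ_mul (-s) n
    have h3 := add_mul_cesaroNumber (-s) n
    have h4 : 0 < 1 - s := by linarith [hs.2]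
    rw [h3, show -s + 1 = 1 - s by ring, cesaroNumber_eq_Gamma h4] at h2
    have g1 := (Real.Gamma_pos_of_pos hs.1).ne'
    have g2 := (Real.Gamma_pos_of_pos h4).ne'
    have h5 : ((n : ℝ) + 1) ≠ 0 := by positivity
    have h6 : ((n.factorial : ℕ) : ℝ) ≠ 0 := by positivity
    apply mul_left_cancel₀ h5
    rw [mul_neg, h2, ProbabilityTheory.beta, Real.Gamma_add_one hs.1.ne',
      show (n : ℝ) + 1 - s + (s + 1) = ((n + 1 : ℕ) : ℝ) + 1 by push_cast; ring,
      Real.Gamma_nat_eq_factorial, Nat.factorial_succ,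
      show (n : ℝ) + (1 - s) = n + 1 - s by ring]
    push_cast
    field_simp
  rw [e] at h
  have e2 : (fun i : ℕ => cesaroNumber α i * ProbabilityTheory.beta (n + 1 - s + i) (s + 1 + α) /
      (Real.Gamma s * Real.Gamma (1 - s)))
      = fun i => cesaroNumber α i * logKernelDensity α s (n + i) := by
    ext i
    rw [logKernelDensity, mul_div_assoc]
    push_cast
    ring_nf
  rw [e2] at h
  exact h

/-- Gauss' formula of order α+1 with p = 1-s and q = s; since B(1-s,s) = Γ(s)Γ(1-s), the total mass
does not depend on s. -/
theorem hasSum_cesaroNumber_add_one_mul_logKernelDensity (hα : 0 ≤ α)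
    (hs : s ∈ Set.Ioo (0 : ℝ) 1) :
    HasSum (fun i => cesaroNumber (α + 1) i * logKernelDensity α s i) 1 := by
  have h4 : 0 < 1 - s := by linarith [hs.2]
  have h := (hasSum_cesaroNumber_mul_beta (by linarith : 0 ≤ α + 1) h4 hs.1).div_const
    (Real.Gamma s * Real.Gamma (1 - s))
  have g1 := (Real.Gamma_pos_of_pos hs.1).ne'
  have g2 := (Real.Gamma_pos_of_pos h4).ne'
  have e : ProbabilityTheory.beta (1 - s) s / (Real.Gamma s * Real.Gamma (1 - s)) = 1 := by
    rw [ProbabilityTheory.beta, sub_add_cancel, Real.Gamma_one]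
    field_simp
  rw [e] at h
  have e2 : (fun i : ℕ => cesaroNumber (α + 1) i *
      ProbabilityTheory.beta (1 - s + i) (s + (α + 1)) / (Real.Gamma s * Real.Gamma (1 - s)))
      = fun i => cesaroNumber (α + 1) i * logKernelDensity α s i := by
    ext i
    rw [logKernelDensity, mul_div_assoc]
    ring_nf
  rw [e2] at h
  exact h

theorem logKernelDensity_succ_le (hα : 0 ≤ α) (hs : s ∈ Set.Ioo (0 : ℝ) 1) (n : ℕ) :
    logKernelDensity α s (n + 1) ≤ logKernelDensity α s n := by
  have h1 : 0 < (n : ℝ) + 1 - s := by linarith [hs.2, n.cast_nonneg (α := ℝ)]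
  have h2 : 0 < (n : ℝ) + 2 + α := by positivity
  have h0 := logKernelDensity_nonneg hα hs n
  have e : logKernelDensity α s (n + 1)
      = logKernelDensity α s n * (((n : ℝ) + 1 - s) / (n + 2 + α)) := by
    have g := (Real.Gamma_pos_of_pos h2).ne'
    rw [logKernelDensity, logKernelDensity, ProbabilityTheory.beta, ProbabilityTheory.beta,
      show ((n + 1 : ℕ) : ℝ) + 1 - s = n + 1 - s + 1 by push_cast; ring, Real.Gamma_add_one h1.ne',
      show (n : ℝ) + 1 - s + 1 + (s + α + 1) = n + 2 + α + 1 by ring,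
      show (n : ℝ) + 1 - s + (s + α + 1) = n + 2 + α by ring, Real.Gamma_add_one h2.ne']
    have g1 := (Real.Gamma_pos_of_pos hs.1).ne'
    have g2 := (Real.Gamma_pos_of_pos (by linarith [hs.2] : 0 < 1 - s)).ne'
    field_simp
  rw [e]
  refine mul_le_of_le_one_right h0 ?_
  rw [div_le_one h2]
  linarith [hs.1]

theorem logKernelDensity_le_one (hα : 0 ≤ α) (hs : s ∈ Set.Ioo (0 : ℝ) 1) (n : ℕ) :
    logKernelDensity α s n ≤ 1 := by
  have h0 := logKernelDensity_nonneg hα hs n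
  have h1 := one_le_cesaroNumber hα n
  have h2 := le_hasSum (hasSum_cesaroNumber_add_one_mul_logKernelDensity hα hs) n fun i _ =>
    mul_nonneg (cesaroNumber_nonneg (by linarith) i) (logKernelDensity_nonneg hα hs i)
  nlinarith

theorem continuousOn_logKernelDensity (hα : 0 ≤ α) (n : ℕ) :
    ContinuousOn (fun s => logKernelDensity α s n) (Set.Ioo 0 1) := by
  have hG : ∀ φ : ℝ → ℝ, Continuous φ → (∀ s ∈ Set.Ioo (0 : ℝ) 1, 0 < φ s) →
      ContinuousOn (fun s => Real.Gamma (φ s)) (Set.Ioo 0 1) := fun φ hφ hpos =>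
    Real.differentiableOn_Gamma_Ioi.continuousOn.comp hφ.continuousOn hpos
  have hn := n.cast_nonneg (α := ℝ)
  unfold logKernelDensity ProbabilityTheory.beta
  refine ContinuousOn.div (ContinuousOn.div (ContinuousOn.mul ?_ ?_) ?_ ?_)
    (ContinuousOn.mul ?_ ?_) ?_
  · exact hG _ (by fun_prop) fun s hs => by linarith [hs.2]
  · exact hG _ (by fun_prop) fun s hs => by linarith [hs.1]
  · exact hG _ (by fun_prop) fun s hs => by linarith
  · exact fun s hs => (Real.Gamma_pos_of_pos (by linarith)).ne'
  · exact hG _ (by fun_prop) fun s hs => hs.1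
  · exact hG _ (by fun_prop) fun s hs => by linarith [hs.2]
  · exact fun s hs => (mul_pos (Real.Gamma_pos_of_pos hs.1)
      (Real.Gamma_pos_of_pos (by linarith [hs.2]))).ne'

end Density

/-- The numbers `-W^α u (n + 1)`, where `u` is the sequence `logKernel`. -/
noncomputable def logKernelTail (α : ℝ) (n : ℕ) : ℝ :=
  ∫ s in Set.Ioo (0 : ℝ) 1, logKernelDensity α s n

/-- The Weyl difference `W^α u`, where `u` is the sequence `logKernel`. -/
noncomputable def logKernelWeyl (α : ℝ) : ℕ → ℝ
  | 0 => 1 + ∑' i, cesaroNumber α (i + 1) * logKernelTail α i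
  | n + 1 => -logKernelTail α n

section Weyl

variable {α : ℝ}

theorem logKernelTail_nonneg (hα : 0 ≤ α) (n : ℕ) : 0 ≤ logKernelTail α n :=
  MeasureTheory.setIntegral_nonneg measurableSet_Ioo fun _ hs => logKernelDensity_nonneg hα hs n

theorem integrableOn_logKernelDensity (hα : 0 ≤ α) (n : ℕ) :
    MeasureTheory.IntegrableOn (fun s => logKernelDensity α s n) (Set.Ioo 0 1) := by
  refine MeasureTheory.Integrable.of_bound
    ((continuousOn_logKernelDensity hα n).aestronglyMeasurable measurableSet_Ioo) 1 ?_
  refine MeasureTheory.ae_restrict_of_forall_mem measurableSet_Ioo fun s hs => ?_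
  rw [Real.norm_of_nonneg (logKernelDensity_nonneg hα hs n)]
  exact logKernelDensity_le_one hα hs n

theorem logKernelTail_antitone (hα : 0 ≤ α) : Antitone (logKernelTail α) :=
  antitone_nat_of_succ_le fun n => MeasureTheory.setIntegral_mono_on
    (integrableOn_logKernelDensity hα (n + 1)) (integrableOn_logKernelDensity hα n)
    measurableSet_Ioo fun _ hs => logKernelDensity_succ_le hα hs n

/-- Positivity of the density allows the identities for fixed s to be integrated term by term. -/
theorem hasSum_mul_logKernelTail (hα : 0 ≤ α) {c : ℕ → ℝ} (hc : ∀ i, 0 ≤ c i) (n : ℕ)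
    {f : ℝ → ℝ} (hf : MeasureTheory.IntegrableOn f (Set.Ioo 0 1))
    (h : ∀ s ∈ Set.Ioo (0 : ℝ) 1, HasSum (fun i => c i * logKernelDensity α s (n + i)) (f s)) :
    HasSum (fun i => c i * logKernelTail α (n + i)) (∫ s in Set.Ioo (0 : ℝ) 1, f s) := by
  have h1 := hasSum_integral_of_nonneg (μ := MeasureTheory.volume.restrict (Set.Ioo (0 : ℝ) 1))
    (F := fun i s => c i * logKernelDensity α s (n + i)) (f := f)
    (fun i => ((continuousOn_logKernelDensity hα (n + i)).const_smul (c i)).aestronglyMeasurable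
      measurableSet_Ioo)
    (fun i => MeasureTheory.ae_restrict_of_forall_mem measurableSet_Ioo fun s hs =>
      mul_nonneg (hc i) (logKernelDensity_nonneg hα hs _)) hf
    (MeasureTheory.ae_restrict_of_forall_mem measurableSet_Ioo h)
  simp only [MeasureTheory.integral_const_mul] at h1
  exact h1

theorem hasSum_cesaroNumber_add_one_mul_logKernelTail (hα : 0 ≤ α) :
    HasSum (fun i => cesaroNumber (α + 1) i * logKernelTail α i) 1 := by
  have h := hasSum_mul_logKernelTail hα (c := cesaroNumber (α + 1))
    (cesaroNumber_nonneg (by linarith)) 0 (f := fun _ => 1) (by simp)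
    fun s hs => by simpa using hasSum_cesaroNumber_add_one_mul_logKernelDensity hα hs
  simpa using h

theorem hasSum_cesaroNumber_mul_logKernelTail (hα : 0 ≤ α) (n : ℕ) :
    HasSum (fun i => cesaroNumber α i * logKernelTail α (n + i)) (-logKernel (n + 1)) := by
  have h := hasSum_mul_logKernelTail hα (cesaroNumber_nonneg hα) n
    ((intervalIntegrable_iff_integrableOn_Ioo_of_le zero_le_one).1
      ((continuous_cesaroNumber_neg (n + 1)).neg.intervalIntegrable 0 1))
    fun s hs => hasSum_cesaroNumber_mul_logKernelDensity hα hs n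
  simp only [Pi.neg_apply] at h
  rwa [MeasureTheory.integral_neg, ← MeasureTheory.integral_Ioc_eq_integral_Ioo,
    ← intervalIntegral.integral_of_le zero_le_one] at h

theorem summable_cesaroNumber_succ_mul_logKernelTail (hα : 0 ≤ α) :
    Summable fun i => cesaroNumber (α + 1) (i + 1) * logKernelTail α i := by
  refine ((hasSum_cesaroNumber_add_one_mul_logKernelTail hα).summable.mul_left
    (1 + α)).of_nonneg_of_le (fun i => mul_nonneg (cesaroNumber_nonneg (by linarith) _)
    (logKernelTail_nonneg hα i)) fun i => ?_
  rw [← mul_assoc]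
  exact mul_le_mul_of_nonneg_right (cesaroNumber_succ_le hα i) (logKernelTail_nonneg hα i)

theorem summable_abs_logKernelWeyl (hα : 0 ≤ α) :
    Summable fun n => |logKernelWeyl α n| * cesaroNumber (α + 1) n := by
  rw [← summable_nat_add_iff 1]
  refine (summable_cesaroNumber_succ_mul_logKernelTail hα).congr fun i => ?_
  rw [logKernelWeyl, abs_neg, abs_of_nonneg (logKernelTail_nonneg hα i), mul_comm]

theorem summable_cesaroNumber_mul_logKernelTail_shift (hα : 0 ≤ α) :
    Summable fun i => cesaroNumber α (i + 1) * logKernelTail α i :=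
  (summable_cesaroNumber_succ_mul_logKernelTail hα).of_nonneg_of_le
    (fun i => mul_nonneg (cesaroNumber_nonneg hα _) (logKernelTail_nonneg hα i))
    fun i => mul_le_mul_of_nonneg_right (cesaroNumber_le_add_one hα _) (logKernelTail_nonneg hα i)

/-- This is u(1) = 0. Pascal's rule splits the tail into a sum cancelled by the entry at 0 and the
total mass 1. -/
theorem hasSum_logKernelWeyl_mul_cesaroNumber (hα : 0 ≤ α) :
    HasSum (fun n => logKernelWeyl α n * cesaroNumber (α + 1) n) 0 := by
  have h1 := (summable_cesaroNumber_mul_logKernelTail_shift hα).hasSum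
  have h2 := (h1.add (hasSum_cesaroNumber_add_one_mul_logKernelTail hα)).neg
  rw [← hasSum_nat_add_iff' 1]
  simp only [Finset.range_one, Finset.sum_singleton, cesaroNumber_zero, mul_one]
  have e : (fun i => -(cesaroNumber α (i + 1) * logKernelTail α i
      + cesaroNumber (α + 1) i * logKernelTail α i))
      = fun i => logKernelWeyl α (i + 1) * cesaroNumber (α + 1) (i + 1) := by
    ext i
    rw [logKernelWeyl, cesaroNumber_pascal]
    ring
  rw [e] at h2
  convert h2 using 1
  rw [logKernelWeyl]
  ring

/-- Positive indices come from integrating over s; the entry at 0 is the one that makes the constant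
coefficient u(0) = 1. -/
theorem hasSum_cesaroNumber_mul_logKernelWeyl (hα : 0 ≤ α) (m : ℕ) :
    HasSum (fun j => cesaroNumber α j * logKernelWeyl α (m + j)) (logKernel m) := by
  cases m with
  | zero =>
    have h1 := (summable_cesaroNumber_mul_logKernelTail_shift hα).hasSum.neg
    rw [← hasSum_nat_add_iff' 1]
    simp only [Finset.range_one, Finset.sum_singleton, cesaroNumber_zero, one_mul, zero_add]
    have e : logKernel 0 - logKernelWeyl α 0
        = -∑' i, cesaroNumber α (i + 1) * logKernelTail α i := by
      simp [logKernel, logKernelWeyl, cesaroNumber_zero]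
    rw [e]
    simpa only [logKernelWeyl, mul_neg] using h1
  | succ m =>
    have h := (hasSum_cesaroNumber_mul_logKernelTail hα m).neg
    rw [neg_neg] at h
    have e : (fun i => -(cesaroNumber α i * logKernelTail α (m + i)))
        = fun j => cesaroNumber α j * logKernelWeyl α (m + 1 + j) := by
      ext j
      rw [show m + 1 + j = m + j + 1 by ring, logKernelWeyl]
      ring
    rw [e] at h
    exact h

theorem logKernelWeyl_nonpos (hα : 0 ≤ α) {n : ℕ} (hn : 0 < n) : logKernelWeyl α n ≤ 0 := by
  obtain ⟨n, rfl⟩ := Nat.exists_eq_succ_of_ne_zero hn.ne'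
  exact neg_nonpos.2 (logKernelTail_nonneg hα n)

/-- A decreasing nonnegative sequence of weighted mass 1 is at most 1/k^{α+2}(n) at n, because
k^{α+2}(n) is the sum of the weights up to n. -/
theorem abs_logKernelWeyl_le (hα : 0 ≤ α) {n : ℕ} (hn : 0 < n) :
    |logKernelWeyl α n| ≤ (α + 1) * cesaroWeight α n := by
  obtain ⟨n, rfl⟩ := Nat.exists_eq_succ_of_ne_zero hn.ne'
  rw [Nat.succ_eq_add_one, logKernelWeyl, abs_neg, abs_of_nonneg (logKernelTail_nonneg hα n)]
  have hk : ∀ i, 0 ≤ cesaroNumber (α + 1) i := cesaroNumber_nonneg (by linarith)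
  have h1 : ∑ i ∈ Finset.range (n + 1), cesaroNumber (α + 1) i * logKernelTail α i ≤ 1 :=
    sum_le_hasSum _ (fun i _ => mul_nonneg (hk i) (logKernelTail_nonneg hα i))
      (hasSum_cesaroNumber_add_one_mul_logKernelTail hα)
  have h2 : cesaroNumber (α + 2) n * logKernelTail α n ≤ 1 := by
    refine le_trans ?_ h1
    rw [show α + 2 = α + 1 + 1 by ring, ← sum_range_cesaroNumber, Finset.sum_mul]
    refine Finset.sum_le_sum fun i hi => mul_le_mul_of_nonneg_left ?_ (hk i)
    exact logKernelTail_antitone hα (by simpa [Nat.lt_succ_iff] using hi)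
  have h3 := cesaroNumber_add_two α n
  have h4 := cesaroNumber_pos (α := α + 1) (by linarith) (n + 1)
  rw [cesaroWeight, mul_one_div, le_div_iff₀ (by positivity)]
  push_cast
  rw [← h3]
  nlinarith

end Weyl

/-! ### Elementary sums with square roots. -/

/-- A telescoping majorant, giving a sum over i of order 1/√K. -/
theorem one_div_mul_sqrt_le {K : ℕ} (hK : 0 < K) (i : ℕ) :
    1 / (((K : ℝ) + i) * √((i : ℝ) + 1))
      ≤ 2 * (4 / (√(i : ℝ) + √(K : ℝ)) - 4 / (√((i : ℝ) + 1) + √(K : ℝ))) := by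
  have hK1 : (1 : ℝ) ≤ K := by exact_mod_cast hK
  have hi : (0 : ℝ) ≤ i := i.cast_nonneg
  have hA : 0 < √(K : ℝ) := Real.sqrt_pos.2 (by linarith)
  have hq : 0 < √((i : ℝ) + 1) := Real.sqrt_pos.2 (by linarith)
  have hp : 0 ≤ √(i : ℝ) := Real.sqrt_nonneg _
  have hA2 : √(K : ℝ) ^ 2 = K := Real.sq_sqrt (by linarith)
  have hq2 : √((i : ℝ) + 1) ^ 2 = i + 1 := Real.sq_sqrt (by linarith)
  have hp2 : √(i : ℝ) ^ 2 = i := Real.sq_sqrt hi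
  have hpq : √(i : ℝ) ≤ √((i : ℝ) + 1) := Real.sqrt_le_sqrt (by linarith)
  generalize √(K : ℝ) = A at *
  generalize √((i : ℝ) + 1) = q at *
  generalize √(i : ℝ) = p at *
  have e : 2 * (4 / (p + A) - 4 / (q + A)) = 8 / ((p + A) * (q + A) * (q + p)) := by
    have h1 : p + A ≠ 0 := by positivity
    have h2 : q + A ≠ 0 := by positivity
    have h3 : q + p ≠ 0 := by positivity
    field_simp
    linear_combination 8 * hq2 - 8 * hp2
  rw [e, div_le_div_iff₀ (by positivity) (by positivity)]
  -- As p ≤ q, the left side is at most (q+A)² ≤ 2(i+1+K); the extra 2 is absorbed by K ≥ 1.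
  have h1 : (p + A) * (q + A) ≤ 4 * (K + i) := by nlinarith [sq_nonneg (q - A)]
  have h2 : (p + A) * (q + A) * (q + p) ≤ 4 * (K + i) * (2 * q) :=
    mul_le_mul h1 (by linarith) (by positivity) (by positivity)
  linarith

theorem sum_range_one_div_mul_sqrt_le {K : ℕ} (hK : 0 < K) (n : ℕ) :
    ∑ i ∈ Finset.range n, 1 / (((K : ℝ) + i) * √((i : ℝ) + 1)) ≤ 8 / √(K : ℝ) := by
  have hA : 0 < √(K : ℝ) := Real.sqrt_pos.2 (by exact_mod_cast hK)
  have h : ∑ i ∈ Finset.range n, 1 / (((K : ℝ) + i) * √((i : ℝ) + 1))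
      ≤ 2 * (4 / (√((0 : ℕ) : ℝ) + √(K : ℝ)) - 4 / (√(n : ℝ) + √(K : ℝ))) := by
    rw [← Finset.sum_range_sub' (fun i : ℕ => 4 / (√(i : ℝ) + √(K : ℝ))), Finset.mul_sum]
    refine Finset.sum_le_sum fun i _ => ?_
    have := one_div_mul_sqrt_le hK i
    push_cast
    exact this
  have h2 : 0 ≤ 4 / (√(n : ℝ) + √(K : ℝ)) := by positivity
  have h3 : 2 * (4 / (√((0 : ℕ) : ℝ) + √(K : ℝ))) = 8 / √(K : ℝ) := by
    simp
    ring
  linarith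

theorem summable_one_div_mul_sqrt {K : ℕ} (hK : 0 < K) :
    Summable fun i : ℕ => 1 / (((K : ℝ) + i) * √((i : ℝ) + 1)) :=
  summable_of_sum_range_le (fun _ => by positivity) (sum_range_one_div_mul_sqrt_le hK)

theorem sum_range_one_div_sqrt_le (n : ℕ) :
    ∑ k ∈ Finset.range n, 1 / √((k : ℝ) + 1) ≤ 2 * √(n : ℝ) := by
  induction n with
  | zero => simp
  | succ n ih =>
    rw [Finset.sum_range_succ]
    push_cast
    have hq : 0 < √((n : ℝ) + 1) := Real.sqrt_pos.2 (by positivity)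
    have hq2 : √((n : ℝ) + 1) ^ 2 = n + 1 := Real.sq_sqrt (by positivity)
    have hp2 : √(n : ℝ) ^ 2 = n := Real.sq_sqrt n.cast_nonneg
    have h : 1 / √((n : ℝ) + 1) ≤ 2 * (√((n : ℝ) + 1) - √(n : ℝ)) := by
      rw [div_le_iff₀ hq]
      nlinarith [sq_nonneg (√((n : ℝ) + 1) - √(n : ℝ))]
    linarith

/-- The sequence `n ↦ 1 / (n √(n - k))` for `n > k`, extended by zero. -/
noncomputable def invMulSqrt (k n : ℕ) : ℝ := if k < n then 1 / (n * √((n : ℝ) - k)) else 0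

theorem invMulSqrt_nonneg (k n : ℕ) : 0 ≤ invMulSqrt k n := by
  unfold invMulSqrt
  split_ifs <;> positivity

theorem summable_invMulSqrt_and_tsum_le (k : ℕ) :
    Summable (invMulSqrt k) ∧ ∑' n, invMulSqrt k n ≤ 8 / √((k : ℝ) + 1) := by
  have e : ∀ i : ℕ, invMulSqrt k (k + 1 + i)
      = 1 / ((((k + 1 : ℕ) : ℝ) + i) * √((i : ℝ) + 1)) := by
    intro i
    rw [invMulSqrt, if_pos (by omega)]
    push_cast
    rw [show (k : ℝ) + 1 + i - k = i + 1 by ring]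
  have hsupp : Function.support (invMulSqrt k) ⊆ Set.range (k + 1 + · : ℕ → ℕ) := by
    intro n hn
    by_contra hc
    refine hn (if_neg fun h => hc ⟨n - (k + 1), ?_⟩)
    simp only
    omega
  have hs := summable_one_div_mul_sqrt k.succ_pos
  constructor
  · rw [← (add_right_injective (k + 1)).summable_iff fun n hn =>
      Function.notMem_support.1 fun h => hn (hsupp h)]
    exact hs.congr fun i => (e i).symm
  · rw [← (add_right_injective (k + 1)).tsum_eq hsupp]
    simp only [e]
    have h := Real.tsum_le_of_sum_range_le (fun _ => by positivity)
      (sum_range_one_div_mul_sqrt_le k.succ_pos)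
    exact_mod_cast h

/-! ### The formal Weyl difference of log(1-z) and its product with u. -/

theorem hasSum_mul_cesaroCoeff_iff (α : ℝ) (g : ℕ → ℝ) (m : ℕ) (x : ℝ) :
    HasSum (fun n => g n * cesaroCoeff α n m) x
      ↔ HasSum (fun j => cesaroNumber α j * g (m + j)) x := by
  rw [← (add_right_injective m).hasSum_iff (f := fun n => g n * cesaroCoeff α n m)]
  · have e : ((fun n => g n * cesaroCoeff α n m) ∘ fun j => m + j)
        = fun j => cesaroNumber α j * g (m + j) := by
      ext j
      simp only [Function.comp, cesaroCoeff]
      rw [if_pos (by omega), Nat.add_sub_cancel_left, mul_comm]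
    rw [e]
  · intro n hn
    have : ¬ m ≤ n := fun h => hn ⟨n - m, by simp only; omega⟩
    simp [cesaroCoeff, this]

theorem weylSum_ofReal {α : ℝ} {g : ℕ → ℝ} {m : ℕ} {x : ℝ}
    (h : HasSum (fun j => cesaroNumber α j * g (m + j)) x) :
    weylSum α (fun n => (g n : ℂ)) m = x := by
  have h' := Complex.hasSum_ofReal.2 h
  simp only [Complex.ofReal_mul] at h'
  exact h'.tsum_eq

/-- The constant `∫_0^1 (1 - u^α) / (1 - u) du`. -/
noncomputable def logConst (α : ℝ) : ℝ := ∫ u in (0 : ℝ)..1, (1 - u ^ α) / (1 - u)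

/-- The formal Weyl difference of the Taylor coefficients of `log (1 - z)`. -/
noncomputable def logWeyl (α : ℝ) (n : ℕ) : ℝ := if n = 0 then logConst α else -cesaroWeight α n

section Log

variable {α : ℝ}

theorem logConst_nonneg (hα : 0 ≤ α) : 0 ≤ logConst α :=
  (hasSum_cesaroNumber_mul_cesaroWeight_zero hα).nonneg fun n =>
    mul_nonneg (cesaroNumber_nonneg hα n) (cesaroWeight_nonneg hα n)

theorem logWeyl_eq (α : ℝ) (n : ℕ) :
    logWeyl α n = (if n = 0 then logConst α else 0) - cesaroWeight α n := by
  unfold logWeyl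
  split_ifs with h
  · rw [h, cesaroWeight_zero, sub_zero]
  · rw [zero_sub]

theorem abs_logWeyl (hα : 0 ≤ α) (n : ℕ) :
    |logWeyl α n| = (if n = 0 then logConst α else 0) + cesaroWeight α n := by
  unfold logWeyl
  split_ifs with h
  · rw [h, cesaroWeight_zero, add_zero, abs_of_nonneg (logConst_nonneg hα)]
  · rw [zero_add, abs_neg, abs_of_nonneg (cesaroWeight_nonneg hα n)]

theorem hasSum_cesaroNumber_mul_cesaroWeight_add (hα : 0 ≤ α) (m : ℕ) :
    HasSum (fun j => cesaroNumber α j * cesaroWeight α (m + j))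
      ((if m = 0 then logConst α else 0) + 1 / (m : ℝ)) := by
  rcases Nat.eq_zero_or_pos m with rfl | hm
  · simpa [logConst] using hasSum_cesaroNumber_mul_cesaroWeight_zero hα
  · simpa [hm.ne'] using hasSum_cesaroNumber_mul_cesaroWeight hα hm

theorem hasSum_cesaroNumber_mul_ite (α c : ℝ) (m : ℕ) :
    HasSum (fun j => cesaroNumber α j * if m + j = 0 then c else 0) (if m = 0 then c else 0) := by
  have h := hasSum_single (f := fun j => cesaroNumber α j * if m + j = 0 then c else 0) 0
    fun j hj => by rw [if_neg (by omega), mul_zero]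
  simpa [cesaroNumber_zero] using h

theorem hasSum_cesaroNumber_mul_logWeyl (hα : 0 ≤ α) (m : ℕ) :
    HasSum (fun j => cesaroNumber α j * logWeyl α (m + j)) (-(1 / (m : ℝ))) := by
  have h := (hasSum_cesaroNumber_mul_ite α (logConst α) m).sub
    (hasSum_cesaroNumber_mul_cesaroWeight_add hα m)
  simp only [← mul_sub, ← logWeyl_eq] at h
  rw [show -(1 / (m : ℝ)) = (if m = 0 then logConst α else 0)
    - ((if m = 0 then logConst α else 0) + 1 / (m : ℝ)) by ring]
  exact h

/-- Supplies the bounded Weyl sums of absolute values that replace summability in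
`hasSum_mul_cesaroStructure`. -/
theorem hasSum_abs_logWeyl_mul_cesaroCoeff (hα : 0 ≤ α) (m : ℕ) :
    HasSum (fun n => |logWeyl α n| * cesaroCoeff α n m)
      ((if m = 0 then logConst α else 0) + ((if m = 0 then logConst α else 0) + 1 / (m : ℝ))) := by
  rw [hasSum_mul_cesaroCoeff_iff]
  simp only [abs_logWeyl hα, mul_add]
  exact (hasSum_cesaroNumber_mul_ite α (logConst α) m).add
    (hasSum_cesaroNumber_mul_cesaroWeight_add hα m)

theorem hasSum_cesaroNumber_neg_mul_ite (α : ℝ) (k : ℕ) :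
    HasSum (fun j => cesaroNumber (-α) j * if k + j = 1 then 1 else 0)
      (if k = 1 then 1 else if k = 0 then -α else 0) := by
  rcases lt_or_ge 1 k with hk | hk
  · rw [if_neg (by omega), if_neg (by omega)]
    have e : (fun j => cesaroNumber (-α) j * if k + j = 1 then 1 else 0) = fun _ => (0 : ℝ) := by
      ext j
      rw [if_neg (by omega), mul_zero]
    rw [e]
    exact hasSum_zero
  · have h := hasSum_single (f := fun j => cesaroNumber (-α) j * if k + j = 1 then 1 else 0)
      (1 - k) fun j hj => by rw [if_neg (by omega), mul_zero]
    rw [if_pos (by omega), mul_one] at h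
    obtain rfl | rfl : k = 0 ∨ k = 1 := by omega
    · simpa [cesaroNumber_one] using h
    · simpa [cesaroNumber_zero] using h

/-- The Weyl difference of `W^{-α} b * u` with `b` the weights and `u` the log kernel. -/
noncomputable def logTotal (α : ℝ) (k : ℕ) : ℝ :=
  (if k = 1 then 1 else if k = 0 then -α else 0) + logConst α * logKernelWeyl α k

/-- With c = `logConst α`, the series ∑ b_n e_n is c - log(1-z), so its product with u is c u + z;
the Weyl difference of z is -α at 0 and 1 at 1. -/
theorem hasSum_cesaroWeight_mul_logKernelWeyl (hα : 0 ≤ α) (k : ℕ) :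
    HasSum (fun q : ℕ × ℕ => cesaroWeight α q.1 * logKernelWeyl α q.2 *
      cesaroStructure α q.1 q.2 k) (logTotal α k) := by
  have h1 := hasSum_mul_cesaroStructure hα (g₁ := fun n => (logWeyl α n : ℂ))
    (g₂ := fun n => (logKernelWeyl α n : ℂ)) (Λ := 1 + 2 * logConst α)
    (fun p => by
      simpa only [Complex.norm_real, Real.norm_eq_abs]
        using (hasSum_abs_logWeyl_mul_cesaroCoeff hα p).summable)
    (fun p => by
      simp only [Complex.norm_real, Real.norm_eq_abs]
      rw [(hasSum_abs_logWeyl_mul_cesaroCoeff hα p).tsum_eq]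
      have h0 := logConst_nonneg hα
      rcases Nat.eq_zero_or_pos p with rfl | hp
      · simp
        linarith
      · have : 1 / (p : ℝ) ≤ 1 := by
          rw [div_le_one (by exact_mod_cast hp)]
          exact_mod_cast hp
        simp only [hp.ne', if_false]
        linarith)
    (by simpa only [Complex.norm_real, Real.norm_eq_abs] using summable_abs_logKernelWeyl hα) k
  have e : ∀ m, ∑ p ∈ Finset.HasAntidiagonal.antidiagonal m,
      weylSum α (fun n => (logWeyl α n : ℂ)) p.1 * weylSum α (fun n => (logKernelWeyl α n : ℂ)) p.2
      = ((-if m = 1 then 1 else 0 : ℝ) : ℂ) := by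
    intro m
    rw [← sum_antidiagonal_mul_logKernel m, ← Finset.sum_neg_distrib]
    push_cast
    refine Finset.sum_congr rfl fun p _ => ?_
    rw [weylSum_ofReal (hasSum_cesaroNumber_mul_logWeyl hα p.1),
      weylSum_ofReal (hasSum_cesaroNumber_mul_logKernelWeyl hα p.2)]
    push_cast
    ring
  simp only [e, ← Complex.ofReal_mul, ← Complex.ofReal_tsum] at h1
  rw [Complex.hasSum_ofReal] at h1
  simp only [mul_neg, tsum_neg] at h1
  rw [(hasSum_cesaroNumber_neg_mul_ite α k).tsum_eq] at h1
  have h2 : HasSum (fun q : ℕ × ℕ => (if q.1 = 0 then logConst α else 0) * logKernelWeyl α q.2 *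
      cesaroStructure α q.1 q.2 k) (logConst α * logKernelWeyl α k) := by
    have h := hasSum_single (f := fun q : ℕ × ℕ => (if q.1 = 0 then logConst α else 0) *
      logKernelWeyl α q.2 * cesaroStructure α q.1 q.2 k) (0, k) fun q hq => by
        rcases q with ⟨n, i⟩
        by_cases hn : n = 0
        · subst hn
          have : k ≠ i := fun h => hq (by rw [h])
          simp [cesaroStructure_zero, this]
        · simp [hn]
    simpa [cesaroStructure_zero] using h
  have h3 := h2.sub h1
  simp only [← sub_mul] at h3
  have e3 : logTotal α k = logConst α * logKernelWeyl α k
      - -(if k = 1 then 1 else if k = 0 then -α else 0) := by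
    rw [logTotal]
    ring
  rw [e3]
  have e4 : ∀ n, (if n = 0 then logConst α else 0) - logWeyl α n = cesaroWeight α n := fun n => by
    rw [logWeyl_eq]
    ring
  simpa only [e4] using h3

end Log

/-! ### The uniform bound for S_N u. -/

/-- The weights `cesaroWeight α n` cut off at `n = N`. -/
noncomputable def truncWeight (α : ℝ) (N n : ℕ) : ℝ := if n ≤ N then cesaroWeight α n else 0

/-- The coefficients of `(∑_{n ≤ N} b_n e_n) u` in the family `e_k`, where `b_n` are the
weights and `u` is the power series with coefficients `logKernel`. -/
noncomputable def truncLogConv (α : ℝ) (N k : ℕ) : ℝ :=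
  ∑' q : ℕ × ℕ, truncWeight α N q.1 * logKernelWeyl α q.2 * cesaroStructure α q.1 q.2 k

section Bound

variable {α : ℝ}

theorem truncWeight_nonneg (hα : 0 ≤ α) (N n : ℕ) : 0 ≤ truncWeight α N n := by
  unfold truncWeight
  split_ifs
  exacts [cesaroWeight_nonneg hα n, le_rfl]

theorem summable_norm_truncWeight (α : ℝ) (N : ℕ) :
    Summable fun n => ‖(truncWeight α N n : ℂ)‖ * cesaroNumber (α + 1) n :=
  summable_of_ne_finset_zero (s := Finset.range (N + 1)) fun n hn => by
    rw [truncWeight, if_neg (by simpa using hn)]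
    simp

theorem summable_norm_logKernelWeyl (hα : 0 ≤ α) :
    Summable fun n => ‖(logKernelWeyl α n : ℂ)‖ * cesaroNumber (α + 1) n := by
  simpa only [Complex.norm_real, Real.norm_eq_abs] using summable_abs_logKernelWeyl hα

theorem cesaroConv_truncWeight (α : ℝ) (N k : ℕ) :
    cesaroConv α (fun n => (truncWeight α N n : ℂ)) (fun n => (logKernelWeyl α n : ℂ)) k
      = (truncLogConv α N k : ℂ) := by
  rw [cesaroConv, truncLogConv, Complex.ofReal_tsum]
  push_cast
  rfl

theorem summable_abs_truncLogConv (hα : 0 ≤ α) (N : ℕ) :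
    Summable fun k => |truncLogConv α N k| * cesaroNumber (α + 1) k := by
  have h := summable_norm_cesaroConv hα (summable_norm_truncWeight α N)
    (summable_norm_logKernelWeyl hα)
  simpa only [cesaroConv_truncWeight, Complex.norm_real, Real.norm_eq_abs] using h

/-- For k > N ≥ n the negative branch of the structure constants is excluded, and i = 0, where the
Weyl difference of u could be positive, contributes nothing. -/
theorem truncLogConv_nonpos (hα : 0 ≤ α) {N k : ℕ} (hk : N < k) : truncLogConv α N k ≤ 0 := by
  refine tsum_nonpos fun q => ?_
  rcases q with ⟨n, i⟩
  simp only
  by_cases hn : n ≤ N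
  · have hM : 0 ≤ cesaroStructure α n i k := by
      unfold cesaroStructure
      split_ifs with h1 h2
      · exact cesaroNumber_nonneg hα _
      · omega
      · exact le_rfl
    rcases Nat.eq_zero_or_pos i with rfl | hi
    · rw [cesaroStructure_eq_zero α (by omega), mul_zero]
    · exact mul_nonpos_of_nonpos_of_nonneg (mul_nonpos_of_nonneg_of_nonpos
        (truncWeight_nonneg hα N n) (logKernelWeyl_nonpos hα hi)) hM
  · rw [truncWeight, if_neg hn, zero_mul, zero_mul]

/-- Multiplicativity of the calculus at the scalar a = 1, where u vanishes. -/
theorem tsum_truncLogConv_mul (hα : 0 ≤ α) (N : ℕ) :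
    ∑' k, truncLogConv α N k * cesaroNumber (α + 1) k = 0 := by
  have hk : ∀ n, 0 ≤ cesaroNumber (α + 1) n := cesaroNumber_nonneg (by linarith)
  have h := tsum_smul_cesaroElem_mul (A := ℂ) (a := 1) (C := 1) hα
    (fun n => by
      rw [cesaroElem_one, smul_eq_mul, mul_one, Complex.norm_real, Real.norm_of_nonneg (hk n),
        one_mul])
    (summable_norm_truncWeight α N) (summable_norm_logKernelWeyl hα)
  simp only [cesaroElem_one, smul_eq_mul, mul_one, cesaroConv_truncWeight,
    ← Complex.ofReal_mul, ← Complex.ofReal_tsum,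
    (hasSum_logKernelWeyl_mul_cesaroNumber hα).tsum_eq, mul_zero] at h
  exact_mod_cast h.symm

/-- Only n > N and i > k contribute, with size about 1/(n i (n+i-k)). The inequality n+i-k ≥ √(n-N)
√(i-k) separates the two variables. -/
theorem abs_tail_le (hα : 0 ≤ α) {N k : ℕ} (hk : k ≤ N) (q : ℕ × ℕ) :
    |(cesaroWeight α q.1 - truncWeight α N q.1) * logKernelWeyl α q.2 *
      cesaroStructure α q.1 q.2 k| * cesaroNumber (α + 1) k
      ≤ α * (α + 1) * (invMulSqrt N q.1 * invMulSqrt k q.2) := by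
  rcases q with ⟨n, i⟩
  simp only
  have hR : 0 ≤ α * (α + 1) * (invMulSqrt N n * invMulSqrt k i) :=
    mul_nonneg (by positivity) (mul_nonneg (invMulSqrt_nonneg _ _) (invMulSqrt_nonneg _ _))
  by_cases hn : n ≤ N
  · rw [truncWeight, if_pos hn, sub_self, zero_mul, zero_mul, abs_zero, zero_mul]
    exact hR
  · by_cases hi : k < i
    · have hn' : N < n := by omega
      have hb := cesaroWeight_nonneg hα n
      have hκ := cesaroNumber_nonneg hα (n + i - k)
      have hk0 : ∀ n, 0 < cesaroNumber (α + 1) n := cesaroNumber_pos (by linarith)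
      rw [truncWeight, if_neg hn, sub_zero, cesaroStructure, if_neg (by omega),
        if_pos ⟨by omega, hi⟩, abs_mul, abs_mul, abs_neg, abs_of_nonneg hb, abs_of_nonneg hκ]
      have hn0 : (0 : ℝ) < n := by exact_mod_cast (by omega : 0 < n)
      have hi0 : (0 : ℝ) < i := by exact_mod_cast (by omega : 0 < i)
      have hNn : (N : ℝ) < n := by exact_mod_cast hn'
      have hki : (k : ℝ) < i := by exact_mod_cast hi
      have hN0 : (0 : ℝ) ≤ N := N.cast_nonneg
      have h1 := cesaroNumber_mul_cesaroNumber_le hα (by omega : k < n) hi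
      have hl : ((n + i - k : ℕ) : ℝ) = n + (i - k) := by
        rw [Nat.cast_sub (by omega)]
        push_cast
        ring
      have hs1 : 0 < √((n : ℝ) - N) := Real.sqrt_pos.2 (by linarith)
      have hs2 : 0 < √((i : ℝ) - k) := Real.sqrt_pos.2 (by linarith)
      have h2 : √((n : ℝ) - N) * √((i : ℝ) - k) ≤ ((n + i - k : ℕ) : ℝ) := by
        rw [hl]
        nlinarith [Real.sq_sqrt (by linarith : 0 ≤ (n : ℝ) - N),
          Real.sq_sqrt (by linarith : 0 ≤ (i : ℝ) - k),
          sq_nonneg (√((n : ℝ) - N) - √((i : ℝ) - k))]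
      have h3 : α / ((n + i - k : ℕ) : ℝ) ≤ α / (√((n : ℝ) - N) * √((i : ℝ) - k)) :=
        div_le_div_of_nonneg_left hα (mul_pos hs1 hs2) h2
      calc cesaroWeight α n * |logKernelWeyl α i| * cesaroNumber α (n + i - k)
            * cesaroNumber (α + 1) k
          ≤ cesaroWeight α n * ((α + 1) * cesaroWeight α i) *
            (α / (√((n : ℝ) - N) * √((i : ℝ) - k)) *
              (cesaroNumber (α + 1) n * cesaroNumber (α + 1) i)) := by
            rw [mul_assoc]
            refine mul_le_mul (mul_le_mul_of_nonneg_left (abs_logKernelWeyl_le hα (by omega)) hb)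
              (h1.trans (mul_le_mul_of_nonneg_right h3 (mul_pos (hk0 _) (hk0 _)).le))
              (mul_nonneg hκ (hk0 k).le)
              (mul_nonneg hb (mul_nonneg (by linarith) (cesaroWeight_nonneg hα i)))
        _ = α * (α + 1) * ((cesaroWeight α n * cesaroNumber (α + 1) n / √((n : ℝ) - N)) *
            (cesaroWeight α i * cesaroNumber (α + 1) i / √((i : ℝ) - k))) := by
            field_simp
        _ = _ := by
            rw [cesaroWeight_mul hα, cesaroWeight_mul hα, invMulSqrt, invMulSqrt, if_pos hn',
              if_pos hi, div_div, div_div]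
    · rw [cesaroStructure, if_neg (by omega), if_neg (by omega), mul_zero, abs_zero, zero_mul]
      exact hR

/-- The truncated product is the complete product minus the tail n > N, which factorises into two
square-root sums. -/
theorem abs_truncLogConv_mul_le (hα : 0 ≤ α) {N k : ℕ} (hk : k ≤ N) :
    |truncLogConv α N k| * cesaroNumber (α + 1) k
      ≤ |logTotal α k| * cesaroNumber (α + 1) k
        + α * (α + 1) * (8 / √((N : ℝ) + 1) * (8 / √((k : ℝ) + 1))) := by
  have hk0 : 0 < cesaroNumber (α + 1) k := cesaroNumber_pos (by linarith) k
  obtain ⟨hN1, hN2⟩ := summable_invMulSqrt_and_tsum_le N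
  obtain ⟨hk1, hk2⟩ := summable_invMulSqrt_and_tsum_le k
  have hprod : HasSum (fun q : ℕ × ℕ => invMulSqrt N q.1 * invMulSqrt k q.2)
      ((∑' n, invMulSqrt N n) * ∑' n, invMulSqrt k n) := by
    rw [tsum_mul_tsum_of_summable_norm hN1.norm hk1.norm]
    exact (summable_mul_of_summable_norm hN1.norm hk1.norm).hasSum
  have hbd : HasSum (fun q : ℕ × ℕ => α * (α + 1) * (invMulSqrt N q.1 * invMulSqrt k q.2) /
      cesaroNumber (α + 1) k) _ := (hprod.mul_left (α * (α + 1))).div_const _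
  have hle : ∀ q : ℕ × ℕ, ‖(cesaroWeight α q.1 - truncWeight α N q.1) * logKernelWeyl α q.2 *
      cesaroStructure α q.1 q.2 k‖ ≤ α * (α + 1) * (invMulSqrt N q.1 * invMulSqrt k q.2) /
      cesaroNumber (α + 1) k := by
    intro q
    rw [le_div_iff₀ hk0]
    exact abs_tail_le hα hk q
  have hs : Summable fun q : ℕ × ℕ => (cesaroWeight α q.1 - truncWeight α N q.1) *
      logKernelWeyl α q.2 * cesaroStructure α q.1 q.2 k := Summable.of_norm_bounded hbd.summable hle
  have h1 := tsum_of_norm_bounded hbd hle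
  have h2 := (hasSum_cesaroWeight_mul_logKernelWeyl hα k).sub hs.hasSum
  have e : (fun q : ℕ × ℕ => cesaroWeight α q.1 * logKernelWeyl α q.2 * cesaroStructure α q.1 q.2 k
      - (cesaroWeight α q.1 - truncWeight α N q.1) * logKernelWeyl α q.2 *
        cesaroStructure α q.1 q.2 k)
      = fun q : ℕ × ℕ => truncWeight α N q.1 * logKernelWeyl α q.2 * cesaroStructure α q.1 q.2 k := by
    ext q
    ring
  rw [e] at h2
  rw [truncLogConv, h2.tsum_eq]
  rw [Real.norm_eq_abs, le_div_iff₀ hk0] at h1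
  calc _ ≤ (|logTotal α k| + |∑' q : ℕ × ℕ, (cesaroWeight α q.1 - truncWeight α N q.1) *
      logKernelWeyl α q.2 * cesaroStructure α q.1 q.2 k|) * cesaroNumber (α + 1) k :=
        mul_le_mul_of_nonneg_right (abs_sub _ _) hk0.le
    _ ≤ _ := by
      rw [add_mul]
      refine add_le_add le_rfl (h1.trans (mul_le_mul_of_nonneg_left ?_ (by positivity)))
      exact mul_le_mul hN2 hk2 (tsum_nonneg fun n => invMulSqrt_nonneg _ _) (by positivity)

theorem sum_abs_logTotal_le (hα : 0 ≤ α) (N : ℕ) :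
    ∑ k ∈ Finset.range (N + 1), |logTotal α k| * cesaroNumber (α + 1) k
      ≤ 2 * α + 1 + logConst α * ∑' n, |logKernelWeyl α n| * cesaroNumber (α + 1) n := by
  have hk : ∀ n, 0 ≤ cesaroNumber (α + 1) n := cesaroNumber_nonneg (by linarith)
  have hc := logConst_nonneg hα
  have h1 : ∀ k ∈ Finset.range (N + 1), |logTotal α k| * cesaroNumber (α + 1) k
      ≤ ((if k = 1 then α + 1 else 0) + (if k = 0 then α else 0))
        + logConst α * (|logKernelWeyl α k| * cesaroNumber (α + 1) k) := by
    intro k _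
    rw [logTotal]
    refine (mul_le_mul_of_nonneg_right (abs_add_le _ _) (hk k)).trans ?_
    rw [add_mul, abs_mul, abs_of_nonneg hc, mul_assoc]
    refine add_le_add ?_ le_rfl
    by_cases h1 : k = 1
    · subst h1
      simp [cesaroNumber_one]
    · by_cases h0 : k = 0
      · subst h0
        simp [cesaroNumber_zero, abs_of_nonneg hα]
      · simp [h0, h1]
  refine (Finset.sum_le_sum h1).trans ?_
  rw [Finset.sum_add_distrib, Finset.sum_add_distrib, ← Finset.mul_sum, Finset.sum_ite_eq',
    Finset.sum_ite_eq']
  have h2 : ∑ n ∈ Finset.range (N + 1), |logKernelWeyl α n| * cesaroNumber (α + 1) n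
      ≤ ∑' n, |logKernelWeyl α n| * cesaroNumber (α + 1) n :=
    (summable_abs_logKernelWeyl hα).sum_le_tsum _ fun n _ => mul_nonneg (abs_nonneg _) (hk n)
  have h3 : ∀ p : Prop, ∀ [Decidable p], ∀ x : ℝ, 0 ≤ x → (if p then x else 0) ≤ x := by
    intro p _ x hx
    split_ifs
    exacts [le_rfl, hx]
  have h4 := h3 (1 ∈ Finset.range (N + 1)) (α + 1) (by linarith)
  have h5 := h3 (0 ∈ Finset.range (N + 1)) α hα
  have h6 := mul_le_mul_of_nonneg_left h2 hc
  linarith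

theorem exists_tsum_abs_truncLogConv_le (hα : 0 ≤ α) :
    ∃ K : ℝ, ∀ N, ∑' k, |truncLogConv α N k| * cesaroNumber (α + 1) k ≤ K := by
  have hk : ∀ n, 0 ≤ cesaroNumber (α + 1) n := cesaroNumber_nonneg (by linarith)
  refine ⟨2 * (2 * α + 1 + logConst α * ∑' n, |logKernelWeyl α n| * cesaroNumber (α + 1) n
    + α * (α + 1) * 128), fun N => ?_⟩
  have hs := summable_abs_truncLogConv hα N
  have hs' : Summable fun k => truncLogConv α N k * cesaroNumber (α + 1) k := by
    refine Summable.of_norm (hs.congr fun k => ?_)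
    rw [norm_mul, Real.norm_eq_abs, Real.norm_of_nonneg (hk k)]
  -- Adding the vanishing weighted sum replaces each |t| by |t| + t, which is zero beyond N.
  have h1 : ∑' k, |truncLogConv α N k| * cesaroNumber (α + 1) k
      = ∑' k, (|truncLogConv α N k| * cesaroNumber (α + 1) k
        + truncLogConv α N k * cesaroNumber (α + 1) k) := by
    rw [hs.tsum_add hs', tsum_truncLogConv_mul hα, add_zero]
  have h2 : ∑' k, (|truncLogConv α N k| * cesaroNumber (α + 1) k
        + truncLogConv α N k * cesaroNumber (α + 1) k)
      = ∑ k ∈ Finset.range (N + 1), (|truncLogConv α N k| * cesaroNumber (α + 1) k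
        + truncLogConv α N k * cesaroNumber (α + 1) k) :=
    tsum_eq_sum fun k hkN => by
      rw [abs_of_nonpos (truncLogConv_nonpos hα (by simpa using hkN))]
      ring
  rw [h1, h2]
  have h3 : ∑ k ∈ Finset.range (N + 1), (|truncLogConv α N k| * cesaroNumber (α + 1) k
        + truncLogConv α N k * cesaroNumber (α + 1) k)
      ≤ ∑ k ∈ Finset.range (N + 1), 2 * (|logTotal α k| * cesaroNumber (α + 1) k
        + α * (α + 1) * (8 / √((N : ℝ) + 1) * (8 / √((k : ℝ) + 1)))) := by
    refine Finset.sum_le_sum fun k hkN => ?_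
    have h4 := abs_truncLogConv_mul_le hα (Nat.lt_succ_iff.1 (Finset.mem_range.1 hkN))
    have h5 := mul_le_mul_of_nonneg_right (le_abs_self (truncLogConv α N k)) (hk k)
    linarith
  refine h3.trans ?_
  rw [← Finset.mul_sum, Finset.sum_add_distrib]
  refine mul_le_mul_of_nonneg_left (add_le_add (sum_abs_logTotal_le hα N) ?_) zero_le_two
  rw [← Finset.mul_sum]
  refine mul_le_mul_of_nonneg_left ?_ (by positivity)
  have h6 := sum_range_one_div_sqrt_le (N + 1)
  have hN : 0 < √((N : ℝ) + 1) := Real.sqrt_pos.2 (by positivity)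
  -- The decay 1/√(N+1) of the sum over n compensates exactly the growth √(N+1) of the sum over k.
  calc ∑ k ∈ Finset.range (N + 1), 8 / √((N : ℝ) + 1) * (8 / √((k : ℝ) + 1))
      = 64 / √((N : ℝ) + 1) * ∑ k ∈ Finset.range (N + 1), 1 / √((k : ℝ) + 1) := by
        rw [Finset.mul_sum]
        exact Finset.sum_congr rfl fun k _ => by ring
    _ ≤ 64 / √((N : ℝ) + 1) * (2 * √((N + 1 : ℕ) : ℝ)) :=
        mul_le_mul_of_nonneg_left h6 (by positivity)
    _ = 128 := by
        push_cast
        field_simp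
        norm_num

end Bound

/-! ### Comparison of the weights b_n with n^{-1-α}. -/

/-- By convexity of log Γ, its slope on [n+1, n+α+1] lies between those on the adjacent unit
intervals, log n and log(n+α+1). -/
theorem Gamma_add_div_Gamma_bounds {α : ℝ} (hα : 0 ≤ α) {n : ℕ} (hn : 0 < n) :
    (n : ℝ) ^ α ≤ Real.Gamma (n + α + 1) / Real.Gamma (n + 1) ∧
      Real.Gamma (n + α + 1) / Real.Gamma (n + 1) ≤ ((n : ℝ) + α + 1) ^ α := by
  have hn' : (0 : ℝ) < n := by exact_mod_cast hn
  have hG1 : 0 < Real.Gamma (n + 1) := Real.Gamma_pos_of_pos (by positivity)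
  rcases hα.eq_or_lt with rfl | hα'
  · simp [hG1.ne']
  have hG2 : 0 < Real.Gamma (n + α + 1) := Real.Gamma_pos_of_pos (by positivity)
  have hlog : ∀ x : ℝ, 0 < x →
      Real.log (Real.Gamma (x + 1)) - Real.log (Real.Gamma x) = Real.log x := by
    intro x hx
    rw [Real.Gamma_add_one hx.ne', Real.log_mul hx.ne' (Real.Gamma_pos_of_pos hx).ne']
    ring
  have h1 := Real.convexOn_log_Gamma.slope_mono_adjacent (x := n) (y := n + 1) (z := n + α + 1)
    hn' (by simp only [Set.mem_Ioi]; positivity) (by linarith) (by linarith)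
  have h2 := Real.convexOn_log_Gamma.slope_mono_adjacent (x := n + 1) (y := n + α + 1)
    (z := n + α + 1 + 1) (by simp only [Set.mem_Ioi]; positivity)
    (by simp only [Set.mem_Ioi]; positivity) (by linarith) (by linarith)
  simp only [Function.comp] at h1 h2
  rw [hlog _ hn', show (n : ℝ) + 1 - n = 1 by ring, show (n : ℝ) + α + 1 - (n + 1) = α by ring,
    div_one, le_div_iff₀ hα', ← Real.log_div hG2.ne' hG1.ne'] at h1
  rw [hlog _ (by positivity), show (n : ℝ) + α + 1 + 1 - (n + α + 1) = 1 by ring,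
    show (n : ℝ) + α + 1 - (n + 1) = α by ring, div_one, div_le_iff₀ hα',
    ← Real.log_div hG2.ne' hG1.ne'] at h2
  have hq : 0 < Real.Gamma (n + α + 1) / Real.Gamma (n + 1) := div_pos hG2 hG1
  constructor
  · rw [Real.rpow_def_of_pos hn']
    exact (Real.le_log_iff_exp_le hq).1 h1
  · rw [Real.rpow_def_of_pos (by positivity)]
    exact (Real.log_le_iff_le_exp hq).1 h2

/-- The relative error between the weights is O(1/n), and either weight times k^{α+1}(n) is O(1/n),
so the terms are O(1/n²). -/
theorem summable_abs_one_div_rpow_sub_cesaroWeight {α : ℝ} (hα : 0 ≤ α) :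
    Summable fun n : ℕ => |1 / (n : ℝ) ^ (1 + α) - cesaroWeight α n / Real.Gamma (α + 1)| *
      cesaroNumber (α + 1) n := by
  have hG : 0 < Real.Gamma (α + 1) := Real.Gamma_pos_of_pos (by linarith)
  have hs : Summable fun n : ℕ =>
      α * (α + 1) * Real.exp (α * (α + 1)) / Real.Gamma (α + 1) * (1 / (n : ℝ) ^ 2) :=
    (Real.summable_one_div_nat_pow.2 one_lt_two).mul_left _
  refine Summable.of_nonneg_of_le
    (fun n => mul_nonneg (abs_nonneg _) (cesaroNumber_nonneg (by linarith) n)) (fun n => ?_) hs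
  rcases Nat.eq_zero_or_pos n with rfl | hn
  · simp [cesaroWeight_zero, Real.zero_rpow (by linarith : 1 + α ≠ 0)]
  have hn' : (0 : ℝ) < n := by exact_mod_cast hn
  have hn1 : (1 : ℝ) ≤ n := by exact_mod_cast hn
  have hk : 0 < cesaroNumber (α + 1) n := cesaroNumber_pos (by linarith) n
  obtain ⟨h1, h2⟩ := Gamma_add_div_Gamma_bounds hα hn
  have hpow : 0 < (n : ℝ) ^ α := Real.rpow_pos_of_pos hn' α
  have hkG : cesaroNumber (α + 1) n
      = Real.Gamma (n + α + 1) / Real.Gamma (n + 1) / Real.Gamma (α + 1) := by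
    rw [cesaroNumber_eq_Gamma (by linarith), Real.Gamma_nat_eq_factorial, ← add_assoc, div_div,
      mul_comm]
  set ρ := Real.Gamma (n + α + 1) / Real.Gamma (n + 1) / (n : ℝ) ^ α with hρ
  have hρ1 : 1 ≤ ρ := (one_le_div hpow).2 h1
  have hρ2 : ρ - 1 ≤ α * (α + 1) * Real.exp (α * (α + 1)) / n := by
    set y := (α + 1) / n with hy
    have hy0 : 0 ≤ y := by positivity
    have hy1 : y ≤ α + 1 := div_le_self (by linarith) hn1
    have e1 : ρ ≤ (1 + y) ^ α := by
      rw [hρ, div_le_iff₀ hpow, ← Real.mul_rpow (by positivity) hn'.le, hy]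
      have : (1 + (α + 1) / (n : ℝ)) * n = n + α + 1 := by
        field_simp
        ring
      rw [this]
      exact h2
    have e2 : (1 + y) ^ α ≤ Real.exp (α * y) := by
      rw [mul_comm, Real.exp_mul]
      exact Real.rpow_le_rpow (by positivity) (by linarith [Real.add_one_le_exp y]) hα
    have e3 : Real.exp (α * y) - 1 ≤ α * y * Real.exp (α * y) := by
      have h3 := Real.add_one_le_exp (-(α * y))
      have h4 : Real.exp (-(α * y)) * Real.exp (α * y) = 1 := by
        rw [← Real.exp_add, neg_add_cancel, Real.exp_zero]
      nlinarith [Real.exp_pos (α * y)]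
    have e4 : α * y * Real.exp (α * y) ≤ α * y * Real.exp (α * (α + 1)) :=
      mul_le_mul_of_nonneg_left (Real.exp_le_exp.2 (mul_le_mul_of_nonneg_left hy1 hα))
        (by positivity)
    calc ρ - 1 ≤ α * y * Real.exp (α * (α + 1)) := by linarith
      _ = _ := by
        rw [hy]
        ring
  have e5 : |1 / (n : ℝ) ^ (1 + α) - cesaroWeight α n / Real.Gamma (α + 1)| *
      cesaroNumber (α + 1) n = (ρ - 1) / (n * Real.Gamma (α + 1)) := by
    rw [← abs_of_pos hk, ← abs_mul, sub_mul, div_mul_eq_mul_div _ (Real.Gamma (α + 1)),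
      cesaroWeight_mul hα]
    have e6 : 1 / (n : ℝ) ^ (1 + α) * cesaroNumber (α + 1) n - 1 / n / Real.Gamma (α + 1)
        = (ρ - 1) / (n * Real.Gamma (α + 1)) := by
      rw [hkG, hρ, Real.rpow_add hn', Real.rpow_one]
      field_simp
    rw [e6, abs_of_nonneg (div_nonneg (by linarith) (by positivity))]
  rw [e5]
  calc (ρ - 1) / (n * Real.Gamma (α + 1))
      ≤ α * (α + 1) * Real.exp (α * (α + 1)) / n / (n * Real.Gamma (α + 1)) :=
        div_le_div_of_nonneg_right hρ2 (by positivity)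
    _ = _ := by
      field_simp

/-! ### The functions 1-z, -z and (1-z)log(1-z) in the algebra. -/

/-- The Weyl difference of the coefficients of `1 - z`. -/
noncomputable def oneSubWeyl (α : ℝ) (n : ℕ) : ℝ := if n = 0 then 1 + α else if n = 1 then -1 else 0

/-- The Weyl difference of the coefficients of `-z`. -/
noncomputable def negIdWeyl (α : ℝ) (n : ℕ) : ℝ := if n = 0 then α else if n = 1 then -1 else 0

/-- The Taylor coefficients of `(1 - z) log (1 - z)`. -/
noncomputable def mulLogCoeff : ℕ → ℝ
  | 0 => 0
  | n + 1 => 1 / (n : ℝ) - 1 / ((n + 1 : ℕ) : ℝ)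

/-- The Weyl difference of the Taylor coefficients of `(1 - z) log (1 - z)`. -/
noncomputable def mulLogWeyl (α : ℝ) : ℕ → ℝ
  | 0 => logConst α + ∑' n, logWeyl α n * cesaroNumber α (n + 1)
  | n + 1 => logWeyl α (n + 1) - logWeyl α n

theorem hasSum_mul_of_support_le_one {f g : ℕ → ℝ} (hg : ∀ n, 2 ≤ n → g n = 0) :
    HasSum (fun n => f n * g n) (f 0 * g 0 + f 1 * g 1) := by
  have h : HasSum (fun n => f n * g n) (∑ n ∈ Finset.range 2, f n * g n) :=
    hasSum_sum_of_ne_finset_zero fun n hn => by rw [hg n (by have := Finset.mem_range.not.1 hn; omega), mul_zero]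
  simpa [Finset.sum_range_succ] using h

theorem hasSum_cesaroNumber_mul_of_support_le_one (α : ℝ) {g : ℕ → ℝ}
    (hg : ∀ n, 2 ≤ n → g n = 0) (m : ℕ) :
    HasSum (fun j => cesaroNumber α j * g (m + j)) (g m + α * g (m + 1)) := by
  have h := hasSum_mul_of_support_le_one (f := cesaroNumber α) (g := fun j => g (m + j))
    fun n hn => hg _ (by omega)
  simpa [cesaroNumber_zero, cesaroNumber_one] using h

theorem hasSum_cesaroNumber_mul_oneSubWeyl (α : ℝ) (m : ℕ) :
    HasSum (fun j => cesaroNumber α j * oneSubWeyl α (m + j))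
      (if m = 0 then 1 else if m = 1 then -1 else 0) := by
  have h := hasSum_cesaroNumber_mul_of_support_le_one α (g := oneSubWeyl α)
    (fun n hn => by rw [oneSubWeyl, if_neg (by omega), if_neg (by omega)]) m
  convert! h using 1
  match m with
  | 0 => simp [oneSubWeyl]
  | 1 => simp [oneSubWeyl]
  | n + 2 => simp [oneSubWeyl]

theorem hasSum_cesaroNumber_mul_negIdWeyl (α : ℝ) (m : ℕ) :
    HasSum (fun j => cesaroNumber α j * negIdWeyl α (m + j)) (if m = 1 then -1 else 0) := by
  have h := hasSum_cesaroNumber_mul_of_support_le_one α (g := negIdWeyl α)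
    (fun n hn => by rw [negIdWeyl, if_neg (by omega), if_neg (by omega)]) m
  convert! h using 1
  match m with
  | 0 => simp [negIdWeyl]
  | 1 => simp [negIdWeyl]
  | n + 2 => simp [negIdWeyl]

theorem summable_norm_of_support_le_one (α : ℝ) {g : ℕ → ℝ} (hg : ∀ n, 2 ≤ n → g n = 0) :
    Summable fun n => ‖(g n : ℂ)‖ * cesaroNumber (α + 1) n :=
  summable_of_ne_finset_zero (s := Finset.range 2) fun n hn => by
    rw [hg n (by have := Finset.mem_range.not.1 hn; omega)]
    simp

theorem summable_norm_oneSubWeyl (α : ℝ) :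
    Summable fun n => ‖(oneSubWeyl α n : ℂ)‖ * cesaroNumber (α + 1) n :=
  summable_norm_of_support_le_one α fun n hn => by
    rw [oneSubWeyl, if_neg (by omega), if_neg (by omega)]

theorem summable_norm_negIdWeyl (α : ℝ) :
    Summable fun n => ‖(negIdWeyl α n : ℂ)‖ * cesaroNumber (α + 1) n :=
  summable_norm_of_support_le_one α fun n hn => by
    rw [negIdWeyl, if_neg (by omega), if_neg (by omega)]

section MulLog

variable {α : ℝ}

theorem summable_logWeyl_mul_cesaroNumber_succ (hα : 0 ≤ α) :
    Summable fun n => logWeyl α n * cesaroNumber α (n + 1) := by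
  have h1 : Summable fun n => cesaroWeight α n * cesaroNumber α (n + 1) := by
    refine Summable.of_nonneg_of_le
      (fun n => mul_nonneg (cesaroWeight_nonneg hα n) (cesaroNumber_nonneg hα _)) (fun n => ?_)
      ((Real.summable_one_div_nat_pow.2 one_lt_two).mul_left (α * (1 + α)))
    rcases Nat.eq_zero_or_pos n with rfl | hn
    · simp [cesaroWeight_zero]
    have hn' : (0 : ℝ) < n := by exact_mod_cast hn
    have hb := cesaroWeight_nonneg hα n
    have h2 : cesaroNumber α (n + 1) ≤ α / n * ((1 + α) * cesaroNumber (α + 1) n) := by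
      refine le_trans ?_ (mul_le_mul_of_nonneg_left (cesaroNumber_succ_le hα n) (by positivity))
      have h3 := add_mul_cesaroNumber α (n + 1)
      have h4 := cesaroNumber_nonneg hα (n + 1)
      rw [div_mul_eq_mul_div, le_div_iff₀ hn', ← h3]
      push_cast
      nlinarith
    calc _ ≤ cesaroWeight α n * (α / n * ((1 + α) * cesaroNumber (α + 1) n)) :=
          mul_le_mul_of_nonneg_left h2 hb
      _ = α * (1 + α) / n * (cesaroWeight α n * cesaroNumber (α + 1) n) := by ring
      _ = _ := by
        rw [cesaroWeight_mul hα]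
        field_simp
  have h2 : Summable fun n => (if n = 0 then logConst α else 0) * cesaroNumber α (n + 1) :=
    summable_of_ne_finset_zero (s := {0}) fun n hn => by
      rw [if_neg (by simpa using hn), zero_mul]
  refine (h2.sub h1).congr fun n => ?_
  rw [logWeyl_eq, sub_mul]

/-- At positive indices, multiplication by 1-z takes backward differences both of the coefficients
and of the Weyl difference; the entry at 0 is fixed by the vanishing constant coefficient. -/
theorem hasSum_cesaroNumber_mul_mulLogWeyl (hα : 0 ≤ α) (m : ℕ) :
    HasSum (fun j => cesaroNumber α j * mulLogWeyl α (m + j)) (mulLogCoeff m) := by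
  cases m with
  | zero =>
    have h1 := (summable_logWeyl_mul_cesaroNumber_succ hα).hasSum
    have h0 := hasSum_cesaroNumber_mul_logWeyl hα 0
    rw [← hasSum_nat_add_iff' 1] at h0
    have h2 := h0.sub h1
    rw [← hasSum_nat_add_iff' 1]
    simp only [Finset.range_one, Finset.sum_singleton, cesaroNumber_zero, one_mul, zero_add,
      Nat.cast_zero, div_zero, neg_zero] at h2 ⊢
    have e : (fun n => cesaroNumber α (n + 1) * logWeyl α (n + 1)
        - logWeyl α n * cesaroNumber α (n + 1))
        = fun n => cesaroNumber α (n + 1) * mulLogWeyl α (n + 1) := by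
      ext n
      rw [mulLogWeyl]
      ring
    rw [e] at h2
    convert! h2 using 1
    simp [mulLogWeyl, mulLogCoeff, logWeyl]
    ring
  | succ m =>
    have h := (hasSum_cesaroNumber_mul_logWeyl hα (m + 1)).sub
      (hasSum_cesaroNumber_mul_logWeyl hα m)
    have e : (fun j => cesaroNumber α j * logWeyl α (m + 1 + j)
        - cesaroNumber α j * logWeyl α (m + j))
        = fun j => cesaroNumber α j * mulLogWeyl α (m + 1 + j) := by
      ext j
      rw [show m + 1 + j = m + j + 1 by ring, mulLogWeyl]
      ring
    rw [e] at h
    convert! h using 1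
    rw [mulLogCoeff]
    ring

/-- Differencing gains a factor 1/n: at n+2 the weighted entry equals (1+α)/((n+1)(n+2)). -/
theorem summable_norm_mulLogWeyl (hα : 0 ≤ α) :
    Summable fun n => ‖(mulLogWeyl α n : ℂ)‖ * cesaroNumber (α + 1) n := by
  rw [← summable_nat_add_iff 2]
  have hs : Summable fun n : ℕ => (1 + α) * (1 / ((n + 1 : ℕ) : ℝ) ^ 2) :=
    ((summable_nat_add_iff 1).2 (Real.summable_one_div_nat_pow.2 one_lt_two)).mul_left _
  refine Summable.of_nonneg_of_le
    (fun n => mul_nonneg (norm_nonneg _) (cesaroNumber_nonneg (by linarith) _)) (fun n => ?_) hs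
  have hk : 0 < cesaroNumber (α + 1) (n + 2) := cesaroNumber_pos (by linarith) _
  have h1 := cesaroWeight_mul hα (n + 1)
  have h2 := cesaroWeight_mul hα (n + 1 + 1)
  have h3 : cesaroWeight α (n + 1) * cesaroNumber (α + 1) (n + 2)
      = 1 / ((n + 1 : ℕ) : ℝ) * ((α + 1 + (n + 1 : ℕ)) / ((n + 1 : ℕ) + 1)) := by
    rw [cesaroNumber_succ, ← mul_assoc, h1]
  have e : mulLogWeyl α (n + 2) * cesaroNumber (α + 1) (n + 2)
      = (1 + α) / (((n + 1 : ℕ) : ℝ) * ((n + 1 : ℕ) + 1)) := by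
    rw [mulLogWeyl, logWeyl, logWeyl, if_neg (by omega), if_neg (by omega), sub_mul, neg_mul,
      neg_mul, h2, h3]
    have h4 : ((n + 1 : ℕ) : ℝ) ≠ 0 := by positivity
    have h5 : ((n + 1 : ℕ) : ℝ) + 1 ≠ 0 := by positivity
    push_cast at h4 h5 ⊢
    field_simp
    ring
  rw [Complex.norm_real, Real.norm_eq_abs, ← abs_of_pos hk, ← abs_mul, e,
    abs_of_nonneg (by positivity), mul_one_div]
  refine div_le_div_of_nonneg_left (by linarith) (by positivity) ?_
  rw [sq]
  exact mul_le_mul_of_nonneg_left (by linarith) (by positivity)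

end MulLog

/-! ### Power series identities and uniqueness of coefficients. -/

theorem sum_antidiagonal_mul_oneSub (a : ℕ → ℝ) (m : ℕ) :
    ∑ p ∈ Finset.HasAntidiagonal.antidiagonal m,
      a p.1 * (if p.2 = 0 then 1 else if p.2 = 1 then -1 else 0)
      = (PowerSeries.mk a * (1 - PowerSeries.X)).coeff m := by
  rw [PowerSeries.coeff_mul]
  refine Finset.sum_congr rfl fun p _ => ?_
  rw [PowerSeries.coeff_mk, map_sub, PowerSeries.coeff_one, PowerSeries.coeff_X]
  split_ifs <;> first | omega | simp

theorem mk_mulLogCoeff : PowerSeries.mk mulLogCoeff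
    = PowerSeries.mk (fun n : ℕ => -(1 / (n : ℝ))) * (1 - PowerSeries.X) := by
  ext m
  rw [mul_sub, mul_one, map_sub]
  cases m with
  | zero => simp [mulLogCoeff]
  | succ m =>
    rw [PowerSeries.coeff_succ_mul_X]
    simp only [PowerSeries.coeff_mk, mulLogCoeff]
    ring

/-- The identity u(z)·(1-z)log(1-z) = -z(1-z), from u(z)log(1-z) = -z. -/
theorem sum_antidiagonal_logKernel_mul_mulLogCoeff (m : ℕ) :
    ∑ p ∈ Finset.HasAntidiagonal.antidiagonal m, logKernel p.1 * mulLogCoeff p.2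
      = ∑ p ∈ Finset.HasAntidiagonal.antidiagonal m, (if p.1 = 1 then -1 else 0) *
        (if p.2 = 0 then 1 else if p.2 = 1 then -1 else 0) := by
  rw [sum_antidiagonal_mul_oneSub fun n => if n = 1 then -1 else 0]
  have h1 : PowerSeries.mk logKernel * PowerSeries.mk (fun n : ℕ => -(1 / (n : ℝ)))
      = PowerSeries.mk fun n => if n = 1 then -1 else 0 := by
    ext m
    rw [mul_comm, PowerSeries.coeff_mul, PowerSeries.coeff_mk]
    have h := sum_antidiagonal_mul_logKernel m
    simp only [PowerSeries.coeff_mk, neg_mul, Finset.sum_neg_distrib, h]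
    split_ifs <;> simp
  rw [← h1, mul_assoc, ← mk_mulLogCoeff, PowerSeries.coeff_mul]
  simp only [PowerSeries.coeff_mk]

theorem hasSum_sum_antidiagonal_mul_pow {f g : ℕ → ℂ} {z F G : ℂ}
    (hf : HasSum (fun n => f n * z ^ n) F) (hg : HasSum (fun n => g n * z ^ n) G) :
    HasSum (fun m => (∑ p ∈ Finset.HasAntidiagonal.antidiagonal m, f p.1 * g p.2) * z ^ m)
      (F * G) := by
  have h := (summable_norm_sum_mul_antidiagonal_of_summable_norm hf.summable.norm
    hg.summable.norm).of_norm.hasSum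
  rw [← tsum_mul_tsum_eq_tsum_sum_antidiagonal_of_summable_norm hf.summable.norm hg.summable.norm,
    hf.tsum_eq, hg.tsum_eq] at h
  have e : (fun n => ∑ p ∈ Finset.HasAntidiagonal.antidiagonal n, f p.1 * z ^ p.1 * (g p.2 * z ^ p.2))
      = fun m => (∑ p ∈ Finset.HasAntidiagonal.antidiagonal m, f p.1 * g p.2) * z ^ m := by
    ext m
    rw [Finset.sum_mul]
    refine Finset.sum_congr rfl fun p hp => ?_
    rw [← Finset.HasAntidiagonal.mem_antidiagonal.1 hp, pow_add]
    ring
  rw [e] at h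
  exact h

theorem eq_of_hasSum_mul_pow {a b : ℕ → ℂ} {F : ℂ → ℂ}
    (ha : ∀ z : ℂ, ‖z‖ < 1 → HasSum (fun n => a n * z ^ n) (F z))
    (hb : ∀ z : ℂ, ‖z‖ < 1 → HasSum (fun n => b n * z ^ n) (F z)) : a = b := by
  have key : ∀ {c : ℕ → ℂ}, (∀ z : ℂ, ‖z‖ < 1 → HasSum (fun n => c n * z ^ n) (F z)) →
      HasFPowerSeriesAt F (FormalMultilinearSeries.ofScalars ℂ c) 0 := by
    intro c hc
    refine ⟨((1 / 2 : NNReal) : ENNReal), ?_, by simp, ?_⟩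
    · refine FormalMultilinearSeries.le_radius_of_summable_norm _ ?_
      have h := (hc (1 / 2) (by norm_num)).summable.norm
      simpa [FormalMultilinearSeries.ofScalars_norm] using h
    · intro y hy
      have hy' : ‖y‖ < 1 := by
        have h1 : ‖y‖₊ < 1 / 2 := by simpa [enorm_eq_nnnorm, ← ENNReal.coe_lt_coe] using hy
        have h2 : ‖y‖ < 1 / 2 := by exact_mod_cast h1
        linarith
      simpa [FormalMultilinearSeries.ofScalars_apply_eq, mul_comm] using hc y hy'
  have h := (key ha).eq_formalMultilinearSeries (key hb)
  ext n
  have h2 := congrArg (fun p : FormalMultilinearSeries ℂ ℂ ℂ => p.coeff n) h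
  simpa [FormalMultilinearSeries.coeff_ofScalars] using h2

theorem hasSum_mulLogCoeff {z : ℂ} (hz : ‖z‖ < 1) :
    HasSum (fun n => (mulLogCoeff n : ℂ) * z ^ n) ((1 - z) * Complex.log (1 - z)) := by
  have h1 := (Complex.hasSum_taylorSeries_neg_log hz).neg
  rw [neg_neg] at h1
  have h2 : HasSum (fun n : ℕ => (-(1 / (n : ℝ)) : ℝ) * z ^ n) (Complex.log (1 - z)) := by
    convert! h1 using 2 with n
    push_cast
    ring
  have h3 := h2.mul_left z
  rw [sub_mul, one_mul]
  have h4 : HasSum (fun n : ℕ => if n = 0 then 0 else z * ((-(1 / ((n - 1 : ℕ) : ℝ)) : ℝ) * z ^ (n - 1)))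
      (z * Complex.log (1 - z)) := by
    rw [← hasSum_nat_add_iff' 1]
    simpa using h3
  have h5 := h2.sub h4
  convert! h5 using 2 with n
  cases n with
  | zero => simp [mulLogCoeff]
  | succ n =>
    simp only [mulLogCoeff, Nat.add_one_sub_one, Nat.succ_ne_zero, if_false, pow_succ]
    push_cast
    ring

/-! ### Evaluation of the calculus and of S_N in a Banach algebra. -/

section Algebra

variable {A : Type*} [Ring A] [Algebra ℂ A]

theorem cesaroElem_mul_self (α : ℝ) (a : A) (n : ℕ) :
    a * cesaroElem α a n = cesaroElem α a (n + 1) - (cesaroNumber α (n + 1) : ℂ) • (1 : A) := by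
  rw [cesaroElem_succ, add_sub_cancel_right]

theorem one_sub_mul_sum_cesaroElem (α : ℝ) (a : A) (n : ℕ) :
    (1 - a) * ∑ j ∈ Finset.range (n + 1), cesaroElem α a j
      = (cesaroNumber (α + 1) (n + 1) : ℂ) • (1 : A) - cesaroElem α a (n + 1) := by
  rw [Finset.mul_sum]
  induction n with
  | zero =>
    rw [zero_add, Finset.sum_range_one, sub_mul, cesaroElem_mul_self, cesaroElem_zero,
      cesaroNumber_one, cesaroNumber_one]
    push_cast
    rw [add_smul, one_smul, one_mul]
    abel
  | succ n ih =>
    rw [Finset.sum_range_succ, ih, sub_mul, cesaroElem_mul_self, cesaroNumber_pascal α (n + 1)]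
    push_cast
    rw [add_smul, one_mul]
    abel

/-- Summation by parts for `(1 - a) ∑_{n ≤ N} G(n) e_n`. -/
theorem one_sub_mul_sum_smul_cesaroElem (α : ℝ) (a : A) (G : ℕ → ℂ) (N : ℕ) :
    (1 - a) * ∑ n ∈ Finset.range (N + 1), G n • cesaroElem α a n
      = G 0 • (1 : A) + ∑ n ∈ Finset.range N, (G (n + 1) - G n) • cesaroElem α a (n + 1)
        - G N • cesaroElem α a (N + 1)
        + (∑ n ∈ Finset.range (N + 1), G n * (cesaroNumber α (n + 1) : ℂ)) • (1 : A) := by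
  rw [Finset.mul_sum]
  induction N with
  | zero =>
    rw [zero_add, Finset.sum_range_one, Finset.sum_range_one, Finset.sum_range_zero,
      mul_smul_comm, sub_mul, cesaroElem_mul_self, cesaroElem_zero, one_mul, mul_smul]
    simp only [smul_sub]
    abel
  | succ N ih =>
    rw [Finset.sum_range_succ, ih, mul_smul_comm, sub_mul, cesaroElem_mul_self,
      Finset.sum_range_succ (fun n => (G (n + 1) - G n) • cesaroElem α a (n + 1)),
      Finset.sum_range_succ (fun n => G n * (cesaroNumber α (n + 1) : ℂ)) (N + 1), one_mul]
    simp only [smul_sub, sub_smul, add_smul, mul_smul]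
    abel

/-- The value `∑_n g(n) e_n` of the Cesàro calculus at the element with Weyl difference `g`. -/
noncomputable def cesaroOp [TopologicalSpace A] (α : ℝ) (a : A) (g : ℕ → ℂ) : A :=
  ∑' n, g n • cesaroElem α a n

theorem cesaroOp_of_support_le_one [TopologicalSpace A] (α : ℝ) (a : A) {g : ℕ → ℂ}
    (hg : ∀ n, 2 ≤ n → g n = 0) :
    cesaroOp α a g = (g 0 + α * g 1) • (1 : A) + g 1 • a := by
  rw [cesaroOp, tsum_eq_sum (s := Finset.range 2) fun n hn => by
    rw [hg n (by have := Finset.mem_range.not.1 hn; omega), zero_smul]]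
  rw [Finset.sum_range_succ, Finset.sum_range_one, cesaroElem_succ, cesaroElem_zero, zero_add,
    cesaroNumber_one, mul_one, smul_add, smul_smul, add_smul, mul_comm (g 1)]
  abel

theorem cesaroOp_oneSubWeyl [TopologicalSpace A] (α : ℝ) (a : A) :
    cesaroOp α a (fun n => (oneSubWeyl α n : ℂ)) = 1 - a := by
  rw [cesaroOp_of_support_le_one α a fun n hn => by
    rw [oneSubWeyl, if_neg (by omega), if_neg (by omega), Complex.ofReal_zero]]
  simp [oneSubWeyl, sub_eq_add_neg]

theorem cesaroOp_negIdWeyl [TopologicalSpace A] (α : ℝ) (a : A) :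
    cesaroOp α a (fun n => (negIdWeyl α n : ℂ)) = -a := by
  rw [cesaroOp_of_support_le_one α a fun n hn => by
    rw [negIdWeyl, if_neg (by omega), if_neg (by omega), Complex.ofReal_zero]]
  simp [negIdWeyl]

/-- The partial sum `∑_{1 ≤ n ≤ N} b_n e_n` of the logarithmic series. -/
noncomputable def logPartialSum (α : ℝ) (a : A) (N : ℕ) : A :=
  ∑ n ∈ Finset.Icc 1 N, (cesaroWeight α n : ℂ) • cesaroElem α a n

theorem cesaroOp_truncWeight [TopologicalSpace A] (α : ℝ) (a : A) (N : ℕ) :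
    cesaroOp α a (fun n => (truncWeight α N n : ℂ)) = logPartialSum α a N := by
  rw [cesaroOp, logPartialSum, tsum_eq_sum (s := Finset.Icc 1 N) fun n hn => by
    rw [Finset.mem_Icc] at hn
    rcases Nat.eq_zero_or_pos n with rfl | h
    · simp [truncWeight, cesaroWeight_zero]
    · rw [truncWeight, if_neg (by omega), Complex.ofReal_zero, zero_smul]]
  refine Finset.sum_congr rfl fun n hn => ?_
  rw [truncWeight, if_pos (Finset.mem_Icc.1 hn).2]

theorem sum_range_logWeyl_smul (α : ℝ) (a : A) (N : ℕ) :
    ∑ n ∈ Finset.range (N + 1), (logWeyl α n : ℂ) • cesaroElem α a n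
      = (logConst α : ℂ) • (1 : A) - logPartialSum α a N := by
  rw [Finset.range_eq_Ico, Finset.sum_eq_sum_Ico_succ_bot (by omega), cesaroElem_zero,
    sub_eq_add_neg, logPartialSum, ← Finset.sum_neg_distrib]
  congr 1
  refine Finset.sum_congr (by ext; simp) fun n hn => ?_
  have := Finset.mem_Icc.1 hn
  rw [logWeyl, if_neg (by omega), Complex.ofReal_neg, neg_smul]

end Algebra

section NormedAlgebra

variable {A : Type*} [NormedRing A] [NormedAlgebra ℂ A] [CompleteSpace A] {α C : ℝ} {a : A}

theorem hasSum_cesaroOp (hC : ∀ n, ‖cesaroElem α a n‖ ≤ C * cesaroNumber (α + 1) n) {g : ℕ → ℂ}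
    (hg : Summable fun n => ‖g n‖ * cesaroNumber (α + 1) n) :
    HasSum (fun n => g n • cesaroElem α a n) (cesaroOp α a g) :=
  (summable_norm_smul_cesaroElem hC hg).of_norm.hasSum

theorem commute_cesaroOp (hα : 0 ≤ α)
    (hC : ∀ n, ‖cesaroElem α a n‖ ≤ C * cesaroNumber (α + 1) n) {g₁ g₂ : ℕ → ℂ}
    (h₁ : Summable fun n => ‖g₁ n‖ * cesaroNumber (α + 1) n)
    (h₂ : Summable fun n => ‖g₂ n‖ * cesaroNumber (α + 1) n) :
    cesaroOp α a g₁ * cesaroOp α a g₂ = cesaroOp α a g₂ * cesaroOp α a g₁ :=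
  tsum_smul_cesaroElem_mul_congr hα hC h₁ h₂ h₂ h₁ fun m => by
    rw [← Finset.Nat.sum_antidiagonal_swap]
    exact Finset.sum_congr rfl fun p _ => mul_comm _ _

theorem cesaroOp_logKernelWeyl_mul (hα : 0 ≤ α)
    (hC : ∀ n, ‖cesaroElem α a n‖ ≤ C * cesaroNumber (α + 1) n) :
    cesaroOp α a (fun n => (logKernelWeyl α n : ℂ)) * cesaroOp α a (fun n => (mulLogWeyl α n : ℂ))
      = -a * (1 - a) := by
  rw [← cesaroOp_negIdWeyl α, ← cesaroOp_oneSubWeyl α]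
  refine tsum_smul_cesaroElem_mul_congr hα hC (summable_norm_logKernelWeyl hα)
    (summable_norm_mulLogWeyl hα) (summable_norm_negIdWeyl α) (summable_norm_oneSubWeyl α)
    fun m => ?_
  simp only [weylSum_ofReal (hasSum_cesaroNumber_mul_logKernelWeyl hα _),
    weylSum_ofReal (hasSum_cesaroNumber_mul_mulLogWeyl hα _),
    weylSum_ofReal (hasSum_cesaroNumber_mul_negIdWeyl α _),
    weylSum_ofReal (hasSum_cesaroNumber_mul_oneSubWeyl α _)]
  exact_mod_cast sum_antidiagonal_logKernel_mul_mulLogCoeff m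

theorem exists_norm_logPartialSum_mul_le (hα : 0 ≤ α) (hC0 : 0 ≤ C)
    (hC : ∀ n, ‖cesaroElem α a n‖ ≤ C * cesaroNumber (α + 1) n) :
    ∃ K, ∀ N, ‖logPartialSum α a N * cesaroOp α a (fun n => (logKernelWeyl α n : ℂ))‖ ≤ K := by
  obtain ⟨K, hK⟩ := exists_tsum_abs_truncLogConv_le hα
  refine ⟨C * K, fun N => ?_⟩
  rw [← cesaroOp_truncWeight, cesaroOp, cesaroOp, tsum_smul_cesaroElem_mul hα hC
    (summable_norm_truncWeight α N) (summable_norm_logKernelWeyl hα)]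
  refine (tsum_of_norm_bounded ((summable_abs_truncLogConv hα N).mul_left C).hasSum
    fun k => ?_).trans ?_
  · rw [cesaroConv_truncWeight, norm_smul, Complex.norm_real, Real.norm_eq_abs]
    calc _ ≤ |truncLogConv α N k| * (C * cesaroNumber (α + 1) k) :=
        mul_le_mul_of_nonneg_left (hC k) (abs_nonneg _)
      _ = _ := by ring
  · rw [tsum_mul_left]
    exact mul_le_mul_of_nonneg_left (hK N) hC0

/-- Summation by parts turns (1-a)(c - S_N) into a partial sum of the absolutely convergent series
for (1-z)log(1-z), a boundary term of size O(1/N), and a scalar remainder tending to 0. -/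
theorem tendsto_one_sub_mul_logPartialSum (hα : 0 ≤ α)
    (hC : ∀ n, ‖cesaroElem α a n‖ ≤ C * cesaroNumber (α + 1) n) :
    Tendsto (fun N => (1 - a) * ((logConst α : ℂ) • (1 : A) - logPartialSum α a N)) atTop
      (𝓝 (cesaroOp α a fun n => (mulLogWeyl α n : ℂ))) := by
  have h1 := (hasSum_cesaroOp hC (summable_norm_mulLogWeyl hα)).tendsto_sum_nat.comp
    (tendsto_add_atTop_nat 1)
  have hs := summable_logWeyl_mul_cesaroNumber_succ hα
  have h2 : Tendsto (fun N => ((∑ n ∈ Finset.range (N + 1), logWeyl α n * cesaroNumber α (n + 1)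
      - ∑' n, logWeyl α n * cesaroNumber α (n + 1) : ℝ) : ℂ) • (1 : A)) atTop (𝓝 0) := by
    have h := (hs.hasSum.tendsto_sum_nat.comp (tendsto_add_atTop_nat 1)).sub_const
      (∑' n, logWeyl α n * cesaroNumber α (n + 1))
    rw [sub_self] at h
    simpa using ((Complex.continuous_ofReal.tendsto 0).comp h).smul_const (1 : A)
  have h3 : Tendsto (fun N => (logWeyl α N : ℂ) • cesaroElem α a (N + 1)) atTop (𝓝 0) := by
    have h := (tendsto_one_div_atTop_nhds_zero_nat (𝕜 := ℝ)).const_mul (|C| * (1 + α))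
    rw [mul_zero] at h
    refine squeeze_zero_norm' ?_ h
    filter_upwards [eventually_ge_atTop 1] with N hN
    have hb := cesaroWeight_nonneg hα N
    rw [logWeyl, if_neg (by omega), norm_smul, Complex.norm_real, norm_neg, Real.norm_eq_abs,
      abs_of_nonneg hb, ← cesaroWeight_mul hα]
    have h4 : ‖cesaroElem α a (N + 1)‖ ≤ |C| * ((1 + α) * cesaroNumber (α + 1) N) :=
      ((hC _).trans (mul_le_mul_of_nonneg_right (le_abs_self C)
        (cesaroNumber_nonneg (by linarith) _))).trans
        (mul_le_mul_of_nonneg_left (cesaroNumber_succ_le hα N) (abs_nonneg C))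
    calc _ ≤ cesaroWeight α N * (|C| * ((1 + α) * cesaroNumber (α + 1) N)) :=
        mul_le_mul_of_nonneg_left h4 hb
      _ = _ := by ring
  have h := (h1.sub h3).add h2
  rw [sub_zero, add_zero] at h
  refine h.congr fun N => ?_
  rw [← sum_range_logWeyl_smul, one_sub_mul_sum_smul_cesaroElem α a (fun n => (logWeyl α n : ℂ)),
    Function.comp_apply, Finset.sum_range_succ', cesaroElem_zero]
  simp only [mulLogWeyl, show logWeyl α 0 = logConst α from if_pos rfl]
  push_cast
  simp only [add_smul, sub_smul]
  abel

end NormedAlgebra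

/-! ### Ergodic and density arguments for operators. -/

section Operators

variable {X : Type*} [NormedAddCommGroup X] [NormedSpace ℂ X]

theorem IsCesaroBounded.exists_norm_cesaroElem_le {α : ℝ} (hα : 0 ≤ α) {T : X →L[ℂ] X}
    (hT : IsCesaroBounded α T) :
    ∃ C, 0 ≤ C ∧ ∀ n, ‖cesaroElem α T n‖ ≤ C * cesaroNumber (α + 1) n := by
  obtain ⟨C, hC⟩ := hT
  refine ⟨max C 0, le_max_right _ _, fun n => ?_⟩
  have hk : 0 < cesaroNumber (α + 1) n := cesaroNumber_pos (by linarith) n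
  have h : ‖cesaroMean α T n‖ ≤ C := hC ⟨n, rfl⟩
  rw [cesaroMean, norm_smul, norm_inv, Complex.norm_real, Real.norm_eq_abs, abs_of_pos hk,
    inv_mul_le_iff₀ hk, mul_comm] at h
  exact h.trans (mul_le_mul_of_nonneg_right (le_max_left _ _) hk.le)

theorem cesaroElem_apply_of_map_eq {α : ℝ} {T : X →L[ℂ] X} {x : X} (hx : T x = x) (n : ℕ) :
    cesaroElem α T n x = (cesaroNumber (α + 1) n : ℂ) • x := by
  induction n with
  | zero => simp [cesaroElem_zero, cesaroNumber_zero]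
  | succ n ih =>
    rw [cesaroElem_succ, cesaroNumber_pascal, add_apply,
      show (T * cesaroElem α T n) x = T (cesaroElem α T n x) from rfl, ih, map_smul, hx]
    push_cast
    rw [add_smul]
    rfl

/-- The means of order α+1 have norm at most C, fix every x with Tx = x, and tend to 0 on v - Tv at
rate 1/n. Hence ‖x‖ ≤ C‖x - (v - Tv)‖ for all v, and density lets v - Tv approach x. -/
theorem injective_one_sub {α C : ℝ} (hα : 0 ≤ α) {T : X →L[ℂ] X}
    (hC : ∀ n, ‖cesaroElem α T n‖ ≤ C * cesaroNumber (α + 1) n)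
    (hran : DenseRange fun v : X => v - T v) :
    Function.Injective (1 - T : X →L[ℂ] X) := by
  refine (injective_iff_map_eq_zero _).2 fun x hx => ?_
  have hx' : T x = x := (sub_eq_zero.1 hx).symm
  have key : ∀ v : X, ‖x‖ ≤ C * ‖x - (v - T v)‖ := by
    intro v
    have hlim : Tendsto (fun n : ℕ => C * ‖x - (v - T v)‖
        + (C + 1) * (α + 1) * ‖v‖ * (1 / ((n : ℝ) + 1))) atTop
        (𝓝 (C * ‖x - (v - T v)‖ + (C + 1) * (α + 1) * ‖v‖ * 0)) :=
      (tendsto_one_div_add_atTop_nhds_zero_nat.const_mul _).const_add _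
    rw [mul_zero, add_zero] at hlim
    refine ge_of_tendsto' hlim fun n => ?_
    have hK : 0 < cesaroNumber (α + 2) n := cesaroNumber_pos (by linarith) n
    have hk : 0 < cesaroNumber (α + 1) (n + 1) := cesaroNumber_pos (by linarith) _
    have hsum : ∑ j ∈ Finset.range (n + 1), cesaroNumber (α + 1) j = cesaroNumber (α + 2) n := by
      rw [sum_range_cesaroNumber, show α + 1 + 1 = α + 2 by ring]
    have hT1 : (∑ j ∈ Finset.range (n + 1), cesaroElem α T j) (v - T v)
        = (cesaroNumber (α + 1) (n + 1) : ℂ) • v - cesaroElem α T (n + 1) v := by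
      have hcomm : Commute (1 - T) (∑ j ∈ Finset.range (n + 1), cesaroElem α T j) :=
        Commute.sum_right _ _ _ fun j _ =>
          (Commute.one_left _).sub_left (commute_cesaroElem α T j)
      have h := congrArg (fun S : X →L[ℂ] X => S v)
        (hcomm.eq.symm.trans (one_sub_mul_sum_cesaroElem α T n))
      exact h
    have hx1 : (∑ j ∈ Finset.range (n + 1), cesaroElem α T j) x
        = (cesaroNumber (α + 2) n : ℂ) • x := by
      rw [← hsum, sum_apply]
      push_cast
      rw [Finset.sum_smul]
      exact Finset.sum_congr rfl fun j _ => cesaroElem_apply_of_map_eq hx' j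
    have hS : ‖∑ j ∈ Finset.range (n + 1), cesaroElem α T j‖ ≤ C * cesaroNumber (α + 2) n := by
      rw [← hsum, Finset.mul_sum]
      exact norm_sum_le_of_le _ fun j _ => hC j
    have h1 : (cesaroNumber (α + 2) n : ℂ) • x
        = (∑ j ∈ Finset.range (n + 1), cesaroElem α T j) (x - (v - T v))
          + ((cesaroNumber (α + 1) (n + 1) : ℂ) • v - cesaroElem α T (n + 1) v) := by
      rw [map_sub, hT1, hx1]
      abel
    have h2 : cesaroNumber (α + 2) n * ‖x‖ ≤ C * cesaroNumber (α + 2) n * ‖x - (v - T v)‖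
        + (cesaroNumber (α + 1) (n + 1) * ‖v‖ + C * cesaroNumber (α + 1) (n + 1) * ‖v‖) := by
      have h3 := congrArg norm h1
      rw [norm_smul, Complex.norm_real, Real.norm_eq_abs, abs_of_pos hK] at h3
      rw [h3]
      refine (norm_add_le _ _).trans (add_le_add
        (ContinuousLinearMap.le_of_opNorm_le _ hS _) ((norm_sub_le _ _).trans (add_le_add ?_
          (ContinuousLinearMap.le_of_opNorm_le _ (hC _) _))))
      rw [norm_smul, Complex.norm_real, Real.norm_eq_abs, abs_of_pos hk]
    have h4 : cesaroNumber (α + 1) (n + 1)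
        = (α + 1) * (1 / ((n : ℝ) + 1)) * cesaroNumber (α + 2) n := by
      have h5 := cesaroNumber_add_two α n
      have h6 : (n : ℝ) + 1 ≠ 0 := by positivity
      field_simp
      linarith
    rw [h4] at h2
    refine le_of_mul_le_mul_left (h2.trans_eq ?_) hK
    ring
  have h := hran.induction_on (p := fun y => ‖x‖ ≤ C * ‖x - y‖) x
    (isClosed_le continuous_const (by fun_prop)) key
  simpa using h

theorem exists_tendsto_of_denseRange [CompleteSpace X] {Ψ : ℕ → X →L[ℂ] X} {K : ℝ}
    (hK : ∀ N, ‖Ψ N‖ ≤ K) {A : X → X} (hA : DenseRange A)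
    (h : ∀ v, ∃ w, Tendsto (fun N => Ψ N (A v)) atTop (𝓝 w)) (y : X) :
    ∃ w, Tendsto (fun N => Ψ N y) atTop (𝓝 w) := by
  refine cauchySeq_tendsto_of_complete (Metric.cauchySeq_iff.2 fun ε hε => ?_)
  have hK0 : 0 ≤ K := (norm_nonneg _).trans (hK 0)
  obtain ⟨v, hv⟩ := hA.exists_dist_lt y (ε := ε / (3 * (K + 1))) (by positivity)
  obtain ⟨w, hw⟩ := h v
  obtain ⟨N, hN⟩ := Metric.cauchySeq_iff.1 hw.cauchySeq (ε / 3) (by positivity)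
  have hd : ∀ n, dist (Ψ n y) (Ψ n (A v)) < ε / 3 := by
    intro n
    rw [dist_eq_norm, ← map_sub]
    rw [dist_eq_norm, lt_div_iff₀ (by positivity)] at hv
    have := (Ψ n).le_of_opNorm_le (hK n) (y - A v)
    have := norm_nonneg (y - A v)
    nlinarith
  refine ⟨N, fun m hm n hn => ?_⟩
  have h1 := dist_triangle4 (Ψ m y) (Ψ m (A v)) (Ψ n (A v)) (Ψ n y)
  have h2 := hN m hm n hn
  have h3 := hd m
  have h4 := hd n
  rw [dist_comm] at h4
  linarith

end Operators

theorem hasSum_oneSub (z : ℂ) :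
    HasSum (fun n : ℕ => ((if n = 0 then 1 else if n = 1 then -1 else 0 : ℝ) : ℂ) * z ^ n)
      (1 - z) := by
  have h : HasSum (fun n : ℕ => ((if n = 0 then 1 else if n = 1 then -1 else 0 : ℝ) : ℂ) * z ^ n)
      (∑ n ∈ Finset.range 2, ((if n = 0 then 1 else if n = 1 then -1 else 0 : ℝ) : ℂ) * z ^ n) :=
    hasSum_sum_of_ne_finset_zero fun n hn => by
      have := Finset.mem_range.not.1 hn
      rw [if_neg (by omega), if_neg (by omega), Complex.ofReal_zero, zero_mul]
  simpa [Finset.sum_range_succ, sub_eq_add_neg] using h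

/-! ### The logarithm of I-T and its series. -/

section Logarithm

variable {X : Type*} [NormedAddCommGroup X] [NormedSpace ℂ X] [CompleteSpace X] {α C : ℝ}
  {T : X →L[ℂ] X}

theorem hasCesaroCalculus_of_hasSum {f g : ℕ → ℝ} {F : ℂ → ℂ}
    (hC : ∀ n, ‖cesaroElem α T n‖ ≤ C * cesaroNumber (α + 1) n)
    (hg : Summable fun n => ‖(g n : ℂ)‖ * cesaroNumber (α + 1) n)
    (hfg : ∀ m, HasSum (fun j => cesaroNumber α j * g (m + j)) (f m))
    (hF : ∀ z : ℂ, ‖z‖ < 1 → HasSum (fun n => (f n : ℂ) * z ^ n) (F z)) :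
    HasCesaroCalculus α T F (cesaroOp α T fun n => (g n : ℂ)) :=
  ⟨fun n => f n, fun n => g n, ⟨hg, funext fun m => weylSum_ofReal (hfg m)⟩, hF,
    hasSum_cesaroOp hC hg⟩

/-- The function 1-z is itself a regularizer. Any other one gives the same relation, by commuting it
past I-T and cancelling its injective operator. -/
theorem hasLogOneSub_iff (hα : 0 ≤ α)
    (hC : ∀ n, ‖cesaroElem α T n‖ ≤ C * cesaroNumber (α + 1) n)
    (hinj : Function.Injective (1 - T : X →L[ℂ] X)) {x y : X} :
    HasLogOneSub α T x y ↔
      (1 - T) y = cesaroOp α T (fun n => (mulLogWeyl α n : ℂ)) x := by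
  constructor
  · rintro ⟨F, E, S, ⟨f₁, g₁, ⟨hs₁, rfl⟩, hF₁, hE⟩, ⟨f₂, g₂, ⟨hs₂, rfl⟩, hF₂, hS⟩, hEinj, hxy⟩
    obtain rfl : cesaroOp α T g₁ = E := hE.tsum_eq
    obtain rfl : cesaroOp α T g₂ = S := hS.tsum_eq
    apply hEinj
    have h1 := commute_cesaroOp hα hC hs₁ (summable_norm_oneSubWeyl α)
    have h2 : cesaroOp α T (fun n => (oneSubWeyl α n : ℂ)) * cesaroOp α T g₂
        -- Both products represent F(z)(1-z)log(1-z).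
        = cesaroOp α T g₁ * cesaroOp α T (fun n => (mulLogWeyl α n : ℂ)) := by
      refine tsum_smul_cesaroElem_mul_congr hα hC (summable_norm_oneSubWeyl α) hs₂ hs₁
        (summable_norm_mulLogWeyl hα) fun m => ?_
      simp only [weylSum_ofReal (hasSum_cesaroNumber_mul_mulLogWeyl hα _),
        weylSum_ofReal (hasSum_cesaroNumber_mul_oneSubWeyl α _)]
      refine congrFun (eq_of_hasSum_mul_pow
        (b := fun m => ∑ p ∈ Finset.HasAntidiagonal.antidiagonal m,
          weylSum α g₁ p.1 * (mulLogCoeff p.2 : ℂ)) (fun z hz => hasSum_sum_antidiagonal_mul_pow (hasSum_oneSub z) (hF₂ z hz))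
        fun z hz => ?_) m
      have h := hasSum_sum_antidiagonal_mul_pow (hF₁ z hz) (hasSum_mulLogCoeff hz)
      rw [show (1 - z) * (F z * Complex.log (1 - z)) = F z * ((1 - z) * Complex.log (1 - z)) by
        ring]
      exact h
    rw [cesaroOp_oneSubWeyl] at h1 h2
    calc cesaroOp α T g₁ ((1 - T) y) = (1 - T) (cesaroOp α T g₁ y) :=
        congrArg (fun R : X →L[ℂ] X => R y) h1
      _ = (1 - T) (cesaroOp α T g₂ x) := by rw [hxy]
      _ = _ := congrArg (fun R : X →L[ℂ] X => R x) h2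
  · intro h
    refine ⟨fun z => 1 - z, 1 - T, _, ?_, hasCesaroCalculus_of_hasSum hC
      (summable_norm_mulLogWeyl hα) (hasSum_cesaroNumber_mul_mulLogWeyl hα)
      fun z hz => hasSum_mulLogCoeff hz, hinj, h⟩
    rw [← cesaroOp_oneSubWeyl α T]
    exact hasCesaroCalculus_of_hasSum hC (summable_norm_oneSubWeyl α)
      (hasSum_cesaroNumber_mul_oneSubWeyl α) fun z _ => hasSum_oneSub z

theorem tendsto_one_sub_apply_logPartialSum (hα : 0 ≤ α)
    (hC : ∀ n, ‖cesaroElem α T n‖ ≤ C * cesaroNumber (α + 1) n) (x : X) :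
    Tendsto (fun N => (1 - T) ((logConst α : ℂ) • x - logPartialSum α T N x)) atTop
      (𝓝 (cesaroOp α T (fun n => (mulLogWeyl α n : ℂ)) x)) :=
  (((ContinuousLinearMap.apply ℂ X x).continuous.tendsto _).comp
    (tendsto_one_sub_mul_logPartialSum hα hC))

/-- Weak convergence of the logarithmic series at `x` puts `x` in the domain of the logarithm. -/
theorem hasLogOneSub_of_tendsto (hα : 0 ≤ α)
    (hC : ∀ n, ‖cesaroElem α T n‖ ≤ C * cesaroNumber (α + 1) n)
    (hinj : Function.Injective (1 - T : X →L[ℂ] X)) {x s : X}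
    (h : ∀ φ : X →L[ℂ] ℂ, Tendsto (fun N => φ (logPartialSum α T N x)) atTop (𝓝 (φ s))) :
    HasLogOneSub α T x ((logConst α : ℂ) • x - s) := by
  rw [hasLogOneSub_iff hα hC hinj, SeparatingDual.eq_iff_forall_dual_eq (R := ℂ)]
  intro φ
  refine tendsto_nhds_unique ?_ ((φ.continuous.tendsto _).comp
    (tendsto_one_sub_apply_logPartialSum hα hC x))
  -- Testing the weak limit against φ ∘ (I-T) makes it comparable with the norm limit of (I-T)(c x -
  -- S_N x).
  have h1 := (h (φ.comp (1 - T))).const_sub (φ.comp (1 - T) ((logConst α : ℂ) • x))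
  rw [← map_sub] at h1
  refine h1.congr fun N => ?_
  rw [← map_sub]
  rfl

/-- On the domain of the logarithm the logarithmic series converges in norm. -/
theorem exists_tendsto_logPartialSum (hα : 0 ≤ α) (hC0 : 0 ≤ C)
    (hC : ∀ n, ‖cesaroElem α T n‖ ≤ C * cesaroNumber (α + 1) n)
    (hran : DenseRange fun v : X => v - T v) {x y : X} (h : HasLogOneSub α T x y) :
    ∃ s, Tendsto (fun N => logPartialSum α T N x) atTop (𝓝 s) := by
  have hinj := injective_one_sub hα hC hran
  rw [hasLogOneSub_iff hα hC hinj] at h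
  set U := cesaroOp α T fun n => (logKernelWeyl α n : ℂ) with hU
  have hsU := summable_norm_logKernelWeyl hα
  have hU1 : U * (1 - T) = (1 - T) * U := by
    rw [hU, ← cesaroOp_oneSubWeyl α T]
    exact commute_cesaroOp hα hC hsU (summable_norm_oneSubWeyl α)
  have hUS : ∀ N, logPartialSum α T N * U = U * logPartialSum α T N := by
    intro N
    rw [hU, ← cesaroOp_truncWeight]
    exact commute_cesaroOp hα hC (summable_norm_truncWeight α N) hsU
  have hS1 : ∀ N v, logPartialSum α T N ((1 - T) v) = (1 - T) (logPartialSum α T N v) := by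
    intro N v
    have h1 := commute_cesaroOp hα hC (summable_norm_truncWeight α N) (summable_norm_oneSubWeyl α)
    rw [cesaroOp_oneSubWeyl, cesaroOp_truncWeight] at h1
    exact congrArg (fun R : X →L[ℂ] X => R v) h1
  have hconv : ∀ v, ∃ w, Tendsto (fun N => (1 - T) (logPartialSum α T N v)) atTop (𝓝 w) := by
    intro v
    refine ⟨_, ((tendsto_one_sub_apply_logPartialSum hα hC v).const_sub
      ((1 - T) ((logConst α : ℂ) • v))).congr fun N => ?_⟩
    rw [map_sub]
    abel
  -- This is u log(1-z) = -z on the domain of the logarithm: apply I-T to both sides and use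
  -- u(z)·(1-z)log(1-z) = -z(1-z).
  have hUy : U y = -T x := by
    apply hinj
    have h1 : (1 - T) (U y) = U ((1 - T) y) := (congrArg (fun R : X →L[ℂ] X => R y) hU1).symm
    have h2 : U (cesaroOp α T (fun n => (mulLogWeyl α n : ℂ)) x) = (-T * (1 - T)) x :=
      congrArg (fun R : X →L[ℂ] X => R x) (cesaroOp_logKernelWeyl_mul hα hC)
    rw [h1, h, h2]
    simp
    abel
  obtain ⟨K, hK⟩ := exists_norm_logPartialSum_mul_le hα hC0 hC
  -- On the dense range, S_N U (I-T)v = U (I-T) S_N v, which converges; the uniform bound extends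
  -- this to y.
  obtain ⟨w, hw⟩ := exists_tendsto_of_denseRange hK hran (fun v => by
    obtain ⟨w, hw⟩ := hconv v
    refine ⟨U w, ((U.continuous.tendsto w).comp hw).congr fun N => ?_⟩
    rw [Function.comp_apply, ← hS1]
    exact (congrArg (fun R : X →L[ℂ] X => R (v - T v)) (hUS N)).symm) y
  obtain ⟨w', hw'⟩ := hconv x
  -- S_N x = (I-T) S_N x + S_N T x, and S_N T x = -S_N U y.
  refine ⟨_, (hw'.sub hw).congr fun N => ?_⟩
  have h3 : (logPartialSum α T N * U) y = -logPartialSum α T N (T x) := by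
    rw [← map_neg, ← hUy]
    rfl
  rw [← hU, h3, ← hS1]
  simp

end Logarithm

/-! ### Passage to the weights n^{-1-α}, and the theorem. -/

section Transfer

variable {X : Type*} [NormedAddCommGroup X] [NormedSpace ℂ X] [CompleteSpace X] {α C : ℝ}
  {T : X →L[ℂ] X}

/-- The partial sums of the series with weights `n^{-(1+α)}` and those of the logarithmic series
differ, up to the factor `Γ(α+1)`, by a norm convergent sequence. -/
theorem exists_tendsto_sum_sub_logPartialSum (hα : 0 ≤ α)
    (hC : ∀ n, ‖cesaroElem α T n‖ ≤ C * cesaroNumber (α + 1) n) (x : X) :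
    ∃ d, Tendsto (fun N : ℕ => ∑ n ∈ Finset.Icc 1 N,
      ((1 / (n : ℝ) ^ (1 + α) : ℝ) : ℂ) • cesaroSum α T n x
        - ((Real.Gamma (α + 1))⁻¹ : ℂ) • logPartialSum α T N x) atTop (𝓝 d) := by
  set δ : ℕ → ℂ := fun n =>
    ((1 / (n : ℝ) ^ (1 + α) - cesaroWeight α n / Real.Gamma (α + 1) : ℝ) : ℂ) with hδ
  have hs : Summable fun n => ‖δ n‖ * cesaroNumber (α + 1) n := by
    simpa only [hδ, Complex.norm_real, Real.norm_eq_abs] using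
      summable_abs_one_div_rpow_sub_cesaroWeight hα
  have h1 := (((ContinuousLinearMap.apply ℂ X x).continuous.tendsto _).comp
    ((hasSum_cesaroOp hC hs).tendsto_sum_nat.comp (tendsto_add_atTop_nat 1))).sub_const
    (δ 0 • cesaroElem α T 0 x)
  refine ⟨_, h1.congr fun N => ?_⟩
  have e : logPartialSum α T N x
      = ∑ n ∈ Finset.Icc 1 N, (cesaroWeight α n : ℂ) • cesaroSum α T n x := by
    rw [logPartialSum, sum_apply]
    rfl
  have e2 : (ContinuousLinearMap.apply ℂ X x)
      (∑ n ∈ Finset.range (N + 1), δ n • cesaroElem α T n)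
        = ∑ n ∈ Finset.range (N + 1), δ n • cesaroElem α T n x := by
    rw [map_sum]
    rfl
  simp only [Function.comp_apply]
  rw [e2, e, Finset.range_eq_Ico, Finset.sum_eq_sum_Ico_succ_bot (by omega), add_sub_cancel_left,
    Finset.smul_sum, ← Finset.sum_sub_distrib]
  refine Finset.sum_congr (by ext; simp) fun n _ => ?_
  rw [smul_smul, ← sub_smul, hδ]
  congr 1
  push_cast
  ring

end Transfer

theorem theorem8p5 {X : Type*} [NormedAddCommGroup X] [NormedSpace ℂ X] [CompleteSpace X]
    (α : ℝ) (hα : 0 ≤ α) (T : X →L[ℂ] X) (hT : IsCesaroBounded α T)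
    (hran : DenseRange (fun v : X => v - T v)) (x : X) :
    (MemDomLogOneSub α T x ↔
      ∃ w : X, SeriesConvergesTo
        (fun n : ℕ => ((1 / (n : ℝ) ^ (1 + α) : ℝ) : ℂ) • cesaroSum α T n x) w) ∧
    (MemDomLogOneSub α T x ↔
      ∃ w : X, SeriesConvergesWeaklyTo
        (fun n : ℕ => ((1 / (n : ℝ) ^ (1 + α) : ℝ) : ℂ) • cesaroSum α T n x) w) ∧
    (MemDomLogOneSub α T x →
      ∃ s : X,
        SeriesConvergesTo
          (fun n : ℕ =>
            ((Real.Gamma (α + 1) * Real.Gamma (n : ℝ) / Real.Gamma ((n : ℝ) + α + 1) : ℝ) : ℂ) •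
              cesaroSum α T n x) s ∧
        ∀ y : X, HasLogOneSub α T x y ↔
          y = ((∫ u in (0 : ℝ)..1, (1 - u ^ α) / (1 - u) : ℝ) : ℂ) • x - s) := by
  obtain ⟨C, hC0, hC⟩ := hT.exists_norm_cesaroElem_le hα
  have hinj := injective_one_sub hα hC hran
  obtain ⟨d, hd⟩ := exists_tendsto_sum_sub_logPartialSum hα hC x
  have hΓ : ((Real.Gamma (α + 1) : ℝ) : ℂ) ≠ 0 := by
    exact_mod_cast (Real.Gamma_pos_of_pos (by linarith : 0 < α + 1)).ne'
  have hnorm : MemDomLogOneSub α T x → ∃ w : X, SeriesConvergesTo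
      (fun n : ℕ => ((1 / (n : ℝ) ^ (1 + α) : ℝ) : ℂ) • cesaroSum α T n x) w := by
    rintro ⟨y, hy⟩
    obtain ⟨s, hs⟩ := exists_tendsto_logPartialSum hα hC0 hC hran hy
    refine ⟨_, (hd.add (hs.const_smul ((Real.Gamma (α + 1))⁻¹ : ℂ))).congr fun N => ?_⟩
    rw [sub_add_cancel]
  have hweak : ∀ w : X, SeriesConvergesTo
      (fun n : ℕ => ((1 / (n : ℝ) ^ (1 + α) : ℝ) : ℂ) • cesaroSum α T n x) w →
      SeriesConvergesWeaklyTo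
      (fun n : ℕ => ((1 / (n : ℝ) ^ (1 + α) : ℝ) : ℂ) • cesaroSum α T n x) w :=
    fun w hw φ => (φ.continuous.tendsto w).comp hw
  have hdom : (∃ w : X, SeriesConvergesWeaklyTo
      (fun n : ℕ => ((1 / (n : ℝ) ^ (1 + α) : ℝ) : ℂ) • cesaroSum α T n x) w) →
      MemDomLogOneSub α T x := by
    rintro ⟨w, hw⟩
    refine ⟨_, hasLogOneSub_of_tendsto hα hC hinj
      -- Since d is the limit of the n^{-1-α} sums minus S_N x/Γ(α+1), the weak limit of S_N x is
      -- Γ(α+1)(w - d).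
      (s := (Real.Gamma (α + 1) : ℂ) • (w - d)) fun φ => ?_⟩
    have h1 := ((hw φ).sub ((φ.continuous.tendsto d).comp hd)).const_smul
      (Real.Gamma (α + 1) : ℂ)
    rw [← map_sub, ← map_smul] at h1
    refine h1.congr fun N => ?_
    rw [Function.comp_apply, ← map_sub, ← map_smul, sub_sub_cancel, smul_inv_smul₀ hΓ]
  refine ⟨⟨hnorm, fun ⟨w, hw⟩ => hdom ⟨w, hweak w hw⟩⟩,
    ⟨fun h => (hnorm h).imp hweak, hdom⟩, ?_⟩
  rintro ⟨y, hy⟩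
  obtain ⟨s, hs⟩ := exists_tendsto_logPartialSum hα hC0 hC hran hy
  have hlog := hasLogOneSub_of_tendsto hα hC hinj fun φ => (φ.continuous.tendsto s).comp hs
  refine ⟨s, ?_, fun y' => ⟨fun hy' => ?_, ?_⟩⟩
  · refine hs.congr fun N => ?_
    rw [logPartialSum, sum_apply]
    refine Finset.sum_congr rfl fun n _ => ?_
    rw [cesaroWeight_eq_Gamma hα]
    rfl
  · rw [hasLogOneSub_iff hα hC hinj] at hy' hlog
    exact hinj (hy'.trans hlog.symm)
  · rintro rfl
    exact hlog
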